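/- Let $k$ be $\mathbb{R}$ or $\mathbb{C}$ and let $G$ be a (discrete) group. Let $\mathbf{Ban}$ be the category of Banach spaces over $k$ with continuous linear maps, and $G\text{-}\mathbf{Ban}$ the category of isometric representations of $G$ on Banach spaces with $G$-equivariant continuous linear maps. Both are quasi-abelian, and $\mathbf{D}, \mathbf{D}^{-}, \mathbf{D}^{+}$ denote their (bounded above, bounded below) derived categories, obtained by inverting the chain maps whose mapping cone is strictly exact. For $M \in G\text{-}\mathbf{Ban}$ let $M_G$ be the quotient of $M$ by the closed linear span of all $m - gm$, and let $M^G$ be the subspace of $G$-invariant vectors. For a complex $A^\bullet$ in $\mathbf{Ban}$ put $$\tau_\ell^{\le 0}A = (\cdots \to A^{-1} \to \operatorname{Ker} d^0 \to 0 \to \cdots), \qquad \tau_\ell^{\ge 0}A = (\cdots \to 0 \to \operatorname{Coim} d^{-1} \to A^0 \to A^1 \to \cdots),$$ $$\tau_r^{\le 0}A = (\cdots \to A^{-1} \to A^0 \to \operatorname{Im} d^0 \to 0 \to \cdots), \qquad \tau_r^{\ge 0}A = (\cdots \to 0 \to \operatorname{Coker} d^{-1} \to A^1 \to A^2 \to \cdots),$$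 where $\operatorname{Im} d$ is the closure of the range of $d$, $\operatorname{Coim} d$ is the source of $d$ modulo its kernel, and $\operatorname{Coker} d$ is the target of $d$ modulo the closure of the range. These are endofunctors of $\mathbf{D}(\mathbf{Ban})$. For $s \in \{\ell, r\}$ the left ($s=\ell$) and right ($s=r$) heart $\mathcal{C}_s(\mathbf{Ban})$ is the full subcategory of $\mathbf{D}(\mathbf{Ban})$ of objects that lie in the essential images of both $\tau_s^{\le 0}$ and $\tau_s^{\ge 0}$, and $H_s^n = \tau_s^{\le 0}\tau_s^{\ge 0}\Sigma^n : \mathbf{D}(\mathbf{Ban}) \to \mathcal{C}_s(\mathbf{Ban})$, where $\Sigma$ is the shift. The Banach dual induces a contravariant endofunctor of $\mathbf{D}(\mathbf{Ban})$, which restricts to the contravariant duality functor $(-)^* : \mathcal{C}_r(\mathbf{Ban}) \to \mathcal{C}_\ell(\mathbf{Ban})$, $(e : A \to B) \mapsto (e^* : B^* \to A^*)$. For $M \in G\text{-}\mathbf{Ban}$ the dual $M^*$ carries the contragredient action. **Theorem.** The total derived functors $\mathbf{L}^{-}(-)_G : \mathbf{D}^{-}(G\text{-}\mathbf{Ban})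 \to \mathbf{D}^{-}(\mathbf{Ban})$ and $\mathbf{R}^{+}(-)^G : \mathbf{D}^{+}(G\text{-}\mathbf{Ban}) \to \mathbf{D}^{+}(\mathbf{Ban})$ exist. Define $\ell^1$-homology and bounded cohomology of $G$ with coefficients in $M \in G\text{-}\mathbf{Ban}$ by $$\mathcal{H}^{\ell^1}_n(G,M) = H_r^{-n}\bigl(\mathbf{L}^{-}(-)_G(M)\bigr) \in \mathcal{C}_r(\mathbf{Ban}), \qquad \mathcal{H}_b^n(G,M) = H_\ell^{n}\bigl(\mathbf{R}^{+}(-)^G(M)\bigr) \in \mathcal{C}_\ell(\mathbf{Ban}).$$ Then for every $n \in \mathbb{Z}$ the duality functor $(-)^* : \mathcal{C}_r(\mathbf{Ban}) \to \mathcal{C}_\ell(\mathbf{Ban})$ yields an isomorphism $$\bigl(\mathcal{H}^{\ell^1}_n(G,M)\bigr)^* \cong \mathcal{H}_b^n(G,M^*)$$ that is natural in $M \in G\text{-}\mathbf{Ban}$. -/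

import Mathlib

open CategoryTheory Limits

universe u

namespace BanachDuality

noncomputable section

/-! ### Banach spaces and isometric Banach representations -/

/-- A Banach space over the ground field `k` (which is `ℝ` or `ℂ`). -/
structure Ban (k : Type) [RCLike k] : Type (u + 1) where
  carrier : Type u
  [instGroup : NormedAddCommGroup carrier]
  [instSpace : NormedSpace k carrier]
  [instComplete : CompleteSpace carrier]

/-- An isometric representation of the (discrete) group `G` on a Banach space over `k`. -/
structure GBan (k : Type) [RCLike k] (G : Type u) [Group G] : Type (u + 1) where
  carrier : Type u
  [instGroup : NormedAddCommGroup carrier]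
  [instSpace : NormedSpace k carrier]
  [instComplete : CompleteSpace carrier]
  ρ : G →* (carrier ≃ₗᵢ[k] carrier)

variable {k : Type} [RCLike k] {G : Type u} [Group G]

instance : CoeSort (Ban.{u} k) (Type u) := ⟨Ban.carrier⟩
instance : CoeSort (GBan k G) (Type u) := ⟨GBan.carrier⟩

attribute [instance] Ban.instGroup Ban.instSpace Ban.instComplete
attribute [instance] GBan.instGroup GBan.instSpace GBan.instComplete

/-- Morphisms of Banach spaces: continuous linear maps. -/
@[ext]
structure Ban.Hom (E F : Ban.{u} k) : Type u where
  clm : E →L[k] F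

/-- Morphisms of representations: equivariant continuous linear maps. -/
@[ext]
structure GBan.Hom (M N : GBan k G) : Type u where
  clm : M →L[k] N
  equivariant : ∀ (g : G) (m : M), clm (M.ρ g m) = N.ρ g (clm m)

namespace Ban

instance : Category (Ban.{u} k) where
  Hom E F := Ban.Hom E F
  id E := ⟨ContinuousLinearMap.id k E⟩
  comp f g := ⟨g.clm.comp f.clm⟩

@[ext] lemma hom_ext {E F : Ban.{u} k} {f g : E ⟶ F} (h : ∀ x, f.clm x = g.clm x) : f = g :=
  Ban.Hom.ext (ContinuousLinearMap.ext h)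

@[simp] lemma id_apply (E : Ban.{u} k) (x : E) : (𝟙 E : E ⟶ E).clm x = x := rfl
@[simp] lemma comp_apply {E F H : Ban.{u} k} (f : E ⟶ F) (g : F ⟶ H) (x : E) :
    (f ≫ g).clm x = g.clm (f.clm x) := rfl

variable (E F : Ban.{u} k)
instance : Zero (E ⟶ F) := ⟨⟨0⟩⟩
instance : Add (E ⟶ F) := ⟨fun f g => ⟨f.clm + g.clm⟩⟩
instance : Neg (E ⟶ F) := ⟨fun f => ⟨-f.clm⟩⟩
instance : Sub (E ⟶ F) := ⟨fun f g => ⟨f.clm - g.clm⟩⟩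
instance : SMul ℕ (E ⟶ F) := ⟨fun n f => ⟨n • f.clm⟩⟩
instance : SMul ℤ (E ⟶ F) := ⟨fun n f => ⟨n • f.clm⟩⟩

instance : AddCommGroup (E ⟶ F) :=
  Function.Injective.addCommGroup (fun f : E ⟶ F => f.clm)
    (fun _ _ h => Ban.Hom.ext h) rfl (fun _ _ => rfl) (fun _ => rfl) (fun _ _ => rfl)
    (fun _ _ => rfl) (fun _ _ => rfl)

variable {E F}
@[simp] lemma zero_apply (x : E) : (0 : E ⟶ F).clm x = 0 := rfl
@[simp] lemma add_apply (f g : E ⟶ F) (x : E) : (f + g).clm x = f.clm x + g.clm x := rfl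
@[simp] lemma neg_apply (f : E ⟶ F) (x : E) : (-f).clm x = -f.clm x := rfl
@[simp] lemma sub_apply (f g : E ⟶ F) (x : E) : (f - g).clm x = f.clm x - g.clm x := rfl
@[simp] lemma zsmul_apply (n : ℤ) (f : E ⟶ F) (x : E) : (n • f).clm x = n • f.clm x := rfl

instance : Preadditive (Ban.{u} k) where
  add_comp _ _ _ f f' g := by ext x; simp
  comp_add _ _ _ f g g' := by ext x; simp

/-- The biproduct of two Banach spaces is their product. -/
instance : HasBinaryBiproducts (Ban.{u} k) where
  has_binary_biproduct E F := HasBinaryBiproduct.mk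
    { bicone :=
        { pt := ⟨E × F⟩
          fst := ⟨ContinuousLinearMap.fst k E F⟩
          snd := ⟨ContinuousLinearMap.snd k E F⟩
          inl := ⟨ContinuousLinearMap.inl k E F⟩
          inr := ⟨ContinuousLinearMap.inr k E F⟩
          inl_fst := by ext x; rfl
          inl_snd := by ext x; rfl
          inr_fst := by ext x; rfl
          inr_snd := by ext x; rfl }
      isBilimit := isBinaryBilimitOfTotal _ (by
        refine Ban.hom_ext fun x => Prod.ext ?_ ?_
        · exact add_zero x.1
        · exact zero_add x.2) }

end Ban

namespace GBan

instance : Category (GBan k G) where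
  Hom M N := GBan.Hom M N
  id M := ⟨ContinuousLinearMap.id k M, fun _ _ => rfl⟩
  comp f g := ⟨g.clm.comp f.clm, fun a m => by simp [f.equivariant, g.equivariant]⟩

@[ext] lemma hom_ext {M N : GBan k G} {f g : M ⟶ N} (h : ∀ x, f.clm x = g.clm x) : f = g :=
  GBan.Hom.ext (ContinuousLinearMap.ext h)

@[simp] lemma id_apply (M : GBan k G) (x : M) : (𝟙 M : M ⟶ M).clm x = x := rfl
@[simp] lemma comp_apply {M N P : GBan k G} (f : M ⟶ N) (g : N ⟶ P) (x : M) :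
    (f ≫ g).clm x = g.clm (f.clm x) := rfl

variable (M N : GBan k G)
instance : Zero (M ⟶ N) := ⟨⟨0, by simp⟩⟩
instance : Add (M ⟶ N) := ⟨fun f g => ⟨f.clm + g.clm, by simp [f.equivariant, g.equivariant]⟩⟩
instance : Neg (M ⟶ N) := ⟨fun f => ⟨-f.clm, by simp [f.equivariant]⟩⟩
instance : Sub (M ⟶ N) := ⟨fun f g => ⟨f.clm - g.clm, by simp [f.equivariant, g.equivariant]⟩⟩
instance : SMul ℕ (M ⟶ N) := ⟨fun n f => ⟨n • f.clm, by simp [f.equivariant]⟩⟩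
instance : SMul ℤ (M ⟶ N) := ⟨fun n f => ⟨n • f.clm, by simp [f.equivariant]⟩⟩

instance : AddCommGroup (M ⟶ N) :=
  Function.Injective.addCommGroup (fun f : M ⟶ N => f.clm)
    (fun _ _ h => GBan.Hom.ext h) rfl (fun _ _ => rfl) (fun _ => rfl) (fun _ _ => rfl)
    (fun _ _ => rfl) (fun _ _ => rfl)

variable {M N}
@[simp] lemma zero_apply (x : M) : (0 : M ⟶ N).clm x = 0 := rfl
@[simp] lemma add_apply (f g : M ⟶ N) (x : M) : (f + g).clm x = f.clm x + g.clm x := rfl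

instance : Preadditive (GBan k G) where
  add_comp _ _ _ f f' g := by ext x; simp
  comp_add _ _ _ f g g' := by ext x; simp

/-- The product of two representations, with the diagonal action. -/
def prod (M N : GBan k G) : GBan k G where
  carrier := M × N
  ρ :=
    { toFun := fun g =>
        { toLinearEquiv := (M.ρ g).toLinearEquiv.prodCongr (N.ρ g).toLinearEquiv
          norm_map' := fun x => by
            change max ‖M.ρ g x.1‖ ‖N.ρ g x.2‖ = max ‖x.1‖ ‖x.2‖
            simp }
      map_one' := by
        ext x <;> simp
      map_mul' := fun g h => by
        ext x <;> simp }

/-- The biproduct of two representations is their product. -/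
instance : HasBinaryBiproducts (GBan k G) where
  has_binary_biproduct M N := HasBinaryBiproduct.mk
    { bicone :=
        { pt := prod M N
          fst := ⟨ContinuousLinearMap.fst k M N, fun _ _ => rfl⟩
          snd := ⟨ContinuousLinearMap.snd k M N, fun _ _ => rfl⟩
          inl := ⟨ContinuousLinearMap.inl k M N,
            fun g m => Prod.ext rfl (map_zero (N.ρ g)).symm⟩
          inr := ⟨ContinuousLinearMap.inr k M N,
            fun g m => Prod.ext (map_zero (M.ρ g)).symm rfl⟩
          inl_fst := by ext x; rfl
          inl_snd := by ext x; rfl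
          inr_fst := by ext x; rfl
          inr_snd := by ext x; rfl }
      isBilimit := isBinaryBilimitOfTotal _ (by
        refine GBan.hom_ext fun x => Prod.ext ?_ ?_
        · exact add_zero x.1
        · exact zero_add x.2) }

instance : HasZeroObject (GBan k G) :=
  ⟨⟨⟨PUnit, 1⟩, by
    rw [IsZero.iff_id_eq_zero]
    ext x⟩⟩

end GBan

/-! ### Coinvariants, invariants and duals -/

namespace GBan

/-- The closed linear span of all `m - g m`. -/
def coinvariantsKer (M : GBan k G) : Submodule k M :=
  (Submodule.span k {x : M | ∃ (m : M) (g : G), x = m - M.ρ g m}).topologicalClosure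

instance (M : GBan k G) : IsClosed (M.coinvariantsKer : Set M) :=
  Submodule.isClosed_topologicalClosure _

/-- The subspace of `G`-invariant vectors. -/
def invariantsSubmodule (M : GBan k G) : Submodule k M where
  carrier := {m | ∀ g : G, M.ρ g m = m}
  add_mem' h h' g := by rw [map_add, h g, h' g]
  zero_mem' g := map_zero _
  smul_mem' c m h g := by rw [map_smul, h g]

lemma isClosed_invariants (M : GBan k G) : IsClosed (M.invariantsSubmodule : Set M) := by
  have : (M.invariantsSubmodule : Set M) = ⋂ g : G, {m | M.ρ g m = m} := by
    ext m; simp [invariantsSubmodule]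
  rw [this]
  exact isClosed_iInter fun g => isClosed_eq (M.ρ g).continuous continuous_id

instance (M : GBan k G) : CompleteSpace M.invariantsSubmodule :=
  M.isClosed_invariants.completeSpace_coe

lemma map_coinvariantsKer {M N : GBan k G} (f : M ⟶ N) :
    M.coinvariantsKer ≤ N.coinvariantsKer.comap (f.clm : M →ₗ[k] N) := by
  refine Submodule.topologicalClosure_minimal _ ?_
    ((Submodule.isClosed_topologicalClosure _).preimage f.clm.continuous)
  rw [Submodule.span_le]
  rintro _ ⟨m, g, rfl⟩
  refine Submodule.le_topologicalClosure _ (Submodule.subset_span ⟨f.clm m, g, ?_⟩)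
  simp [f.equivariant]

end GBan

/-- The continuous linear map between quotients induced by a continuous linear map. -/
def quotMap {E F : Type u} [NormedAddCommGroup E] [NormedSpace k E] [NormedAddCommGroup F]
    [NormedSpace k F] (S : Submodule k E) (T : Submodule k F)
    (f : E →L[k] F) (h : S ≤ T.comap (f : E →ₗ[k] F)) : (E ⧸ S) →L[k] (F ⧸ T) where
  toLinearMap := Submodule.mapQ S T (f : E →ₗ[k] F) h
  cont := by
    refine (Submodule.isOpenQuotientMap_mkQ S).isQuotientMap.continuous_iff.2 ?_
    exact (Submodule.isOpenQuotientMap_mkQ T).continuous.comp f.continuous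

@[simp] lemma quotMap_mk {E F : Type u} [NormedAddCommGroup E] [NormedSpace k E]
    [NormedAddCommGroup F] [NormedSpace k F] (S : Submodule k E) (T : Submodule k F)
    (f : E →L[k] F) (h : S ≤ T.comap (f : E →ₗ[k] F)) (x : E) :
    quotMap S T f h (Submodule.Quotient.mk x) = Submodule.Quotient.mk (f x) := rfl

variable (k G) in
/-- The coinvariants functor: `M ↦ M_G`, the quotient of `M` by the closed linear span of
all `m - g m`. -/
@[simps]
def coinvariants : GBan k G ⥤ Ban.{u} k where
  obj M := ⟨M ⧸ M.coinvariantsKer⟩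
  map f := ⟨quotMap _ _ f.clm (GBan.map_coinvariantsKer f)⟩
  map_id M := by
    ext x; obtain ⟨x, rfl⟩ := Submodule.Quotient.mk_surjective _ x; rfl
  map_comp f g := by
    ext x; obtain ⟨x, rfl⟩ := Submodule.Quotient.mk_surjective _ x; rfl

instance : (coinvariants k G).Additive where
  map_add {M N f g} := by
    ext x; obtain ⟨x, rfl⟩ := Submodule.Quotient.mk_surjective _ x; rfl

variable (k G) in
/-- The invariants functor: `M ↦ M^G`. -/
@[simps]
def invariants : GBan k G ⥤ Ban.{u} k where
  obj M := ⟨M.invariantsSubmodule⟩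
  map {M N} f := ⟨(f.clm.comp M.invariantsSubmodule.subtypeL).codRestrict N.invariantsSubmodule
    (fun m g => by
      have := m.2 g
      change N.ρ g (f.clm m) = f.clm m
      rw [← f.equivariant, this])⟩
  map_id M := rfl
  map_comp f g := rfl

instance : (invariants k G).Additive where
  map_add := rfl

/-- The dual of a Banach space, with the operator norm. -/
abbrev Ban.dual (E : Ban.{u} k) : Ban.{u} k := ⟨E →L[k] k⟩

/-- The dual (transpose) of a morphism. -/
abbrev Ban.dualMap {E F : Ban.{u} k} (f : E ⟶ F) : F.dual ⟶ E.dual :=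
  ⟨(ContinuousLinearMap.compL k E F k).flip f.clm⟩

@[simp] lemma Ban.dualMap_apply {E F : Ban.{u} k} (f : E ⟶ F) (φ : F →L[k] k) (x : E) :
    ((Ban.dualMap f).clm φ : E →L[k] k) x = φ (f.clm x) := rfl

variable (k) in
/-- The (contravariant) duality functor on Banach spaces. -/
def dualBan : (Ban.{u} k)ᵒᵖ ⥤ Ban.{u} k where
  obj E := E.unop.dual
  map f := Ban.dualMap f.unop
  map_id _ := rfl
  map_comp _ _ := rfl

lemma GBan.ρ_inv_ρ (M : GBan k G) (g : G) (m : M) : M.ρ g⁻¹ (M.ρ g m) = m := by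
  rw [map_inv]; exact (M.ρ g).symm_apply_apply m

lemma GBan.ρ_ρ_inv (M : GBan k G) (g : G) (m : M) : M.ρ g (M.ρ g⁻¹ m) = m := by
  rw [map_inv]; exact (M.ρ g).apply_symm_apply m

/-- The contragredient action: `(g φ) m = φ (g⁻¹ m)`. -/
def GBan.contragredient (M : GBan k G) : G →* ((M →L[k] k) ≃ₗᵢ[k] (M →L[k] k)) where
  toFun g :=
    { toFun := fun φ => φ.comp ((M.ρ g⁻¹).toContinuousLinearEquiv : M →L[k] M)
      invFun := fun φ => φ.comp ((M.ρ g).toContinuousLinearEquiv : M →L[k] M)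
      map_add' := fun _ _ => rfl
      map_smul' := fun _ _ => rfl
      left_inv := fun φ => ContinuousLinearMap.ext fun m => congrArg φ (M.ρ_inv_ρ g m)
      right_inv := fun φ => ContinuousLinearMap.ext fun m => congrArg φ (M.ρ_ρ_inv g m)
      norm_map' := fun φ => ContinuousLinearMap.opNorm_comp_linearIsometryEquiv φ (M.ρ g⁻¹) }
  map_one' := by ext φ m; simp
  map_mul' g h := by ext φ m; simp

variable (k G) in
/-- The (contravariant) duality functor on isometric Banach representations. -/
def dualGBan : (GBan k G)ᵒᵖ ⥤ GBan k G where
  obj M := ⟨M.unop →L[k] k, M.unop.contragredient⟩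
  map {M N} f := ⟨(ContinuousLinearMap.compL k N.unop M.unop k).flip f.unop.clm, fun g φ => by
    ext m
    change φ (M.unop.ρ g⁻¹ (f.unop.clm m)) = φ (f.unop.clm (N.unop.ρ g⁻¹ m))
    rw [f.unop.equivariant]⟩
  map_id _ := rfl
  map_comp _ _ := rfl

/-! ### Derived categories of quasi-abelian categories -/

section Derived

variable (A : Type*) [Category* A] [Preadditive A]

variable {A} in
/-- Exactness of `X₁ ⟶ X₂ ⟶ X₃` with respect to the exact structure of all kernel-cokernel
pairs: the first map is a cokernel followed by a kernel of the second map. -/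
def StrictExact (S : ShortComplex A) : Prop :=
  ∃ (Z : A) (ι : Z ⟶ S.X₂) (w : ι ≫ S.g = 0) (π : S.X₁ ⟶ Z),
    Nonempty (IsLimit (KernelFork.ofι ι w)) ∧ Nonempty (NormalEpi π) ∧ π ≫ ι = S.f

/-- Acyclic (that is, strictly exact) cochain complexes. -/
def acyclic : ObjectProperty (CochainComplex A ℤ) :=
  fun K => ∀ n : ℤ, StrictExact (K.sc' (n - 1) n (n + 1))

variable [HasBinaryBiproducts A]

/-- Quasi-isomorphisms: chain maps whose mapping cone is acyclic. -/
def qis : MorphismProperty (CochainComplex A ℤ) :=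
  fun _ _ f => acyclic A (CochainComplex.mappingCone f)

/-- The derived category `D(A)`. -/
abbrev DCat := (qis A).Localization

/-- Cochain complexes that are bounded above. -/
def bddAbove : ObjectProperty (CochainComplex A ℤ) := fun K => ∃ n : ℤ, K.IsStrictlyLE n

/-- Cochain complexes that are bounded below. -/
def bddBelow : ObjectProperty (CochainComplex A ℤ) := fun K => ∃ n : ℤ, K.IsStrictlyGE n

/-- The category of bounded above complexes. -/
abbrev CMinus := (bddAbove A).FullSubcategory

/-- The category of bounded below complexes. -/
abbrev CPlus := (bddBelow A).FullSubcategory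

/-- Quasi-isomorphisms of bounded above complexes. -/
abbrev qisMinus : MorphismProperty (CMinus A) := (qis A).inverseImage (bddAbove A).ι

/-- Quasi-isomorphisms of bounded below complexes. -/
abbrev qisPlus : MorphismProperty (CPlus A) := (qis A).inverseImage (bddBelow A).ι

/-- The bounded above derived category `D⁻(A)`. -/
abbrev DMinus := (qisMinus A).Localization

/-- The bounded below derived category `D⁺(A)`. -/
abbrev DPlus := (qisPlus A).Localization

/-- The canonical functor `D⁻(A) ⥤ D(A)`. -/
def DMinus.toD : DMinus A ⥤ DCat A :=
  Localization.lift ((bddAbove A).ι ⋙ (qis A).Q)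
    (show (qisMinus A).IsInvertedBy _ from
      fun _ _ f hf => Localization.inverts (qis A).Q (qis A) ((bddAbove A).ι.map f) hf)
    (qisMinus A).Q

/-- The canonical functor `D⁺(A) ⥤ D(A)`. -/
def DPlus.toD : DPlus A ⥤ DCat A :=
  Localization.lift ((bddBelow A).ι ⋙ (qis A).Q)
    (show (qisPlus A).IsInvertedBy _ from
      fun _ _ f hf => Localization.inverts (qis A).Q (qis A) ((bddBelow A).ι.map f) hf)
    (qisPlus A).Q

variable [HasZeroObject A]

/-- An object as a bounded above complex concentrated in degree zero. -/
def CMinus.single : A ⥤ CMinus A :=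
  (bddAbove A).lift (CochainComplex.singleFunctor A 0) (fun _ => ⟨0, inferInstance⟩)

/-- An object as a bounded below complex concentrated in degree zero. -/
def CPlus.single : A ⥤ CPlus A :=
  (bddBelow A).lift (CochainComplex.singleFunctor A 0) (fun _ => ⟨0, inferInstance⟩)

variable {A}
variable {B : Type*} [Category* B] [Preadditive B] [HasBinaryBiproducts B]

/-- Degreewise extension of an additive functor to bounded above complexes. -/
def mapCMinus (F : A ⥤ B) [F.Additive] : CMinus A ⥤ CMinus B :=
  (bddAbove B).lift ((bddAbove A).ι ⋙ F.mapHomologicalComplex (ComplexShape.up ℤ)) (fun K => by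
    obtain ⟨n, hn⟩ := K.property
    refine ⟨n, ?_⟩
    dsimp
    infer_instance)

/-- Degreewise extension of an additive functor to bounded below complexes. -/
def mapCPlus (F : A ⥤ B) [F.Additive] : CPlus A ⥤ CPlus B :=
  (bddBelow B).lift ((bddBelow A).ι ⋙ F.mapHomologicalComplex (ComplexShape.up ℤ)) (fun K => by
    obtain ⟨n, hn⟩ := K.property
    refine ⟨n, ?_⟩
    dsimp
    infer_instance)

/-- `F` has a total left derived functor `D⁻(A) ⥤ D⁻(B)`, that is, the right Kan extension of
`C⁻(A) ⥤ C⁻(B) ⥤ D⁻(B)` along `C⁻(A) ⥤ D⁻(A)` exists. -/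
abbrev HasL (F : A ⥤ B) [F.Additive] : Prop :=
  (mapCMinus F ⋙ (qisMinus B).Q).HasLeftDerivedFunctor (qisMinus A)

/-- `F` has a total right derived functor `D⁺(A) ⥤ D⁺(B)`, that is, the left Kan extension of
`C⁺(A) ⥤ C⁺(B) ⥤ D⁺(B)` along `C⁺(A) ⥤ D⁺(A)` exists. -/
abbrev HasR (F : A ⥤ B) [F.Additive] : Prop :=
  (mapCPlus F ⋙ (qisPlus B).Q).HasRightDerivedFunctor (qisPlus A)

/-- The total left derived functor `L⁻F : D⁻(A) ⥤ D⁻(B)`. -/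
def leftDerivedMinus (F : A ⥤ B) [F.Additive] [HasL F] : DMinus A ⥤ DMinus B :=
  (mapCMinus F ⋙ (qisMinus B).Q).totalLeftDerived (qisMinus A).Q (qisMinus A)

/-- The total right derived functor `R⁺F : D⁺(A) ⥤ D⁺(B)`. -/
def rightDerivedPlus (F : A ⥤ B) [F.Additive] [HasR F] : DPlus A ⥤ DPlus B :=
  (mapCPlus F ⋙ (qisPlus B).Q).totalRightDerived (qisPlus A).Q (qisPlus A)

end Derived

/-! ### Exactness and quasi-isomorphisms of Banach spaces in terms of elements -/

namespace Ban

/-- A closed subspace as an object. -/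
abbrev sub (E : Ban.{u} k) (S : Submodule k E) (hS : IsClosed (S : Set E)) : Ban.{u} k :=
  haveI : CompleteSpace S := hS.completeSpace_coe
  ⟨S⟩

/-- The quotient by a closed subspace as an object. -/
abbrev quot (E : Ban.{u} k) (S : Submodule k E) (hS : IsClosed (S : Set E)) : Ban.{u} k :=
  haveI := hS
  ⟨E ⧸ S⟩

/-- The inclusion of a closed subspace. -/
abbrev subι (E : Ban.{u} k) (S : Submodule k E) (hS : IsClosed (S : Set E)) : sub E S hS ⟶ E :=
  ⟨S.subtypeL⟩

/-- The projection to the quotient by a closed subspace. -/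
abbrev quotπ (E : Ban.{u} k) (S : Submodule k E) (hS : IsClosed (S : Set E)) :
    E ⟶ quot E S hS :=
  ⟨S.mkQL⟩

lemma quotπ_surjective (E : Ban.{u} k) (S : Submodule k E) (hS : IsClosed (S : Set E)) :
    Function.Surjective (quotπ E S hS).clm := Submodule.Quotient.mk_surjective S

lemma quotπ_eq_zero (E : Ban.{u} k) (S : Submodule k E) (hS : IsClosed (S : Set E)) (x : E) :
    (quotπ E S hS).clm x = 0 ↔ x ∈ S := Submodule.Quotient.mk_eq_zero S

lemma quot_hom_ext {E F : Ban.{u} k} {S : Submodule k E} {hS : IsClosed (S : Set E)}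
    {f g : quot E S hS ⟶ F} (h : quotπ E S hS ≫ f = quotπ E S hS ≫ g) : f = g := by
  ext x
  obtain ⟨x, rfl⟩ := quotπ_surjective E S hS x
  rw [← comp_apply, h, comp_apply]

/-- The kernel of a morphism, as a subspace. -/
def ker {E F : Ban.{u} k} (f : E ⟶ F) : Submodule k E := LinearMap.ker (f.clm : E →ₗ[k] F)

/-- The image of a morphism in the category of Banach spaces, that is, the kernel of its
cokernel: the closure of the range. -/
def im {E F : Ban.{u} k} (f : E ⟶ F) : Submodule k F :=
  (LinearMap.range (f.clm : E →ₗ[k] F)).topologicalClosure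

lemma mem_ker {E F : Ban.{u} k} (f : E ⟶ F) (x : E) : x ∈ ker f ↔ f.clm x = 0 := Iff.rfl

lemma apply_mem_im {E F : Ban.{u} k} (f : E ⟶ F) (x : E) : f.clm x ∈ im f :=
  Submodule.le_topologicalClosure _ ⟨x, rfl⟩

lemma mem_im {E F : Ban.{u} k} (f : E ⟶ F) (y : F) :
    y ∈ im f ↔ y ∈ closure (Set.range f.clm) := Iff.rfl

lemma isClosed_ker {E F : Ban.{u} k} (f : E ⟶ F) : IsClosed (ker f : Set E) :=
  ContinuousLinearMap.isClosed_ker f.clm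

lemma isClosed_im {E F : Ban.{u} k} (f : E ⟶ F) : IsClosed (im f : Set F) :=
  Submodule.isClosed_topologicalClosure _

lemma im_le {E F : Ban.{u} k} (f : E ⟶ F) (S : Submodule k F) (hS : IsClosed (S : Set F))
    (h : ∀ x, f.clm x ∈ S) : im f ≤ S := by
  refine Submodule.topologicalClosure_minimal _ ?_ hS
  rintro _ ⟨x, rfl⟩
  exact h x

lemma map_mem_im {E F E' F' : Ban.{u} k} (f : E ⟶ F) (f' : E' ⟶ F') (a : E ⟶ E') (b : F ⟶ F')
    (w : f ≫ b = a ≫ f') (y : F) (hy : y ∈ im f) : b.clm y ∈ im f' := by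
  have : im f ≤ (im f').comap (b.clm : F →ₗ[k] F') := by
    refine im_le f _ ((isClosed_im f').preimage b.clm.continuous) fun x => ?_
    change b.clm (f.clm x) ∈ im f'
    have h : b.clm (f.clm x) = f'.clm (a.clm x) :=
      congrArg (fun φ : E ⟶ F' => φ.clm x) w
    rw [h]
    exact apply_mem_im f' _
  exact this hy

lemma comp_eq_zero {E F H : Ban.{u} k} {f : E ⟶ F} {g : F ⟶ H} (h : f ≫ g = 0) (x : E) :
    g.clm (f.clm x) = 0 := by
  rw [← comp_apply, h, zero_apply]

lemma surjective_of_normalEpi {E F : Ban.{u} k} (π : E ⟶ F) (hπ : NormalEpi π) :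
    Function.Surjective π.clm := by
  obtain ⟨W, g, w, hc⟩ := hπ
  let R : Submodule k E := im g
  have hR : IsClosed (R : Set E) := isClosed_im g
  have hker : R ≤ ker π := im_le g _ (isClosed_ker π) (comp_eq_zero w)
  let q : E ⟶ quot E R hR := quotπ E R hR
  have hq : g ≫ q = 0 := by
    ext x
    exact (quotπ_eq_zero E R hR _).2 (apply_mem_im g x)
  let e : quot E R hR ⟶ F := ⟨⟨Submodule.liftQ R (π.clm : E →ₗ[k] F) hker, by
    refine (Submodule.isOpenQuotientMap_mkQ R).isQuotientMap.continuous_iff.2 ?_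
    exact π.clm.continuous⟩⟩
  let d : F ⟶ quot E R hR := hc.desc (CokernelCofork.ofπ q hq)
  have hd : π ≫ d = q := hc.fac (CokernelCofork.ofπ q hq) WalkingParallelPair.one
  have hqe : q ≫ e = π := by ext x; rfl
  have hde : d ≫ e = 𝟙 F := by
    refine Cofork.IsColimit.hom_ext hc ?_
    change π ≫ d ≫ e = π ≫ 𝟙 F
    rw [← Category.assoc, hd, hqe, Category.comp_id]
  intro z
  obtain ⟨x, hx⟩ := Submodule.Quotient.mk_surjective R (d.clm z)
  refine ⟨x, ?_⟩
  have h1 : e.clm (d.clm z) = z := by rw [← comp_apply, hde, id_apply]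
  rw [← hx] at h1
  exact h1

lemma exists_factor {E F H : Type*} [NormedAddCommGroup E] [NormedSpace k E] [CompleteSpace E]
    [NormedAddCommGroup F] [NormedSpace k F] [CompleteSpace F] [NormedAddCommGroup H]
    [NormedSpace k H] (π : E →L[k] F) (hπ : Function.Surjective π)
    (h : E →L[k] H) (hh : ∀ x, π x = 0 → h x = 0) : ∃ l : F →L[k] H, ∀ x, l (π x) = h x := by
  let L : F →ₗ[k] H :=
    (Submodule.liftQ (LinearMap.ker (π : E →ₗ[k] F)) (h : E →ₗ[k] H)
      (fun x hx => hh x hx)).comp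
      (LinearMap.quotKerEquivOfSurjective (π : E →ₗ[k] F) hπ).symm.toLinearMap
  have hL : ∀ x, L (π x) = h x := by
    intro x
    have : (LinearMap.quotKerEquivOfSurjective (π : E →ₗ[k] F) hπ).symm (π x) =
        Submodule.Quotient.mk x := by
      rw [LinearEquiv.symm_apply_eq]; rfl
    simp only [L, LinearMap.comp_apply, LinearEquiv.coe_coe]
    rw [this]; rfl
  refine ⟨⟨L, ?_⟩, hL⟩
  refine ((π.isOpenMap hπ).isQuotientMap π.continuous hπ).continuous_iff.2 ?_
  have : (L.toFun ∘ π) = h := funext hL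
  rw [this]
  exact h.continuous

lemma strictExact_iff (S : ShortComplex (Ban.{u} k)) :
    StrictExact S ↔ ∀ x : S.X₂, S.g.clm x = 0 → ∃ y : S.X₁, S.f.clm y = x := by
  have hcl := isClosed_ker S.g
  let j : sub S.X₂ _ hcl ⟶ S.X₂ := subι _ _ _
  have hj : j ≫ S.g = 0 := by ext x; exact x.2
  constructor
  · rintro ⟨Z, ι, w, π, ⟨hι⟩, ⟨hπ⟩, fac⟩ x hx
    let l : sub S.X₂ _ hcl ⟶ Z := hι.lift (KernelFork.ofι j hj)
    have hl : l ≫ ι = j := hι.fac (KernelFork.ofι j hj) WalkingParallelPair.zero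
    obtain ⟨y, hy⟩ := surjective_of_normalEpi π hπ (l.clm ⟨x, hx⟩)
    refine ⟨y, ?_⟩
    rw [← fac, comp_apply, hy, ← comp_apply, hl]
    rfl
  · intro H
    let π : S.X₁ ⟶ sub S.X₂ _ hcl :=
      ⟨S.f.clm.codRestrict _ (fun x => comp_eq_zero S.zero x)⟩
    have hπ : Function.Surjective π.clm := by
      rintro ⟨x, hx⟩
      obtain ⟨y, rfl⟩ := H x hx
      exact ⟨y, rfl⟩
    refine ⟨_, j, hj, π, ⟨?_⟩, ⟨?_⟩, rfl⟩
    · refine KernelFork.IsLimit.ofι j hj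
        (fun {E} m hm => ⟨m.clm.codRestrict _ (fun x => comp_eq_zero hm x)⟩)
        (fun {E} m hm => rfl) ?_
      rintro E m hm m' rfl
      rfl
    · let i : sub S.X₁ _ (isClosed_ker π) ⟶ S.X₁ :=
        subι _ _ _
      have hi : i ≫ π = 0 := by ext x; exact congrArg Subtype.val x.2
      have key : ∀ {H : Ban.{u} k} (h : S.X₁ ⟶ H), i ≫ h = 0 →
          ∃ l : sub S.X₂ _ hcl ⟶ H, π ≫ l = h := fun h hh =>
        let ⟨l, hl⟩ := exists_factor π.clm hπ h.clm (fun x hx => comp_eq_zero hh ⟨x, hx⟩)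
        ⟨⟨l⟩, hom_ext hl⟩
      refine ⟨_, i, hi, CokernelCofork.IsColimit.ofπ π hi
        (fun {E} m hm => (key m hm).choose) (fun {E} m hm => (key m hm).choose_spec) ?_⟩
      rintro E m hm m' hm'
      ext x
      obtain ⟨y, rfl⟩ := hπ x
      rw [← comp_apply, ← comp_apply, hm', (key m hm).choose_spec]

/-- The complexes of Banach spaces. -/
abbrev Cpx (k : Type) [RCLike k] := CochainComplex (Ban.{u} k) ℤ

lemma acyclic_iff (K : Cpx.{u} k) : acyclic (Ban.{u} k) K ↔
    ∀ i j l : ℤ, i + 1 = j → j + 1 = l → ∀ x : K.X j, (K.d j l).clm x = 0 →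
      ∃ y : K.X i, (K.d i j).clm y = x := by
  constructor
  · rintro H i j l rfl rfl
    have := (strictExact_iff _).1 (H (i + 1))
    have e : i + 1 - 1 = i := by lia
    rw [e] at this
    exact this
  · intro H n
    exact (strictExact_iff _).2 (H _ _ _ (by lia) rfl)

lemma d_d_apply (K : Cpx.{u} k) (i j l : ℤ) (x : K.X i) :
    (K.d j l).clm ((K.d i j).clm x) = 0 := comp_eq_zero (K.d_comp_d i j l) x

lemma d_f_apply {K L : Cpx.{u} k} (f : K ⟶ L) (i j : ℤ) (x : K.X i) :
    (L.d i j).clm ((f.f i).clm x) = (f.f j).clm ((K.d i j).clm x) := by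
  rw [← comp_apply, ← comp_apply, f.comm]

/-- A chain map inducing bijections on the algebraic cohomology spaces. -/
structure QI {K L : Cpx.{u} k} (f : K ⟶ L) : Prop where
  inj : ∀ i j l : ℤ, i + 1 = j → j + 1 = l → ∀ x : K.X j, (K.d j l).clm x = 0 →
    ∀ y : L.X i, (L.d i j).clm y = (f.f j).clm x → ∃ x' : K.X i, (K.d i j).clm x' = x
  surj : ∀ i j l : ℤ, i + 1 = j → j + 1 = l → ∀ y : L.X j, (L.d j l).clm y = 0 →
    ∃ x : K.X j, (K.d j l).clm x = 0 ∧ ∃ y' : L.X i, y = (f.f j).clm x + (L.d i j).clm y'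

open CochainComplex in
lemma qis_iff {K L : Cpx.{u} k} (f : K ⟶ L) : qis (Ban.{u} k) f ↔ QI f := by
  change acyclic _ (mappingCone f) ↔ _
  rw [acyclic_iff]
  let C := mappingCone f
  let fst (i j : ℤ) (h : i + 1 = j) : C.X i ⟶ K.X j := (mappingCone.fst f).1.v i j h
  let snd (i : ℤ) : C.X i ⟶ L.X i := (mappingCone.snd f).v i i (add_zero i)
  let inl (i j : ℤ) (h : i + 1 = j) : K.X j ⟶ C.X i :=
    (mappingCone.inl f).v j i (by lia)
  let inr (i : ℤ) : L.X i ⟶ C.X i := (mappingCone.inr f).f i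
  have e1 : ∀ i j h x, (fst i j h).clm ((inl i j h).clm x) = x := fun i j h x => by
    rw [← comp_apply]; simp [fst, inl]
  have e2 : ∀ i j h x, (snd i).clm ((inl i j h).clm x) = 0 := fun i j h x => by
    rw [← comp_apply]; simp [snd, inl]
  have e3 : ∀ i j h x, (fst i j h).clm ((inr i).clm x) = 0 := fun i j h x => by
    rw [← comp_apply]; simp [fst, inr]
  have e4 : ∀ i x, (snd i).clm ((inr i).clm x) = x := fun i x => by
    rw [← comp_apply]; simp [snd, inr]
  have d1 : ∀ i j l h h' x, (fst j l h').clm ((C.d i j).clm x) =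
      -(K.d j l).clm ((fst i j h).clm x) := fun i j l h h' x => by
    rw [← comp_apply, ← comp_apply, ← neg_apply]
    exact congrArg (fun φ => Ban.Hom.clm φ x) (mappingCone.d_fst_v f i j l h h')
  have d2 : ∀ i j h x, (snd j).clm ((C.d i j).clm x) =
      (f.f j).clm ((fst i j h).clm x) + (L.d i j).clm ((snd i).clm x) := fun i j h x => by
    rw [← comp_apply, ← comp_apply, ← comp_apply, ← add_apply]
    exact congrArg (fun φ => Ban.Hom.clm φ x) (mappingCone.d_snd_v f i j h)
  have ext : ∀ i j h (x y : C.X i), (fst i j h).clm x = (fst i j h).clm y →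
      (snd i).clm x = (snd i).clm y → x = y := fun i j h x y h1 h2 => by
    have hid : ∀ z : C.X i, (inl i j h).clm ((fst i j h).clm z) +
        (inr i).clm ((snd i).clm z) = z := fun z => by
      rw [← comp_apply, ← comp_apply, ← add_apply]
      exact congrArg (fun φ => Ban.Hom.clm φ z) (mappingCone.id_X f i j h)
    rw [← hid x, ← hid y, h1, h2]
  constructor
  · intro H
    constructor
    · intro i j l hij hjl x hx y hy
      obtain ⟨b, hb⟩ := H (i - 1) i j (by lia) hij ((inl i j hij).clm x - (inr i).clm y) (by
        refine ext j l hjl _ _ ?_ ?_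
        · rw [d1 i j l hij hjl, map_sub, e1, e3, sub_zero, hx, neg_zero, map_zero]
        · rw [d2 i j hij, map_sub (fst i j hij).clm, map_sub (snd i).clm, e1, e2 i j hij, e3, e4, sub_zero, zero_sub, map_neg, hy,
            add_neg_cancel, map_zero])
      refine ⟨-(fst (i - 1) i (by lia)).clm b, ?_⟩
      rw [map_neg, ← d1 (i - 1) i j (by lia) hij, hb, map_sub, e1, e3, sub_zero]
    · intro i j l hij hjl y hy
      obtain ⟨b, hb⟩ := H i j l hij hjl ((inr j).clm y) (by
        refine ext l (l + 1) rfl _ _ ?_ ?_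
        · rw [d1 j l (l + 1) hjl rfl, e3, map_zero, neg_zero, map_zero]
        · rw [d2 j l hjl, e3, e4, hy, map_zero, map_zero, add_zero])
      refine ⟨(fst i j hij).clm b, ?_, (snd i).clm b, ?_⟩
      · rw [← neg_eq_zero, ← d1 i j l hij hjl, hb, e3]
      · rw [← d2 i j hij, hb, e4]
  · intro H i j l hij hjl c hc
    have h1 : (K.d l (l + 1)).clm ((fst j l hjl).clm c) = 0 := by
      rw [← neg_eq_zero, ← d1 j l (l + 1) hjl rfl, hc, map_zero]
    have h2 : (f.f l).clm ((fst j l hjl).clm c) + (L.d j l).clm ((snd j).clm c) = 0 := by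
      rw [← d2 j l hjl, hc, map_zero]
    obtain ⟨x, hx⟩ := H.inj j l (l + 1) hjl rfl _ h1 (-(snd j).clm c) (by
      rw [map_neg]; exact (eq_neg_of_add_eq_zero_left h2).symm)
    obtain ⟨z, hz, y, hy⟩ := H.surj i j l hij hjl ((snd j).clm c + (f.f j).clm x) (by
      rw [map_add, d_f_apply, hx, add_comm]; exact h2)
    refine ⟨(inl i j hij).clm (z - x) + (inr i).clm y, ext j l hjl _ _ ?_ ?_⟩
    · rw [d1 i j l hij hjl, map_add, e1, e3, add_zero, map_sub, hz, hx, zero_sub, neg_neg]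
    · rw [d2 i j hij, map_add (fst i j hij).clm, map_add (snd i).clm, e1, e3, e2 i j hij, e4, add_zero,
        zero_add, map_sub, sub_add_eq_add_sub, ← hy, add_sub_cancel_right]

end Ban

/-! ### Truncations of complexes of Banach spaces -/

/-- A functorial family of closed subcomplexes of complexes of Banach spaces. -/
structure ClosedSubcomplex (k : Type) [RCLike k] where
  S (K : Ban.Cpx.{u} k) (n : ℤ) : Submodule k (K.X n)
  closed (K : Ban.Cpx.{u} k) (n : ℤ) : IsClosed (S K n : Set (K.X n))
  d_mem (K : Ban.Cpx.{u} k) (i j : ℤ) (x : K.X i) (hx : x ∈ S K i) : (K.d i j).clm x ∈ S K j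
  f_mem {K L : Ban.Cpx.{u} k} (f : K ⟶ L) (n : ℤ) (x : K.X n) (hx : x ∈ S K n) :
    (f.f n).clm x ∈ S L n

namespace ClosedSubcomplex

/-- The functor taking a complex to the given closed subcomplex. -/
def sub (T : ClosedSubcomplex.{u} k) : Ban.Cpx.{u} k ⥤ Ban.Cpx.{u} k where
  obj K :=
    { X := fun n => Ban.sub (K.X n) (T.S K n) (T.closed K n)
      d := fun i j => ⟨((K.d i j).clm.comp (T.S K i).subtypeL).codRestrict (T.S K j)
        (fun x => T.d_mem K i j x x.2)⟩
      shape := fun i j h => by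
        ext x
        exact congrArg (fun φ => Ban.Hom.clm φ x.1) (K.shape i j h)
      d_comp_d' := fun i j l _ _ => by
        ext x
        exact Ban.d_d_apply K i j l x.1 }
  map {K L} f :=
    { f := fun n => ⟨((f.f n).clm.comp (T.S K n).subtypeL).codRestrict (T.S L n)
        (fun x => T.f_mem f n x x.2)⟩
      comm' := fun i j _ => by
        ext x
        exact Ban.d_f_apply f i j x.1 }
  map_id _ := rfl
  map_comp _ _ := rfl

/-- The functor taking a complex to its quotient by the given closed subcomplex. -/
def quot (T : ClosedSubcomplex.{u} k) : Ban.Cpx.{u} k ⥤ Ban.Cpx.{u} k where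
  obj K :=
    { X := fun n => Ban.quot (K.X n) (T.S K n) (T.closed K n)
      d := fun i j => ⟨quotMap (T.S K i) (T.S K j) (K.d i j).clm (fun x => T.d_mem K i j x)⟩
      shape := fun i j h => by
        refine Ban.quot_hom_ext ?_
        change K.d i j ≫ Ban.quotπ _ _ _ = _
        rw [K.shape i j h, zero_comp, comp_zero]
      d_comp_d' := fun i j l _ _ => by
        refine Ban.quot_hom_ext ?_
        change (K.d i j ≫ K.d j l) ≫ Ban.quotπ _ _ _ = _
        rw [K.d_comp_d, zero_comp, comp_zero] }
  map {K L} f :=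
    { f := fun n => ⟨quotMap (T.S K n) (T.S L n) (f.f n).clm (fun x => T.f_mem f n x)⟩
      comm' := fun i j _ => by
        refine Ban.quot_hom_ext ?_
        change (f.f i ≫ L.d i j) ≫ Ban.quotπ _ _ _ = (K.d i j ≫ f.f j) ≫ Ban.quotπ _ _ _
        rw [f.comm] }
  map_id K := by
    ext n : 1
    exact Ban.quot_hom_ext rfl
  map_comp f g := by
    ext n : 1
    exact Ban.quot_hom_ext rfl

/-- The inclusion of the subcomplex. -/
def ι (T : ClosedSubcomplex.{u} k) (K : Ban.Cpx.{u} k) : T.sub.obj K ⟶ K where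
  f n := Ban.subι _ _ (T.closed K n)

/-- The projection to the quotient complex. -/
def π (T : ClosedSubcomplex.{u} k) (K : Ban.Cpx.{u} k) : K ⟶ T.quot.obj K where
  f n := Ban.quotπ _ _ (T.closed K n)

end ClosedSubcomplex

/-- The subcomplex `⋯ → K^{m-2} → K^{m-1} → Ker d^m → 0 → ⋯` of `K`. -/
def cyclesSub (k : Type) [RCLike k] (m : ℤ) : ClosedSubcomplex.{u} k where
  S K n := if n < m then ⊤ else if n = m then Ban.ker (K.d n (n + 1)) else ⊥
  closed K n := by
    split_ifs
    · exact isClosed_univ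
    · exact Ban.isClosed_ker _
    · exact isClosed_singleton
  d_mem K i j x hx := by
    by_cases hij : i + 1 = j
    · subst hij
      split_ifs at hx ⊢ <;> try lia
      · exact Submodule.mem_top
      · exact Ban.d_d_apply K _ _ _ x
      · exact hx
      · rw [(Submodule.mem_bot k).1 hx, map_zero]; exact Submodule.zero_mem _
    · rw [K.shape i j hij]; exact Submodule.zero_mem _
  f_mem {K L} f n x hx := by
    split_ifs at hx ⊢
    · exact Submodule.mem_top
    · rw [Ban.mem_ker] at hx ⊢
      rw [Ban.d_f_apply, hx, map_zero]
    · rw [(Submodule.mem_bot k).1 hx, map_zero]; exact Submodule.zero_mem _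

/-- The subcomplex `⋯ → K^{m-2} → K^{m-1} → Im d^{m-1} → 0 → ⋯` of `K`, where `Im` is the image
in the category of Banach spaces, the closure of the range. -/
def imageSub (k : Type) [RCLike k] (m : ℤ) : ClosedSubcomplex.{u} k where
  S K n := if n < m then ⊤ else if n = m then Ban.im (K.d (n - 1) n) else ⊥
  closed K n := by
    split_ifs
    · exact isClosed_univ
    · exact Ban.isClosed_im _
    · exact isClosed_singleton
  d_mem K i j x hx := by
    by_cases hij : i + 1 = j
    · obtain rfl : i = j - 1 := by lia
      split_ifs at hx ⊢ <;> try lia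
      · exact Submodule.mem_top
      · exact Ban.apply_mem_im _ x
      · refine (Submodule.mem_bot k).2 ?_
        exact Ban.im_le _ (Ban.ker (K.d (j - 1) j)) (Ban.isClosed_ker _)
          (Ban.d_d_apply K _ _ _) hx
      · rw [(Submodule.mem_bot k).1 hx, map_zero]; exact Submodule.zero_mem _
    · rw [K.shape i j hij]; exact Submodule.zero_mem _
  f_mem {K L} f n x hx := by
    split_ifs at hx ⊢
    · exact Submodule.mem_top
    · exact Ban.map_mem_im _ _ (f.f (n - 1)) (f.f n) (f.comm _ _).symm x hx
    · rw [(Submodule.mem_bot k).1 hx, map_zero]; exact Submodule.zero_mem _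

variable (k) in
/-- Left truncation `τ_ℓ^{≤0} K = (⋯ → K^{-2} → K^{-1} → Ker d^0 → 0 → ⋯)`. -/
def leftTruncLE : Ban.Cpx.{u} k ⥤ Ban.Cpx.{u} k := (cyclesSub k 0).sub

variable (k) in
/-- Left truncation `τ_ℓ^{≥0} K = (⋯ → 0 → Coim d^{-1} → K^0 → K^1 → ⋯)`, where the coimage
of `d^{-1}` is the quotient of `K^{-1}` by the kernel of `d^{-1}`. -/
def leftTruncGE : Ban.Cpx.{u} k ⥤ Ban.Cpx.{u} k := (cyclesSub k (-1)).quot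

variable (k) in
/-- Right truncation `τ_r^{≤0} K = (⋯ → K^{-1} → K^0 → Im d^0 → 0 → ⋯)`, where the image is
the closure of the range. -/
def rightTruncLE : Ban.Cpx.{u} k ⥤ Ban.Cpx.{u} k := (imageSub k 1).sub

variable (k) in
/-- Right truncation `τ_r^{≥0} K = (⋯ → 0 → Coker d^{-1} → K^1 → K^2 → ⋯)`, where the cokernel
is the quotient by the closure of the range. -/
def rightTruncGE : Ban.Cpx.{u} k ⥤ Ban.Cpx.{u} k := (imageSub k 0).quot

lemma mem_cyclesSub (m : ℤ) (K : Ban.Cpx.{u} k) (n : ℤ) (x : K.X n) :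
    x ∈ (cyclesSub k m).S K n ↔ (n = m → (K.d n (n + 1)).clm x = 0) ∧ (m < n → x = 0) := by
  dsimp only [cyclesSub]
  split_ifs with h h'
  · simp only [Submodule.mem_top, true_iff]; exact ⟨by lia, by lia⟩
  · exact ⟨fun hx => ⟨fun _ => hx, by lia⟩, fun hx => hx.1 h'⟩
  · exact ⟨fun hx => ⟨by lia, fun _ => hx⟩, fun hx => hx.2 (by lia)⟩

lemma mem_imageSub (m : ℤ) (K : Ban.Cpx.{u} k) (n : ℤ) (x : K.X n) :
    x ∈ (imageSub k m).S K n ↔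
      (n = m → x ∈ Ban.im (K.d (n - 1) n)) ∧ (m < n → x = 0) := by
  dsimp only [imageSub]
  split_ifs with h h'
  · simp only [Submodule.mem_top, true_iff]; exact ⟨by lia, by lia⟩
  · exact ⟨fun hx => ⟨fun _ => hx, by lia⟩, fun hx => hx.1 h'⟩
  · exact ⟨fun hx => ⟨by lia, fun _ => hx⟩, fun hx => hx.2 (by lia)⟩

/-! ### Truncations preserve quasi-isomorphisms -/

namespace Ban

lemma QI.mem_closure {K L : Cpx.{u} k} {f : K ⟶ L} (H : QI f) (j : ℤ) (x : K.X j)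
    (hx : (K.d j (j + 1)).clm x = 0)
    (h : (f.f j).clm x ∈ im (L.d (j - 1) j)) : x ∈ im (K.d (j - 1) j) := by
  have hij : j - 1 + 1 = j := by lia
  let ZK := ker (K.d j (j + 1))
  let ZL := ker (L.d j (j + 1))
  have : CompleteSpace ZK := (isClosed_ker _).completeSpace_coe
  have : CompleteSpace ZL := (isClosed_ker _).completeSpace_coe
  let Φ₀ : (ZK × L.X (j - 1)) →L[k] L.X j :=
    ((f.f j).clm.comp (Submodule.subtypeL _)).coprod (L.d (j - 1) j).clm
  have hΦ₀ : ∀ p, Φ₀ p = (f.f j).clm p.1.1 + (L.d (j - 1) j).clm p.2 := fun p => rfl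
  let Φ : (ZK × L.X (j - 1)) →L[k] ZL := Φ₀.codRestrict _ (fun p => by
    change (L.d j (j + 1)).clm (Φ₀ p) = 0
    rw [hΦ₀, map_add, d_d_apply, d_f_apply, show (K.d j (j + 1)).clm p.1.1 = 0 from p.1.2,
      map_zero, add_zero])
  have hΦ : Function.Surjective Φ := by
    rintro ⟨y, hy⟩
    obtain ⟨z, hz, y', hy'⟩ := H.surj (j - 1) j (j + 1) hij rfl y hy
    exact ⟨(⟨z, hz⟩, y'), Subtype.ext hy'.symm⟩
  obtain ⟨C, hC, hpre⟩ := Φ.exists_preimage_norm_le hΦ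
  rw [mem_im, Metric.mem_closure_iff] at h ⊢
  intro ε hε
  obtain ⟨_, ⟨y, rfl⟩, hy⟩ := h (ε / C) (by positivity)
  have hmem : (L.d j (j + 1)).clm ((f.f j).clm x - (L.d (j - 1) j).clm y) = 0 := by
    rw [map_sub, d_f_apply, hx, d_d_apply, map_zero, sub_zero]
  obtain ⟨⟨z, y'⟩, h1, h2⟩ := hpre ⟨(f.f j).clm x - (L.d (j - 1) j).clm y, hmem⟩
  have h1' : (f.f j).clm z.1 + (L.d (j - 1) j).clm y' =
      (f.f j).clm x - (L.d (j - 1) j).clm y := congrArg Subtype.val h1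
  obtain ⟨x', hx'⟩ := H.inj (j - 1) j (j + 1) hij rfl (x - z.1)
    (by rw [map_sub, hx, show (K.d j (j + 1)).clm z.1 = 0 from z.2, sub_zero]) (y + y') (by
      rw [map_add, map_sub, add_comm, ← sub_eq_zero]
      rw [← sub_eq_zero] at h1'
      rw [← h1']; abel)
  refine ⟨_, ⟨x', rfl⟩, ?_⟩
  rw [hx', dist_eq_norm, sub_sub_cancel]
  calc ‖(z.1 : K.X j)‖ ≤ ‖((z, y') : ZK × L.X (j - 1))‖ := le_max_left _ _
    _ ≤ C * ‖(f.f j).clm x - (L.d (j - 1) j).clm y‖ := h2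
    _ < C * (ε / C) := by
        rw [dist_eq_norm] at hy
        exact mul_lt_mul_of_pos_left hy hC
    _ = ε := by field_simp

lemma QI.cyclesSub_sub {K L : Cpx.{u} k} {f : K ⟶ L} (H : QI f) (m : ℤ) :
    QI ((cyclesSub k m).sub.map f) := by
  constructor
  · rintro i j l hij rfl ⟨x, hx⟩ hx0 ⟨y, hy⟩ hyx
    have hx0' : (K.d j (j + 1)).clm x = 0 := congrArg Subtype.val hx0
    have hyx' : (L.d i j).clm y = (f.f j).clm x := congrArg Subtype.val hyx
    by_cases hj : m < j
    · have := ((mem_cyclesSub m K j x).1 hx).2 hj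
      subst this
      exact ⟨0, map_zero _⟩
    · obtain ⟨x', rfl⟩ := H.inj i j _ hij rfl x hx0' y hyx'
      exact ⟨⟨x', (mem_cyclesSub m K i x').2 ⟨by lia, by lia⟩⟩, rfl⟩
  · rintro i j l hij rfl ⟨y, hy⟩ hy0
    have hy0' : (L.d j (j + 1)).clm y = 0 := congrArg Subtype.val hy0
    by_cases hj : m < j
    · have := ((mem_cyclesSub m L j y).1 hy).2 hj
      subst this
      refine ⟨0, map_zero _, 0, ?_⟩
      rw [map_zero, map_zero, add_zero]; rfl
    · obtain ⟨x, hx, y', rfl⟩ := H.surj i j _ hij rfl y hy0'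
      exact ⟨⟨x, (mem_cyclesSub m K j x).2 ⟨fun _ => hx, by lia⟩⟩, Subtype.ext hx,
        ⟨y', (mem_cyclesSub m L i y').2 ⟨by lia, by lia⟩⟩, rfl⟩

lemma QI.imageSub_sub {K L : Cpx.{u} k} {f : K ⟶ L} (H : QI f) (m : ℤ) :
    QI ((imageSub k m).sub.map f) := by
  constructor
  · rintro i j l hij rfl ⟨x, hx⟩ hx0 ⟨y, hy⟩ hyx
    have hx0' : (K.d j (j + 1)).clm x = 0 := congrArg Subtype.val hx0
    have hyx' : (L.d i j).clm y = (f.f j).clm x := congrArg Subtype.val hyx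
    by_cases hj : m < j
    · have := ((mem_imageSub m K j x).1 hx).2 hj
      subst this
      exact ⟨0, map_zero _⟩
    · obtain ⟨x', rfl⟩ := H.inj i j _ hij rfl x hx0' y hyx'
      exact ⟨⟨x', (mem_imageSub m K i x').2 ⟨by lia, by lia⟩⟩, rfl⟩
  · rintro i j l hij rfl ⟨y, hy⟩ hy0
    have hy0' : (L.d j (j + 1)).clm y = 0 := congrArg Subtype.val hy0
    by_cases hj : m < j
    · have := ((mem_imageSub m L j y).1 hy).2 hj
      subst this
      refine ⟨0, map_zero _, 0, ?_⟩
      rw [map_zero, map_zero, add_zero]; rfl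
    · obtain ⟨x, hx, y', rfl⟩ := H.surj i j _ hij rfl y hy0'
      refine ⟨⟨x, (mem_imageSub m K j x).2 ⟨fun hjm => H.mem_closure j x hx ?_, by lia⟩⟩,
        Subtype.ext hx, ⟨y', (mem_imageSub m L i y').2 ⟨by lia, by lia⟩⟩, rfl⟩
      have h := ((mem_imageSub m L j _).1 hy).1 hjm
      obtain rfl : i = j - 1 := by lia
      have h2 := Submodule.sub_mem _ h (apply_mem_im _ y')
      rwa [add_sub_cancel_right] at h2

lemma QI.cyclesSub_quot {K L : Cpx.{u} k} {f : K ⟶ L} (H : QI f) (m : ℤ) :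
    QI ((cyclesSub k m).quot.map f) := by
  constructor
  · rintro i j l hij rfl x hx y hy
    obtain ⟨x, rfl⟩ := Submodule.Quotient.mk_surjective _ x
    obtain ⟨y, rfl⟩ := Submodule.Quotient.mk_surjective _ y
    have hx' : (K.d j (j + 1)).clm x ∈ (cyclesSub k m).S K (j + 1) :=
      (Submodule.Quotient.mk_eq_zero _).1 hx
    have hy' : (L.d i j).clm y - (f.f j).clm x ∈ (cyclesSub k m).S L j :=
      (Submodule.Quotient.eq _).1 hy
    by_cases hj : m < j
    · have h1 := ((mem_cyclesSub m K _ _).1 hx').2 (by lia)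
      have h2 := sub_eq_zero.1 (((mem_cyclesSub m L _ _).1 hy').2 hj)
      obtain ⟨x', rfl⟩ := H.inj i j _ hij rfl x h1 y h2
      exact ⟨Submodule.Quotient.mk x', rfl⟩
    · have hx0 : x ∈ (cyclesSub k m).S K j := (mem_cyclesSub m K j x).2
        ⟨fun _ => ((mem_cyclesSub m K _ _).1 hx').2 (by lia), by lia⟩
      exact ⟨0, (map_zero _).trans ((Submodule.Quotient.mk_eq_zero _).2 hx0).symm⟩
  · rintro i j l hij rfl y hy
    obtain ⟨y, rfl⟩ := Submodule.Quotient.mk_surjective _ y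
    have hy' : (L.d j (j + 1)).clm y ∈ (cyclesSub k m).S L (j + 1) :=
      (Submodule.Quotient.mk_eq_zero _).1 hy
    by_cases hj : m < j
    · have h1 := ((mem_cyclesSub m L _ _).1 hy').2 (by lia)
      obtain ⟨x, hx, y', rfl⟩ := H.surj i j _ hij rfl y h1
      exact ⟨Submodule.Quotient.mk x, congrArg Submodule.Quotient.mk hx,
        Submodule.Quotient.mk y', rfl⟩
    · have hy0 : y ∈ (cyclesSub k m).S L j := (mem_cyclesSub m L j y).2
        ⟨fun _ => ((mem_cyclesSub m L _ _).1 hy').2 (by lia), by lia⟩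
      refine ⟨0, map_zero _, 0, ?_⟩
      rw [map_zero, map_zero, add_zero]
      exact (Submodule.Quotient.mk_eq_zero _).2 hy0

lemma QI.imageSub_quot {K L : Cpx.{u} k} {f : K ⟶ L} (H : QI f) (m : ℤ) :
    QI ((imageSub k m).quot.map f) := by
  constructor
  · rintro i j l hij rfl x hx y hy
    obtain ⟨x, rfl⟩ := Submodule.Quotient.mk_surjective _ x
    obtain ⟨y, rfl⟩ := Submodule.Quotient.mk_surjective _ y
    have hx' : (K.d j (j + 1)).clm x ∈ (imageSub k m).S K (j + 1) :=
      (Submodule.Quotient.mk_eq_zero _).1 hx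
    have hy' : (L.d i j).clm y - (f.f j).clm x ∈ (imageSub k m).S L j :=
      (Submodule.Quotient.eq _).1 hy
    by_cases hj : m < j
    · have h1 := ((mem_imageSub m K _ _).1 hx').2 (by lia)
      have h2 := sub_eq_zero.1 (((mem_imageSub m L _ _).1 hy').2 hj)
      obtain ⟨x', rfl⟩ := H.inj i j _ hij rfl x h1 y h2
      exact ⟨Submodule.Quotient.mk x', rfl⟩
    · have hx0 : x ∈ (imageSub k m).S K j := by
        refine (mem_imageSub m K j x).2 ⟨fun hjm => ?_, by lia⟩
        refine H.mem_closure j x (((mem_imageSub m K _ _).1 hx').2 (by lia)) ?_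
        have h := ((mem_imageSub m L j _).1 hy').1 hjm
        obtain rfl : i = j - 1 := by lia
        have h2 := Submodule.sub_mem _ (apply_mem_im _ y) h
        rwa [sub_sub_cancel] at h2
      exact ⟨0, (map_zero _).trans ((Submodule.Quotient.mk_eq_zero _).2 hx0).symm⟩
  · rintro i j l hij rfl y hy
    obtain ⟨y, rfl⟩ := Submodule.Quotient.mk_surjective _ y
    have hy' : (L.d j (j + 1)).clm y ∈ (imageSub k m).S L (j + 1) :=
      (Submodule.Quotient.mk_eq_zero _).1 hy
    by_cases hj : m ≤ j
    · have h1 := ((mem_imageSub m L _ _).1 hy').2 (by lia)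
      obtain ⟨x, hx, y', rfl⟩ := H.surj i j _ hij rfl y h1
      exact ⟨Submodule.Quotient.mk x, congrArg Submodule.Quotient.mk hx,
        Submodule.Quotient.mk y', rfl⟩
    · have hy0 : y ∈ (imageSub k m).S L j := (mem_imageSub m L j y).2 ⟨by lia, by lia⟩
      refine ⟨0, map_zero _, 0, ?_⟩
      rw [map_zero, map_zero, add_zero]
      exact (Submodule.Quotient.mk_eq_zero _).2 hy0

end Ban

/-! ### Duality and shifts preserve quasi-isomorphisms -/

variable (k) in
/-- The (contravariant) dual of a complex of Banach spaces: `(K^*)^n = (K^{-n})^*`, with the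
transposed differentials. -/
def dualCpx : (Ban.Cpx.{u} k)ᵒᵖ ⥤ Ban.Cpx.{u} k where
  obj K :=
    { X := fun n => (K.unop.X (-n)).dual
      d := fun i j => Ban.dualMap (K.unop.d (-j) (-i))
      shape := fun i j h => by
        rw [K.unop.shape]
        · exact Ban.hom_ext fun φ => ContinuousLinearMap.ext fun x => map_zero φ
        · intro h'
          exact h (by change i + 1 = j; change -j + 1 = -i at h'; lia)
      d_comp_d' := fun i j l _ _ => by
        change Ban.dualMap (K.unop.d (-l) (-j) ≫ K.unop.d (-j) (-i)) = 0
        rw [K.unop.d_comp_d]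
        exact Ban.hom_ext fun φ => ContinuousLinearMap.ext fun x => map_zero φ }
  map {K L} f :=
    { f := fun n => Ban.dualMap (f.unop.f (-n))
      comm' := fun i j _ => by
        change Ban.dualMap (L.unop.d (-j) (-i) ≫ f.unop.f (-i)) =
          Ban.dualMap (f.unop.f (-j) ≫ K.unop.d (-j) (-i))
        rw [f.unop.comm] }
  map_id _ := rfl
  map_comp _ _ := rfl

namespace Ban

lemma exists_dual_factor {E F H : Type*} [NormedAddCommGroup E] [NormedSpace k E]
    [CompleteSpace E] [NormedAddCommGroup F] [NormedSpace k F] [CompleteSpace F]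
    [NormedAddCommGroup H] [NormedSpace k H] (g : E →L[k] F) (c : F →L[k] H)
    (hgc : ∀ x, c (g x) = 0) (hex : ∀ y, c y = 0 → ∃ x, g x = y) (φ : E →L[k] k)
    (hφ : ∀ x, g x = 0 → φ x = 0) : ∃ l : F →L[k] k, ∀ x, l (g x) = φ x := by
  let R : Submodule k F := LinearMap.ker (c : F →ₗ[k] H)
  have : CompleteSpace R := (ContinuousLinearMap.isClosed_ker c).completeSpace_coe
  let π : E →L[k] R := g.codRestrict R hgc
  have hπ : Function.Surjective π := by
    rintro ⟨y, hy⟩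
    obtain ⟨x, rfl⟩ := hex y hy
    exact ⟨x, rfl⟩
  obtain ⟨l₀, hl₀⟩ := exists_factor π hπ φ (fun x hx => hφ x (congrArg Subtype.val hx))
  obtain ⟨l, hl, -⟩ := exists_extension_norm_eq R l₀
  exact ⟨l, fun x => (hl (π x)).trans (hl₀ x)⟩

lemma QI.dual_key {K L : Cpx.{u} k} {f : K ⟶ L} (H : QI f) (p q r s : ℤ) (hpq : p + 1 = q)
    (hqr : q + 1 = r) (hrs : r + 1 = s) (φ : L.X q →L[k] k) (ψ : K.X r →L[k] k)
    (h1 : ∀ x, φ ((L.d p q).clm x) = 0) (h2 : ∀ x, φ ((f.f q).clm x) = ψ ((K.d q r).clm x)) :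
    ∃ (χ : L.X r →L[k] k) (ξ : K.X s →L[k] k), (∀ y, φ y = χ ((L.d q r).clm y)) ∧
      (∀ x, ψ x = χ ((f.f r).clm x) + ξ ((K.d r s).clm x)) := by
  let g : (L.X q × K.X r) →L[k] (L.X r × K.X s) :=
    ((L.d q r).clm.coprod (f.f r).clm).prod ((K.d r s).clm.comp (ContinuousLinearMap.snd k _ _))
  let c : (L.X r × K.X s) →L[k] (L.X s × K.X (s + 1)) :=
    ((L.d r s).clm.coprod (-(f.f s).clm)).prod
      ((K.d s (s + 1)).clm.comp (ContinuousLinearMap.snd k _ _))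
  have hg : ∀ y x, g (y, x) = ((L.d q r).clm y + (f.f r).clm x, (K.d r s).clm x) :=
    fun y x => rfl
  have hc : ∀ v w, c (v, w) = ((L.d r s).clm v + -(f.f s).clm w, (K.d s (s + 1)).clm w) :=
    fun v w => rfl
  have hψ : ∀ z, (K.d q r).clm z = 0 → φ ((f.f q).clm z) = 0 := fun z hz => by
    rw [h2, hz, map_zero]
  obtain ⟨l, hl⟩ := exists_dual_factor g c (fun ⟨y, x⟩ => by
      rw [hg, hc, map_add, d_d_apply, d_d_apply, d_f_apply, zero_add, add_neg_cancel]; rfl)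
    (fun ⟨v, w⟩ hvw => by
      rw [hc, Prod.mk_eq_zero] at hvw
      obtain ⟨x₀, rfl⟩ := H.inj r s (s + 1) hrs rfl w hvw.2 v (add_neg_eq_zero.1 hvw.1)
      obtain ⟨z, hz, y, hy⟩ := H.surj q r s hqr hrs (v - (f.f r).clm x₀) (by
        rw [map_sub, d_f_apply, sub_eq_add_neg]; exact hvw.1)
      refine ⟨(y, x₀ + z), ?_⟩
      rw [hg, map_add, map_add, hz, add_zero, Prod.mk.injEq]
      refine ⟨?_, rfl⟩
      rw [sub_eq_iff_eq_add] at hy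
      rw [hy]; abel) (φ.coprod ψ) (fun ⟨y, x⟩ hyx => by
      rw [hg, Prod.mk_eq_zero] at hyx
      change φ y + ψ x = 0
      obtain ⟨x', rfl⟩ := H.inj q r s hqr hrs x hyx.2 (-y) (by
        rw [map_neg]; exact (eq_neg_of_add_eq_zero_right hyx.1).symm)
      rw [← d_f_apply, ← map_add] at hyx
      obtain ⟨z, hz, y', hy'⟩ := H.surj p q r hpq hqr (y + (f.f q).clm x') hyx.1
      rw [← h2, ← map_add, hy', map_add, h1, hψ z hz, add_zero])
  refine ⟨l.comp (ContinuousLinearMap.inl k _ _), l.comp (ContinuousLinearMap.inr k _ _),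
    fun y => ?_, fun x => ?_⟩
  · have := hl (y, 0)
    rw [hg, map_zero, map_zero, add_zero] at this
    refine Eq.trans ?_ this.symm
    change φ y = φ y + ψ 0
    rw [map_zero, add_zero]
  · have := hl (0, x)
    rw [hg, map_zero, zero_add] at this
    refine Eq.trans (Eq.trans ?_ this.symm) ?_
    · change ψ x = φ 0 + ψ x
      rw [map_zero, zero_add]
    · change _ = l (_, 0) + l (0, _)
      rw [← map_add, Prod.mk_add_mk, add_zero, zero_add]
      rfl

lemma QI.dual {K L : Cpx.{u} k} {f : K ⟶ L} (H : QI f) : QI ((dualCpx k).map f.op) := by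
  constructor
  · intro i j l hij hjl φ hφ ψ hψ
    obtain ⟨χ, ξ, h1, -⟩ := H.dual_key (-l) (-j) (-i) (-i + 1) (by lia) (by lia) rfl φ ψ
      (fun x => congrArg (fun θ : L.X (-l) →L[k] k => θ x) hφ)
      (fun x => (congrArg (fun θ : K.X (-j) →L[k] k => θ x) hψ).symm)
    exact ⟨χ, ContinuousLinearMap.ext fun x => (h1 x).symm⟩
  · intro i j l hij hjl ψ hψ
    obtain ⟨χ, ξ, h1, h2⟩ := H.dual_key (-l - 1) (-l) (-j) (-i) (by lia) (by lia) (by lia) 0 ψ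
      (fun x => rfl) (fun x => (congrArg (fun θ : K.X (-l) →L[k] k => θ x) hψ).symm)
    exact ⟨χ, ContinuousLinearMap.ext fun x => (h1 x).symm, ξ,
      ContinuousLinearMap.ext fun x => h2 x⟩

lemma QI.shift {K L : Cpx.{u} k} {f : K ⟶ L} (H : QI f) (n : ℤ) : QI (f⟦n⟧') := by
  have hz : ∀ {E : Ban.{u} k} (x : E), n.negOnePow • x = 0 ↔ x = 0 :=
    fun x => smul_eq_zero_iff_eq _
  have hs : ∀ {E : Ban.{u} k} (x : E), n.negOnePow • n.negOnePow • x = x :=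
    fun x => by rw [smul_smul, Int.units_mul_self, one_smul]
  have hm : ∀ {E F : Ban.{u} k} (a : E ⟶ F) (x : E),
      a.clm (n.negOnePow • x) = n.negOnePow • a.clm x := fun a x => by
    rw [Units.smul_def, Units.smul_def, map_zsmul]
  constructor
  · intro i j l hij hjl x hx y hy
    let x₀ : K.X (j + n) := x
    let y₀ : L.X (i + n) := y
    obtain ⟨x', hx'⟩ := H.inj (i + n) (j + n) (l + n) (by lia) (by lia) x₀ ((hz _).1 hx)
      (n.negOnePow • y₀) (by rw [hm]; exact hy)
    refine ⟨(n.negOnePow • x' : K.X (i + n)), ?_⟩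
    change n.negOnePow • (K.d (i + n) (j + n)).clm (n.negOnePow • x') = x₀
    rw [hm, hs]; exact hx'
  · intro i j l hij hjl y hy
    let y₀ : L.X (j + n) := y
    obtain ⟨x, hx, y', hy'⟩ := H.surj (i + n) (j + n) (l + n) (by lia) (by lia) y₀ ((hz _).1 hy)
    refine ⟨x, ?_, (n.negOnePow • y' : L.X (i + n)), ?_⟩
    · exact (hz _).2 hx
    · change y₀ = (f.f (j + n)).clm x +
        n.negOnePow • (L.d (i + n) (j + n)).clm (n.negOnePow • y')
      rw [hm, hs]; exact hy'

end Ban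

/-! ### The two t-structures on the derived category of Banach spaces -/

/-- The endofunctor of `D(Ban)` induced by an endofunctor of complexes that preserves
quasi-isomorphisms. -/
def descend (T : Ban.Cpx.{u} k ⥤ Ban.Cpx.{u} k)
    (hT : ∀ {K L : Ban.Cpx.{u} k} (f : K ⟶ L), Ban.QI f → Ban.QI (T.map f)) :
    DCat (Ban.{u} k) ⥤ DCat (Ban.{u} k) :=
  Localization.lift (T ⋙ (qis (Ban.{u} k)).Q)
    (fun _ _ f hf => Localization.inverts (qis (Ban.{u} k)).Q (qis (Ban.{u} k)) (T.map f)
      ((Ban.qis_iff _).2 (hT f ((Ban.qis_iff f).1 hf))))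
    (qis (Ban.{u} k)).Q

variable (k) in
/-- The left truncation functor `τ_ℓ^{≤0}` on `D(Ban)`. -/
def tauLeftLE : DCat (Ban.{u} k) ⥤ DCat (Ban.{u} k) :=
  descend (leftTruncLE k) (fun _ h => h.cyclesSub_sub 0)

variable (k) in
/-- The left truncation functor `τ_ℓ^{≥0}` on `D(Ban)`. -/
def tauLeftGE : DCat (Ban.{u} k) ⥤ DCat (Ban.{u} k) :=
  descend (leftTruncGE k) (fun _ h => h.cyclesSub_quot (-1))

variable (k) in
/-- The right truncation functor `τ_r^{≤0}` on `D(Ban)`. -/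
def tauRightLE : DCat (Ban.{u} k) ⥤ DCat (Ban.{u} k) :=
  descend (rightTruncLE k) (fun _ h => h.imageSub_sub 1)

variable (k) in
/-- The right truncation functor `τ_r^{≥0}` on `D(Ban)`. -/
def tauRightGE : DCat (Ban.{u} k) ⥤ DCat (Ban.{u} k) :=
  descend (rightTruncGE k) (fun _ h => h.imageSub_quot 0)

variable (k) in
/-- The shift functor `Σ^n` on `D(Ban)`. -/
def shiftD (n : ℤ) : DCat (Ban.{u} k) ⥤ DCat (Ban.{u} k) :=
  descend (shiftFunctor (Ban.Cpx.{u} k) n) (fun _ h => h.shift n)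

variable (k) in
/-- The objects of the left heart: `D_ℓ^{≤0} ∩ D_ℓ^{≥0}`, where `D_ℓ^{≤0}` and `D_ℓ^{≥0}` are
the essential images of `τ_ℓ^{≤0}` and `τ_ℓ^{≥0}`. -/
def isLeftHeart : ObjectProperty (DCat (Ban.{u} k)) :=
  (tauLeftLE k).essImage ⊓ (tauLeftGE k).essImage

variable (k) in
/-- The objects of the right heart: `D_r^{≤0} ∩ D_r^{≥0}`, where `D_r^{≤0}` and `D_r^{≥0}` are
the essential images of `τ_r^{≤0}` and `τ_r^{≥0}`. -/
def isRightHeart : ObjectProperty (DCat (Ban.{u} k)) :=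
  (tauRightLE k).essImage ⊓ (tauRightGE k).essImage

variable (k) in
/-- The left heart `C_ℓ(Ban)`, a full subcategory of `D(Ban)`. -/
abbrev LeftHeart := (isLeftHeart.{u} k).FullSubcategory

variable (k) in
/-- The right heart `C_r(Ban)`, a full subcategory of `D(Ban)`. -/
abbrev RightHeart := (isRightHeart.{u} k).FullSubcategory

/-! ### Truncated complexes lie in the hearts -/

/-- The class of a complex in `D(Ban)`. -/
abbrev Qob (K : Ban.Cpx.{u} k) : DCat (Ban.{u} k) := (qis (Ban.{u} k)).Q.obj K

/-- `descend T` is computed by `T`. -/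
def descendIso (T : Ban.Cpx.{u} k ⥤ Ban.Cpx.{u} k)
    (hT : ∀ {K L : Ban.Cpx.{u} k} (f : K ⟶ L), Ban.QI f → Ban.QI (T.map f))
    (K : Ban.Cpx.{u} k) : (descend T hT).obj (Qob K) ≅ Qob (T.obj K) :=
  (Localization.fac (T ⋙ (qis (Ban.{u} k)).Q) _ (qis (Ban.{u} k)).Q).app K

lemma exists_iso_Qob (X : DCat (Ban.{u} k)) : ∃ K : Ban.Cpx.{u} k, Nonempty (Qob K ≅ X) := by
  have := Localization.essSurj (qis (Ban.{u} k)).Q (qis (Ban.{u} k))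
  exact ⟨(qis (Ban.{u} k)).Q.objPreimage X, ⟨(qis (Ban.{u} k)).Q.objObjPreimageIso X⟩⟩

lemma Ban.QI.nonempty_iso {K L : Ban.Cpx.{u} k} {f : K ⟶ L} (H : Ban.QI f) :
    Nonempty (Qob K ≅ Qob L) :=
  ⟨Localization.isoOfHom (qis (Ban.{u} k)).Q (qis (Ban.{u} k)) f ((Ban.qis_iff f).2 H)⟩

namespace ClosedSubcomplex

lemma qi_ι (T : ClosedSubcomplex.{u} k) (K : Ban.Cpx.{u} k)
    (h : ∀ n (x : K.X n), x ∈ T.S K n) : Ban.QI (T.ι K) := by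
  constructor
  · rintro i j l - - ⟨x, hx⟩ - y hy
    exact ⟨⟨y, h i y⟩, Subtype.ext hy⟩
  · intro i j l _ _ y hy
    exact ⟨⟨y, h j y⟩, Subtype.ext hy, 0, by rw [map_zero, add_zero]; rfl⟩

lemma qi_π (T : ClosedSubcomplex.{u} k) (K : Ban.Cpx.{u} k)
    (h : ∀ n (x : K.X n), x ∈ T.S K n → x = 0) : Ban.QI (T.π K) := by
  constructor
  · intro i j l _ _ x _ y hy
    obtain ⟨y, rfl⟩ := Submodule.Quotient.mk_surjective _ y
    exact ⟨y, sub_eq_zero.1 (h _ _ ((Submodule.Quotient.eq _).1 hy))⟩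
  · intro i j l _ _ y hy
    obtain ⟨y, rfl⟩ := Submodule.Quotient.mk_surjective _ y
    exact ⟨y, h _ _ ((Submodule.Quotient.mk_eq_zero _).1 hy), 0,
      by rw [map_zero, add_zero]; rfl⟩

end ClosedSubcomplex

lemma mem_essImage_of_qi (T : Ban.Cpx.{u} k ⥤ Ban.Cpx.{u} k)
    (hT : ∀ {K L : Ban.Cpx.{u} k} (f : K ⟶ L), Ban.QI f → Ban.QI (T.map f))
    (K : Ban.Cpx.{u} k) (h : Nonempty (Qob (T.obj K) ≅ Qob K)) :
    (descend T hT).essImage (Qob K) :=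
  ⟨Qob K, ⟨descendIso T hT K ≪≫ h.some⟩⟩

/-- A complex concentrated in degrees `-1` and `0` with injective differential lies in the left
heart. -/
lemma isLeftHeart_Qob (K : Ban.Cpx.{u} k) (h₁ : ∀ n, 0 < n → ∀ x : K.X n, x = 0)
    (h₂ : ∀ n, n < -1 → ∀ x : K.X n, x = 0)
    (h₃ : ∀ x : K.X (-1), (K.d (-1) 0).clm x = 0 → x = 0) : isLeftHeart k (Qob K) := by
  constructor
  · refine mem_essImage_of_qi _ (fun _ h => h.cyclesSub_sub 0) K
      (Ban.QI.nonempty_iso ((cyclesSub k 0).qi_ι K ?_))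
    exact fun n x => (mem_cyclesSub 0 K n x).2
      ⟨fun hn => h₁ _ (by lia) _, fun hn => h₁ n hn x⟩
  · refine mem_essImage_of_qi _ (fun _ h => h.cyclesSub_quot (-1)) K
      ((Ban.QI.nonempty_iso ((cyclesSub k (-1)).qi_π K ?_)).map Iso.symm)
    intro n x hx
    rw [mem_cyclesSub] at hx
    rcases lt_trichotomy n (-1) with hn | rfl | hn
    · exact h₂ n hn x
    · exact h₃ x (hx.1 rfl)
    · exact hx.2 hn

/-- A complex concentrated in degrees `0` and `1` whose differential has dense range lies in the
right heart. -/
lemma isRightHeart_Qob (K : Ban.Cpx.{u} k) (h₁ : ∀ n, 1 < n → ∀ x : K.X n, x = 0)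
    (h₂ : ∀ n, n < 0 → ∀ x : K.X n, x = 0)
    (h₃ : ∀ x : K.X 1, x ∈ Ban.im (K.d 0 1)) : isRightHeart k (Qob K) := by
  constructor
  · refine mem_essImage_of_qi _ (fun _ h => h.imageSub_sub 1) K
      (Ban.QI.nonempty_iso ((imageSub k 1).qi_ι K ?_))
    exact fun n x => (mem_imageSub 1 K n x).2
      ⟨fun hn => by subst hn; exact h₃ x, fun hn => h₁ n hn x⟩
  · refine mem_essImage_of_qi _ (fun _ h => h.imageSub_quot 0) K
      ((Ban.QI.nonempty_iso ((imageSub k 0).qi_π K ?_)).map Iso.symm)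
    intro n x hx
    rw [mem_imageSub] at hx
    rcases lt_trichotomy n 0 with hn | rfl | hn
    · exact h₂ n hn x
    · have h := hx.1 rfl
      have := Ban.im_le (K.d (0 - 1) 0) ⊥ isClosed_singleton (fun y => by
        rw [h₂ (0 - 1) (by lia) y, map_zero]; exact Submodule.zero_mem _) h
      exact (Submodule.mem_bot k).1 this
    · exact hx.2 hn

lemma leftTrunc_zero_of_pos (K : Ban.Cpx.{u} k) (n : ℤ) (hn : 0 < n)
    (x : ((leftTruncLE k).obj K).X n) : x = 0 :=
  Subtype.ext (((mem_cyclesSub 0 K n x.1).1 x.2).2 hn)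

lemma isLeftHeart_trunc (K : Ban.Cpx.{u} k) :
    isLeftHeart k (Qob ((leftTruncLE k).obj ((leftTruncGE k).obj K))) := by
  refine isLeftHeart_Qob _ (fun n hn x => leftTrunc_zero_of_pos _ n hn x) ?_ ?_
  · rintro n hn ⟨x, hx⟩
    refine Subtype.ext ?_
    obtain ⟨x, rfl⟩ := Submodule.Quotient.mk_surjective _ x
    exact (Submodule.Quotient.mk_eq_zero _).2
      ((mem_cyclesSub (-1) K n x).2 ⟨by lia, by lia⟩)
  · rintro ⟨x, hx⟩ h0
    refine Subtype.ext ?_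
    have h0' := congrArg Subtype.val h0
    obtain ⟨x, rfl⟩ := Submodule.Quotient.mk_surjective _ x
    have h1 : (K.d (-1) 0).clm x ∈ (cyclesSub k (-1)).S K 0 :=
      (Submodule.Quotient.mk_eq_zero _).1 h0'
    have h2 := ((mem_cyclesSub (-1) K 0 _).1 h1).2 (by lia)
    exact (Submodule.Quotient.mk_eq_zero _).2
      ((mem_cyclesSub (-1) K (-1) x).2 ⟨fun _ => h2, by lia⟩)

lemma rightTrunc_zero_of_lt (K : Ban.Cpx.{u} k) (n : ℤ) (hn : 1 < n)
    (x : ((rightTruncLE k).obj K).X n) : x = 0 :=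
  Subtype.ext (((mem_imageSub 1 _ n x.1).1 x.2).2 hn)

lemma rightTrunc_zero_of_neg (K : Ban.Cpx.{u} k) (n : ℤ) (hn : n < 0)
    (x : ((rightTruncLE k).obj ((rightTruncGE k).obj K)).X n) : x = 0 := by
  obtain ⟨x, hx⟩ := x
  refine Subtype.ext ?_
  obtain ⟨x, rfl⟩ := Submodule.Quotient.mk_surjective _ x
  exact (Submodule.Quotient.mk_eq_zero _).2 ((mem_imageSub 0 K n x).2 ⟨by lia, by lia⟩)

lemma rightTrunc_dense (K : Ban.Cpx.{u} k) (x : ((rightTruncLE k).obj K).X 1) :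
    x ∈ Ban.im (((rightTruncLE k).obj K).d 0 1) := by
  have h := ((mem_imageSub 1 _ 1 x.1).1 x.2).1 rfl
  rw [Ban.mem_im, Metric.mem_closure_iff] at h ⊢
  intro ε hε
  obtain ⟨_, ⟨y, rfl⟩, hy⟩ := h ε hε
  exact ⟨_, ⟨⟨y, (mem_imageSub 1 _ 0 y).2 ⟨by lia, by lia⟩⟩, rfl⟩, hy⟩

lemma isRightHeart_trunc (K : Ban.Cpx.{u} k) :
    isRightHeart k (Qob ((rightTruncLE k).obj ((rightTruncGE k).obj K))) :=
  isRightHeart_Qob _ (fun n hn x => rightTrunc_zero_of_lt _ n hn x)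
    (fun n hn x => rightTrunc_zero_of_neg K n hn x) (rightTrunc_dense _)

lemma exists_of_isRightHeart (X : DCat (Ban.{u} k)) (hX : isRightHeart k X) :
    ∃ K : Ban.Cpx.{u} k, Nonempty (Qob ((rightTruncLE k).obj ((rightTruncGE k).obj K)) ≅ X) := by
  obtain ⟨⟨Y, ⟨e⟩⟩, ⟨Z, ⟨e'⟩⟩⟩ := hX
  obtain ⟨A, ⟨a⟩⟩ := exists_iso_Qob Y
  obtain ⟨B, ⟨b⟩⟩ := exists_iso_Qob Z
  have hLE : ∀ {K L : Ban.Cpx.{u} k} (f : K ⟶ L), Ban.QI f → Ban.QI ((rightTruncLE k).map f) :=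
    fun _ h => h.imageSub_sub 1
  have hGE : ∀ {K L : Ban.Cpx.{u} k} (f : K ⟶ L), Ban.QI f → Ban.QI ((rightTruncGE k).map f) :=
    fun _ h => h.imageSub_quot 0
  have e₁ : Qob ((rightTruncLE k).obj A) ≅ X :=
    (descendIso _ hLE A).symm ≪≫ (tauRightLE k).mapIso a ≪≫ e
  have e₂ : Qob ((rightTruncGE k).obj B) ≅ X :=
    (descendIso _ hGE B).symm ≪≫ (tauRightGE k).mapIso b ≪≫ e'
  have hid : Ban.QI ((imageSub k 1).ι ((rightTruncLE k).obj A)) :=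
    (imageSub k 1).qi_ι _ (fun n x => (mem_imageSub 1 _ n x).2
      ⟨fun hn => by subst hn; exact rightTrunc_dense A x,
        fun hn => rightTrunc_zero_of_lt A n hn x⟩)
  obtain ⟨e₃⟩ := hid.nonempty_iso
  exact ⟨B, ⟨(descendIso _ hLE _).symm ≪≫ (tauRightLE k).mapIso (e₂ ≪≫ e₁.symm) ≪≫
    descendIso _ hLE _ ≪≫ e₃ ≪≫ e₁⟩⟩

lemma isLeftHeart_H (X : DCat (Ban.{u} k)) :
    isLeftHeart k ((tauLeftLE k).obj ((tauLeftGE k).obj X)) := by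
  obtain ⟨K, ⟨e⟩⟩ := exists_iso_Qob X
  have e₁ : Qob ((leftTruncGE k).obj K) ≅ (tauLeftGE k).obj X :=
    (descendIso _ (fun _ h => h.cyclesSub_quot (-1)) K).symm ≪≫ (tauLeftGE k).mapIso e
  have e₂ : Qob ((leftTruncLE k).obj ((leftTruncGE k).obj K)) ≅
      (tauLeftLE k).obj ((tauLeftGE k).obj X) :=
    (descendIso _ (fun _ h => h.cyclesSub_sub 0) _).symm ≪≫ (tauLeftLE k).mapIso e₁
  exact ⟨(Functor.essImage.ofIso e₂ (isLeftHeart_trunc K).1),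
    (Functor.essImage.ofIso e₂ (isLeftHeart_trunc K).2)⟩

lemma isRightHeart_H (X : DCat (Ban.{u} k)) :
    isRightHeart k ((tauRightLE k).obj ((tauRightGE k).obj X)) := by
  obtain ⟨K, ⟨e⟩⟩ := exists_iso_Qob X
  have e₁ : Qob ((rightTruncGE k).obj K) ≅ (tauRightGE k).obj X :=
    (descendIso _ (fun _ h => h.imageSub_quot 0) K).symm ≪≫ (tauRightGE k).mapIso e
  have e₂ : Qob ((rightTruncLE k).obj ((rightTruncGE k).obj K)) ≅
      (tauRightLE k).obj ((tauRightGE k).obj X) :=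
    (descendIso _ (fun _ h => h.imageSub_sub 1) _).symm ≪≫ (tauRightLE k).mapIso e₁
  exact ⟨(Functor.essImage.ofIso e₂ (isRightHeart_trunc K).1),
    (Functor.essImage.ofIso e₂ (isRightHeart_trunc K).2)⟩

variable (k) in
/-- The cohomological functor `H_ℓ^n = τ_ℓ^{≤0} ∘ τ_ℓ^{≥0} ∘ Σ^n : D(Ban) ⥤ C_ℓ(Ban)`. -/
def HLeft (n : ℤ) : DCat (Ban.{u} k) ⥤ LeftHeart.{u} k :=
  (isLeftHeart k).lift (shiftD k n ⋙ tauLeftGE k ⋙ tauLeftLE k) (fun _ => isLeftHeart_H _)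

variable (k) in
/-- The cohomological functor `H_r^n = τ_r^{≤0} ∘ τ_r^{≥0} ∘ Σ^n : D(Ban) ⥤ C_r(Ban)`. -/
def HRight (n : ℤ) : DCat (Ban.{u} k) ⥤ RightHeart.{u} k :=
  (isRightHeart k).lift (shiftD k n ⋙ tauRightGE k ⋙ tauRightLE k) (fun _ => isRightHeart_H _)

/-! ### The duality functor on the hearts -/

variable (k) in
/-- The (contravariant) duality functor on `D(Ban)`. -/
def dualD : (DCat (Ban.{u} k))ᵒᵖ ⥤ DCat (Ban.{u} k) :=
  (Localization.lift ((dualCpx k).rightOp ⋙ (qis (Ban.{u} k)).Q.op)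
    (fun _ _ f hf => by
      have := Localization.inverts (qis (Ban.{u} k)).Q (qis (Ban.{u} k)) ((dualCpx k).map f.op)
        ((Ban.qis_iff _).2 ((Ban.qis_iff f).1 hf).dual)
      exact inferInstanceAs (IsIso ((qis (Ban.{u} k)).Q.map ((dualCpx k).map f.op)).op))
    (qis (Ban.{u} k)).Q).leftOp

/-- The duality functor on `D(Ban)` is computed by the dual complex. -/
def dualDIso (K : Ban.Cpx.{u} k) :
    (dualD k).obj (Opposite.op (Qob K)) ≅ Qob ((dualCpx k).obj (Opposite.op K)) :=
  ((Localization.fac ((dualCpx k).rightOp ⋙ (qis (Ban.{u} k)).Q.op) _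
    (qis (Ban.{u} k)).Q).app K).unop.symm

lemma isLeftHeart_dual (X : DCat (Ban.{u} k)) (hX : isRightHeart k X) :
    isLeftHeart k ((dualD k).obj (Opposite.op X)) := by
  obtain ⟨K, ⟨e⟩⟩ := exists_of_isRightHeart X hX
  let E := (rightTruncLE k).obj ((rightTruncGE k).obj K)
  have h : isLeftHeart k (Qob ((dualCpx k).obj (Opposite.op E))) := by
    refine isLeftHeart_Qob _ ?_ ?_ ?_
    · intro n hn (φ : E.X (-n) →L[k] k)
      refine ContinuousLinearMap.ext fun x => ?_
      exact (congrArg φ (rightTrunc_zero_of_neg K (-n) (by lia) x)).trans (map_zero φ)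
    · intro n hn (φ : E.X (-n) →L[k] k)
      refine ContinuousLinearMap.ext fun x => ?_
      exact (congrArg φ (rightTrunc_zero_of_lt _ (-n) (by lia) x)).trans (map_zero φ)
    · intro (φ : E.X 1 →L[k] k) hφ
      refine ContinuousLinearMap.ext fun x => ?_
      exact Ban.im_le (E.d 0 1) (LinearMap.ker (φ : E.X 1 →ₗ[k] k))
        (ContinuousLinearMap.isClosed_ker φ)
        (fun y => congrArg (fun θ : E.X 0 →L[k] k => θ y) hφ) (rightTrunc_dense _ x)
  have e₂ := (dualDIso _).symm ≪≫ (dualD k).mapIso e.symm.op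
  exact ⟨Functor.essImage.ofIso e₂ h.1, Functor.essImage.ofIso e₂ h.2⟩

variable (k) in
/-- The (contravariant) duality functor `C_r(Ban) ⥤ C_ℓ(Ban)`, which takes `(e : A → B)` to
`(e^* : B^* → A^*)`. -/
def dualHeart : (RightHeart.{u} k)ᵒᵖ ⥤ LeftHeart.{u} k :=
  (isLeftHeart k).lift ((isRightHeart k).ι.op ⋙ dualD k)
    (fun X => isLeftHeart_dual _ X.unop.property)

/-! ### `ℓ¹`-homology and bounded cohomology -/

variable (k G) in
/-- `ℓ¹`-homology `M ↦ H_n^{ℓ¹}(G, M) = H_r^{-n}(L⁻(-)_G (M))`, a functor to the right heart. -/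
def l1Homology [HasL (coinvariants k G)] (n : ℤ) : GBan k G ⥤ RightHeart.{u} k :=
  CMinus.single (GBan k G) ⋙ (qisMinus (GBan k G)).Q ⋙ leftDerivedMinus (coinvariants k G) ⋙
    DMinus.toD (Ban.{u} k) ⋙ HRight k (-n)

variable (k G) in
/-- Bounded cohomology `M ↦ H_b^n(G, M) = H_ℓ^n(R⁺(-)^G (M))`, a functor to the left heart. -/
def boundedCohomology [HasR (invariants k G)] (n : ℤ) : GBan k G ⥤ LeftHeart.{u} k :=
  CPlus.single (GBan k G) ⋙ (qisPlus (GBan k G)).Q ⋙ rightDerivedPlus (invariants k G) ⋙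
    DPlus.toD (Ban.{u} k) ⋙ HLeft k n

end

end BanachDuality

set_option linter.unusedSectionVars false

namespace BanachDuality

noncomputable section

variable {k : Type} [RCLike k] {G : Type u} [Group G]

/-! ### Strict exactness in the category of isometric representations -/

namespace GBan

variable (k G) in
/-- The underlying Banach space of a representation. -/
@[simps]
def forget : GBan k G ⥤ Ban.{u} k where
  obj M := ⟨M⟩
  map f := ⟨f.clm⟩

instance : (forget k G).Additive where

/-- The restriction of the action to an invariant closed subspace. -/
def sub (M : GBan k G) (S : Submodule k M) (hS : IsClosed (S : Set M))
    (h : ∀ g, ∀ x ∈ S, M.ρ g x ∈ S) : GBan k G :=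
  haveI : CompleteSpace S := hS.completeSpace_coe
  { carrier := S
    ρ :=
      { toFun := fun g =>
          { toFun := fun x => ⟨M.ρ g x, h g x x.2⟩
            invFun := fun x => ⟨M.ρ g⁻¹ x, h g⁻¹ x x.2⟩
            map_add' := fun x y => Subtype.ext (map_add (M.ρ g) x.1 y.1)
            map_smul' := fun c x => Subtype.ext (map_smul (M.ρ g) c x.1)
            left_inv := fun x => Subtype.ext (M.ρ_inv_ρ g x)
            right_inv := fun x => Subtype.ext (M.ρ_ρ_inv g x)
            norm_map' := fun x => (M.ρ g).norm_map x.1 }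
        map_one' := by
          ext x
          change M.ρ 1 x.1 = x.1
          simp
        map_mul' := fun g g' => by
          ext x
          change M.ρ (g * g') x.1 = M.ρ g (M.ρ g' x.1)
          simp } }

/-- The inclusion of an invariant closed subspace. -/
def subι (M : GBan k G) (S : Submodule k M) (hS : IsClosed (S : Set M))
    (h : ∀ g, ∀ x ∈ S, M.ρ g x ∈ S) : sub M S hS h ⟶ M :=
  ⟨S.subtypeL, fun _ _ => rfl⟩

/-- The quotient norm is an infimum over representatives, and `M.ρ g` carries representatives to
representatives of the same norm. One inequality suffices: the other follows by applying it to
`g⁻¹`. -/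
lemma norm_quotMap_le (M : GBan k G) (S : Submodule k M)
    (h : ∀ g, ∀ x ∈ S, M.ρ g x ∈ S) (g : G) (x : M ⧸ S) :
    ‖quotMap S S ((M.ρ g).toContinuousLinearEquiv : M →L[k] M) (h g) x‖ ≤ ‖x‖ := by
  refine le_of_forall_pos_le_add fun ε hε => ?_
  obtain ⟨m, rfl, hm⟩ := Submodule.Quotient.norm_mk_lt x hε
  refine (Submodule.Quotient.norm_mk_le S _).trans ?_
  change ‖M.ρ g m‖ ≤ _
  rw [(M.ρ g).norm_map]
  exact hm.le

/-- The quotient representation by an invariant closed subspace. -/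
def quot (M : GBan k G) (S : Submodule k M) (hS : IsClosed (S : Set M))
    (h : ∀ g, ∀ x ∈ S, M.ρ g x ∈ S) : GBan k G :=
  haveI := hS
  { carrier := M ⧸ S
    ρ :=
      { toFun := fun g =>
          { toFun := quotMap S S ((M.ρ g).toContinuousLinearEquiv : M →L[k] M) (h g)
            invFun := quotMap S S ((M.ρ g⁻¹).toContinuousLinearEquiv : M →L[k] M) (h g⁻¹)
            map_add' := map_add _
            map_smul' := map_smul _
            left_inv := fun x => by
              obtain ⟨x, rfl⟩ := Submodule.Quotient.mk_surjective _ x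
              exact congrArg _ (M.ρ_inv_ρ g x)
            right_inv := fun x => by
              obtain ⟨x, rfl⟩ := Submodule.Quotient.mk_surjective _ x
              exact congrArg _ (M.ρ_ρ_inv g x)
            norm_map' := fun x => by
              refine le_antisymm (norm_quotMap_le M S h g x) ?_
              have := norm_quotMap_le M S h g⁻¹
                (quotMap S S ((M.ρ g).toContinuousLinearEquiv : M →L[k] M) (h g) x)
              refine le_trans (le_of_eq ?_) this
              obtain ⟨x, rfl⟩ := Submodule.Quotient.mk_surjective _ x
              exact congrArg (fun y : M => ‖(Submodule.Quotient.mk y : M ⧸ S)‖)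
                (M.ρ_inv_ρ g x).symm }
        map_one' := by
          ext x
          obtain ⟨x, rfl⟩ := Submodule.Quotient.mk_surjective _ x
          change Submodule.Quotient.mk (M.ρ 1 x) = Submodule.Quotient.mk x
          simp
        map_mul' := fun g g' => by
          ext x
          obtain ⟨x, rfl⟩ := Submodule.Quotient.mk_surjective _ x
          change Submodule.Quotient.mk (M.ρ (g * g') x) =
            Submodule.Quotient.mk (M.ρ g (M.ρ g' x))
          simp } }

/-- The projection to the quotient by an invariant closed subspace. -/
def quotπ (M : GBan k G) (S : Submodule k M) (hS : IsClosed (S : Set M))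
    (h : ∀ g, ∀ x ∈ S, M.ρ g x ∈ S) : M ⟶ quot M S hS h :=
  ⟨S.mkQL, fun _ _ => rfl⟩

lemma comp_eq_zero {E F H : GBan k G} {f : E ⟶ F} {g : F ⟶ H} (h : f ≫ g = 0) (x : E) :
    g.clm (f.clm x) = 0 := by
  rw [← comp_apply, h, zero_apply]

lemma ker_invariant {M N : GBan k G} (f : M ⟶ N) (g : G) (x : M)
    (hx : x ∈ LinearMap.ker (f.clm : M →ₗ[k] N)) :
    M.ρ g x ∈ LinearMap.ker (f.clm : M →ₗ[k] N) := by
  have hx' : f.clm x = 0 := hx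
  change f.clm (M.ρ g x) = 0
  rw [f.equivariant, hx', map_zero]

/-- The kernel of a morphism, as a subrepresentation. -/
abbrev kernelObj {M N : GBan k G} (f : M ⟶ N) : GBan k G :=
  sub M _ (ContinuousLinearMap.isClosed_ker f.clm) (ker_invariant f)

/-- The inclusion of the kernel. -/
abbrev kernelι {M N : GBan k G} (f : M ⟶ N) : kernelObj f ⟶ M :=
  subι M _ (ContinuousLinearMap.isClosed_ker f.clm) (ker_invariant f)

lemma range_invariant {M N : GBan k G} (f : M ⟶ N) (g : G) :
    ∀ y ∈ (LinearMap.range (f.clm : M →ₗ[k] N)).topologicalClosure,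
      N.ρ g y ∈ (LinearMap.range (f.clm : M →ₗ[k] N)).topologicalClosure := by
  let R := (LinearMap.range (f.clm : M →ₗ[k] N)).topologicalClosure
  have : R ≤ R.comap ((N.ρ g).toContinuousLinearEquiv : N →ₗ[k] N) := by
    refine Submodule.topologicalClosure_minimal _ ?_
      ((Submodule.isClosed_topologicalClosure _).preimage (N.ρ g).continuous)
    rintro _ ⟨x, rfl⟩
    exact Submodule.le_topologicalClosure _ ⟨M.ρ g x, f.equivariant g x⟩
  exact fun y hy => this hy

/-- Compare `π` with the projection `q` modulo the closed range of `g`. The universal property of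
the cokernel gives `d` with `d ≫ e = 𝟙`, so every representative of `d z` is a preimage of `z`. -/
lemma surjective_of_normalEpi {E F : GBan k G} (π : E ⟶ F) (hπ : NormalEpi π) :
    Function.Surjective π.clm := by
  obtain ⟨W, g, w, hc⟩ := hπ
  let R : Submodule k E := (LinearMap.range (g.clm : W →ₗ[k] E)).topologicalClosure
  have hR : IsClosed (R : Set E) := Submodule.isClosed_topologicalClosure _
  have hker : R ≤ LinearMap.ker (π.clm : E →ₗ[k] F) := by
    refine Submodule.topologicalClosure_minimal _ ?_ (ContinuousLinearMap.isClosed_ker π.clm)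
    rintro _ ⟨x, rfl⟩
    exact comp_eq_zero w x
  let q : E ⟶ quot E R hR (range_invariant g) := quotπ E R hR _
  have hq : g ≫ q = 0 := by
    ext x
    exact (Submodule.Quotient.mk_eq_zero R).2 (Submodule.le_topologicalClosure _ ⟨x, rfl⟩)
  let e : quot E R hR (range_invariant g) ⟶ F :=
    ⟨⟨Submodule.liftQ R (π.clm : E →ₗ[k] F) hker, by
      refine (Submodule.isOpenQuotientMap_mkQ R).isQuotientMap.continuous_iff.2 ?_
      exact π.clm.continuous⟩, fun a x => by
        obtain ⟨x, rfl⟩ := Submodule.Quotient.mk_surjective _ x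
        exact π.equivariant a x⟩
  let d : F ⟶ quot E R hR (range_invariant g) := hc.desc (CokernelCofork.ofπ q hq)
  have hd : π ≫ d = q := hc.fac (CokernelCofork.ofπ q hq) WalkingParallelPair.one
  have hqe : q ≫ e = π := by ext x; rfl
  have hde : d ≫ e = 𝟙 F := by
    refine Cofork.IsColimit.hom_ext hc ?_
    change π ≫ d ≫ e = π ≫ 𝟙 F
    rw [← Category.assoc, hd, hqe, Category.comp_id]
  intro z
  obtain ⟨x, hx⟩ := Submodule.Quotient.mk_surjective R (d.clm z)
  refine ⟨x, ?_⟩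
  have h1 : e.clm (d.clm z) = z := by rw [← comp_apply, hde, id_apply]
  rw [← hx] at h1
  exact h1

/-- By the open mapping theorem a continuous surjection of Banach spaces is the cokernel of its
kernel, so strictness comes for free. The criterion does not mention the action, which is what
allows testing on underlying Banach spaces. -/
lemma strictExact_iff (S : ShortComplex (GBan k G)) :
    StrictExact S ↔ ∀ x : S.X₂, S.g.clm x = 0 → ∃ y : S.X₁, S.f.clm y = x := by
  let j : kernelObj S.g ⟶ S.X₂ := kernelι S.g
  have hj : j ≫ S.g = 0 := by ext x; exact x.2
  constructor
  · rintro ⟨Z, ι, w, π, ⟨hι⟩, ⟨hπ⟩, fac⟩ x hx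
    let l : kernelObj S.g ⟶ Z := hι.lift (KernelFork.ofι j hj)
    have hl : l ≫ ι = j := hι.fac (KernelFork.ofι j hj) WalkingParallelPair.zero
    obtain ⟨y, hy⟩ := surjective_of_normalEpi π hπ (l.clm ⟨x, hx⟩)
    refine ⟨y, ?_⟩
    rw [← fac, comp_apply, hy]
    exact congrArg (fun φ : kernelObj S.g ⟶ S.X₂ => φ.clm ⟨x, hx⟩) hl
  · intro H
    let π : S.X₁ ⟶ kernelObj S.g :=
      ⟨S.f.clm.codRestrict _ (fun x => comp_eq_zero S.zero x),
        fun a x => Subtype.ext (S.f.equivariant a x)⟩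
    have hπ : Function.Surjective π.clm := by
      rintro ⟨x, hx⟩
      obtain ⟨y, rfl⟩ := H x hx
      exact ⟨y, rfl⟩
    refine ⟨_, j, hj, π, ⟨?_⟩, ⟨?_⟩, rfl⟩
    · refine KernelFork.IsLimit.ofι j hj
        (fun {E} m hm => ⟨m.clm.codRestrict _ (fun x => comp_eq_zero hm x),
          fun a x => Subtype.ext (m.equivariant a x)⟩)
        (fun {E} m hm => rfl) ?_
      rintro E m hm m' rfl
      rfl
    · let i : kernelObj π ⟶ S.X₁ := kernelι π
      have hi : i ≫ π = 0 := by ext x; exact x.2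
      have key : ∀ {H : GBan k G} (h : S.X₁ ⟶ H), i ≫ h = 0 →
          ∃ l : kernelObj S.g ⟶ H, π ≫ l = h := fun {H} h hh =>
        let ⟨l, hl⟩ := Ban.exists_factor π.clm hπ h.clm (fun x hx => comp_eq_zero hh ⟨x, hx⟩)
        -- The factor through the surjection `π` is automatically equivariant: this is tested on
        -- elements `π x`.
        ⟨⟨l, fun a x => by
          obtain ⟨x, rfl⟩ := hπ x
          rw [← π.equivariant]
          exact ((hl _).trans (h.equivariant a x)).trans (congrArg (H.ρ a) (hl x).symm)⟩,
          hom_ext hl⟩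
      refine ⟨_, i, hi, CokernelCofork.IsColimit.ofπ π hi
        (fun {E} m hm => (key m hm).choose) (fun {E} m hm => (key m hm).choose_spec) ?_⟩
      rintro E m hm m' hm'
      ext x
      obtain ⟨y, rfl⟩ := hπ x
      rw [← comp_apply, ← comp_apply, hm', (key m hm).choose_spec]

/-- The complexes of isometric representations. -/
abbrev Cpx (k : Type) [RCLike k] (G : Type u) [Group G] := CochainComplex (GBan k G) ℤ

variable (k G) in
/-- The underlying complex of Banach spaces of a complex of representations. -/
abbrev forgetCpx : Cpx k G ⥤ Ban.Cpx.{u} k := (forget k G).mapHomologicalComplex _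

lemma acyclic_iff (K : Cpx k G) :
    acyclic (GBan k G) K ↔ acyclic (Ban.{u} k) ((forgetCpx k G).obj K) :=
  forall_congr' fun n => (strictExact_iff _).trans
    (Ban.strictExact_iff (((forgetCpx k G).obj K).sc' (n - 1) n (n + 1))).symm

end GBan

lemma Ban.acyclic_of_iso {K L : Ban.Cpx.{u} k} (e : K ≅ L) (h : acyclic (Ban.{u} k) K) :
    acyclic (Ban.{u} k) L := by
  rw [Ban.acyclic_iff] at h ⊢
  intro i j l hij hjl x hx
  obtain ⟨y, hy⟩ := h i j l hij hjl ((e.inv.f j).clm x) (by rw [Ban.d_f_apply, hx, map_zero])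
  refine ⟨(e.hom.f i).clm y, ?_⟩
  rw [Ban.d_f_apply, hy, ← Ban.comp_apply, ← HomologicalComplex.comp_f, e.inv_hom_id]
  rfl

/-- The forgetful functor is additive, hence commutes with mapping cones, and it preserves and
reflects acyclicity. -/
lemma GBan.qis_iff {K L : GBan.Cpx k G} (f : K ⟶ L) :
    qis (GBan k G) f ↔ Ban.QI ((GBan.forgetCpx k G).map f) := by
  rw [← Ban.qis_iff]
  have e := CochainComplex.mappingCone.mapHomologicalComplexIso f (GBan.forget k G)
  exact (GBan.acyclic_iff _).trans ⟨Ban.acyclic_of_iso e, Ban.acyclic_of_iso e.symm⟩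

/-- An additive functor to Banach spaces that preserves acyclic complexes preserves
quasi-isomorphisms. -/
lemma qis_map_Ban (Φ : GBan k G ⥤ Ban.{u} k) [Φ.Additive]
    (h : ∀ K, acyclic (GBan k G) K → acyclic (Ban.{u} k) ((Φ.mapHomologicalComplex _).obj K))
    {K L : GBan.Cpx k G} (f : K ⟶ L) (hf : qis (GBan k G) f) :
    Ban.QI ((Φ.mapHomologicalComplex _).map f) :=
  (Ban.qis_iff _).1
    (Ban.acyclic_of_iso (CochainComplex.mappingCone.mapHomologicalComplexIso f Φ) (h _ hf))

/-! ### Quasi-isomorphisms and mapping cones -/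

namespace Ban

/-- Exactness of the mapping cone of `f` at a given place, in terms of elements. -/
def ConeExact {K L : Cpx.{u} k} (f : K ⟶ L) (i j l : ℤ) : Prop :=
  ∀ (x : K.X l) (y : L.X j), (K.d l (l + 1)).clm x = 0 → (f.f l).clm x = (L.d j l).clm y →
    ∃ (x' : K.X j) (y' : L.X i), x = (K.d j l).clm x' ∧
      y = (f.f j).clm x' + (L.d i j).clm y'

/-- Injectivity on cohomology makes the first entry of a cone cycle a boundary; once that is
removed, surjectivity corrects the second entry. Unlike the two halves of `QI`, the single condition
`ConeExact` lends itself to successive approximation. -/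
lemma QI.coneExact {K L : Cpx.{u} k} {f : K ⟶ L} (H : QI f) (i j l : ℤ) (hij : i + 1 = j)
    (hjl : j + 1 = l) : ConeExact f i j l := by
  intro x y hx hxy
  obtain ⟨x₀, rfl⟩ := H.inj j l (l + 1) hjl rfl x hx y hxy.symm
  obtain ⟨z, hz, y', hy⟩ := H.surj i j l hij hjl (y - (f.f j).clm x₀) (by
    rw [map_sub, d_f_apply, ← hxy, sub_self])
  refine ⟨x₀ + z, y', by rw [map_add, hz, add_zero], ?_⟩
  rw [map_add, add_assoc, ← hy, add_sub_cancel]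

lemma QI.of_coneExact {K L : Cpx.{u} k} {f : K ⟶ L}
    (H : ∀ i j l : ℤ, i + 1 = j → j + 1 = l → ConeExact f i j l) : QI f := by
  constructor
  · rintro i j l hij rfl x hx y hy
    -- Injectivity in degree `j` is exactness of the cone one degree lower, whence `i - 1`.
    obtain ⟨x', -, h, -⟩ := H (i - 1) i j (by lia) hij x y hx hy.symm
    exact ⟨x', h.symm⟩
  · intro i j l hij hjl y hy
    obtain ⟨x', y', h, h'⟩ := H i j l hij hjl 0 y (map_zero _) (by rw [hy, map_zero])
    exact ⟨x', h.symm, y', h'⟩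

/-- Exactness of the mapping cone by successive approximation. -/
lemma coneExact_of_filtration {K L : Cpx.{u} k} (f : K ⟶ L) (i j l : ℤ)
    (P : ℤ → K.X l → L.X j → Prop) (a b : ℤ)
    (start : ∀ x y, (K.d l (l + 1)).clm x = 0 → (f.f l).clm x = (L.d j l).clm y →
      ∃ (x' : K.X j) (y' : L.X i), P a (x - (K.d j l).clm x')
        (y - ((f.f j).clm x' + (L.d i j).clm y')))
    (step : ∀ c x y, P c x y → (K.d l (l + 1)).clm x = 0 → (f.f l).clm x = (L.d j l).clm y →
      ∃ (x' : K.X j) (y' : L.X i), P (c + 1) (x - (K.d j l).clm x')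
        (y - ((f.f j).clm x' + (L.d i j).clm y')))
    (hlast : ∀ c x y, b ≤ c → P c x y → (K.d l (l + 1)).clm x = 0 →
      (f.f l).clm x = (L.d j l).clm y → x = 0 ∧ y = 0) : ConeExact f i j l := by
  -- Subtracting a boundary of the cone leaves a cycle of the cone, so `step` can be iterated.
  have cycle : ∀ (x : K.X l) (y : L.X j) (x' : K.X j) (y' : L.X i),
      (K.d l (l + 1)).clm x = 0 → (f.f l).clm x = (L.d j l).clm y →
      (K.d l (l + 1)).clm (x - (K.d j l).clm x') = 0 ∧ (f.f l).clm (x - (K.d j l).clm x') =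
        (L.d j l).clm (y - ((f.f j).clm x' + (L.d i j).clm y')) := by
    intro x y x' y' h h'
    refine ⟨by rw [map_sub, d_d_apply, h, sub_zero], ?_⟩
    rw [map_sub, map_sub, map_add, d_d_apply, d_f_apply, h', add_zero]
  -- Induction on the number `n` of steps that separate the level `c` from `b`, where `hlast` takes
  -- over.
  have main : ∀ (n : ℕ) (c : ℤ) (x : K.X l) (y : L.X j), b ≤ c + n → P c x y →
      (K.d l (l + 1)).clm x = 0 → (f.f l).clm x = (L.d j l).clm y →
      ∃ (x' : K.X j) (y' : L.X i), x = (K.d j l).clm x' ∧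
        y = (f.f j).clm x' + (L.d i j).clm y' := by
    intro n
    induction n with
    | zero =>
      intro c x y hc hP h h'
      obtain ⟨rfl, rfl⟩ := hlast c x y (by simpa using hc) hP h h'
      exact ⟨0, 0, by simp, by simp⟩
    | succ n ih =>
      intro c x y hc hP h h'
      obtain ⟨x₁, y₁, hP'⟩ := step c x y hP h h'
      obtain ⟨h₁, h₁'⟩ := cycle x y x₁ y₁ h h'
      obtain ⟨x₂, y₂, e, e'⟩ := ih (c + 1) _ _ (by push_cast at hc; lia) hP' h₁ h₁'
      refine ⟨x₁ + x₂, y₁ + y₂, ?_, ?_⟩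
      · rw [map_add, ← e]; abel
      · rw [map_add, map_add, add_add_add_comm, ← e']; abel
  intro x y h h'
  obtain ⟨x₁, y₁, hP⟩ := start x y h h'
  obtain ⟨h₁, h₁'⟩ := cycle x y x₁ y₁ h h'
  obtain ⟨x₂, y₂, e, e'⟩ := main (b - a).toNat a _ _ (by lia) hP h₁ h₁'
  refine ⟨x₁ + x₂, y₁ + y₂, ?_, ?_⟩
  · rw [map_add, ← e]; abel
  · rw [map_add, map_add, add_add_add_comm, ← e']; abel

/-- A degreewise bijective chain map is a quasi-isomorphism. -/
lemma QI.of_bijective {K L : Cpx.{u} k} (f : K ⟶ L)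
    (h : ∀ n, Function.Bijective (f.f n).clm) : QI f := by
  constructor
  · intro i j l _ _ x _ y hy
    obtain ⟨x', rfl⟩ := (h i).2 y
    refine ⟨x', (h j).1 ?_⟩
    rw [← d_f_apply, hy]
  · intro i j l _ _ y hy
    obtain ⟨x, rfl⟩ := (h j).2 y
    refine ⟨x, (h l).1 ?_, 0, by simp⟩
    rw [← d_f_apply, hy, map_zero]

end Ban

/-! ### Biproducts of families with finite support -/

section Biproducts

variable {A : Type*} [Category* A] [Preadditive A] {J : Type*}

-- A total degree contains infinitely many bidegrees, so the index set cannot be taken finite. The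
-- biproduct over a finite set outside which all terms vanish serves for the whole family, with zero
-- structure maps elsewhere.
open scoped Classical in
lemma hasBiproduct_of_finite [HasFiniteBiproducts A] (X : J → A) (s : Finset J)
    (hs : ∀ j, j ∉ s → IsZero (X j)) : HasBiproduct X := by
  let Y : s → A := fun j => X j
  let b : Bicone X :=
    { pt := ⨁ Y
      π := fun j => if h : j ∈ s then biproduct.π Y ⟨j, h⟩ else 0
      ι := fun j => if h : j ∈ s then biproduct.ι Y ⟨j, h⟩ else 0
      ι_π := fun j j' => by
        by_cases h : j ∈ s
        · by_cases h' : j' ∈ s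
          · rw [dif_pos h, dif_pos h']
            by_cases e : j = j'
            · subst e
              rw [dif_pos rfl, biproduct.ι_π_self]
              rfl
            · rw [dif_neg e, biproduct.ι_π_ne]
              exact fun e' => e (congrArg Subtype.val e')
          · exact (hs _ h').eq_of_tgt _ _
        · exact (hs _ h).eq_of_src _ _ }
  have hπ : ∀ j : s, b.π j = biproduct.π Y j := fun j => dif_pos j.2
  have hι : ∀ j : s, b.ι j = biproduct.ι Y j := fun j => dif_pos j.2
  refine HasBiproduct.mk ⟨b, ⟨Fan.IsLimit.mk _ (fun t => biproduct.lift fun j => t.proj j.1) ?_ ?_,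
    Cofan.IsColimit.mk _ (fun t => biproduct.desc fun j => t.inj j.1) ?_ ?_⟩⟩
  · intro t j
    by_cases h : j ∈ s
    · change _ ≫ b.π j = _
      rw [hπ ⟨j, h⟩, biproduct.lift_π]
    · exact (hs _ h).eq_of_tgt _ _
  · intro t m hm
    refine biproduct.hom_ext _ _ fun j => ?_
    rw [biproduct.lift_π, ← hm j.1]
    exact congrArg (m ≫ ·) (hπ j).symm
  · intro t j
    by_cases h : j ∈ s
    · change b.ι j ≫ _ = _
      rw [hι ⟨j, h⟩, biproduct.ι_desc]
    · exact (hs _ h).eq_of_src _ _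
  · intro t m hm
    refine biproduct.hom_ext' _ _ fun j => ?_
    rw [biproduct.ι_desc, ← hm j.1]
    exact congrArg (· ≫ m) (hι j).symm

/-- A finite sum expressing the identity survives any additive functor; this is how elements of the
image of a biproduct are seen to be determined by their components. -/
lemma biproduct_total (X : J → A) [HasBiproduct X] (s : Finset J)
    (hs : ∀ j, j ∉ s → IsZero (X j)) :
    ∑ j ∈ s, biproduct.π X j ≫ biproduct.ι X j = 𝟙 (⨁ X) := by
  classical
  refine biproduct.hom_ext _ _ fun j => ?_
  by_cases hj : j ∈ s
  · rw [Preadditive.sum_comp, Finset.sum_eq_single j]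
    · simp
    · intro i _ hij
      rw [Category.assoc, biproduct.ι_π_ne _ hij, comp_zero]
    · exact fun h => absurd hj h
  · exact (hs _ hj).eq_of_tgt _ _

/-- Detection of elements of the image of a biproduct under an additive functor. -/
lemma eq_zero_of_map_biproduct_π (Φ : A ⥤ Ban.{u} k) [Φ.Additive] (X : J → A)
    [HasBiproduct X] (hs : {j | ¬ IsZero (X j)}.Finite) (x : Φ.obj (⨁ X))
    (hx : ∀ j, (Φ.map (biproduct.π X j)).clm x = 0) : x = 0 := by
  have h := congrArg (fun f => (Φ.map f).clm x)
    (biproduct_total X hs.toFinset (fun j hj => by simpa using hj))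
  simp only [Φ.map_sum, Φ.map_id, Ban.id_apply, Φ.map_comp] at h
  rw [← h]
  have hsum : ∀ t : Finset J, (∑ j ∈ t, Φ.map (biproduct.π X j) ≫ Φ.map (biproduct.ι X j)).clm x
      = 0 := by
    classical
    intro t
    induction t using Finset.induction_on with
    | empty => rfl
    | insert a t ha ih =>
      rw [Finset.sum_insert ha, Ban.add_apply, ih, Ban.comp_apply, hx, map_zero, add_zero]
  exact hsum _

end Biproducts

/-! ### Total complexes -/

namespace Tot

variable {A : Type*} [Category* A] [Preadditive A] {ι : Type} {c : ComplexShape ι} (deg : ι → ℤ)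

/-- The bidegrees of total degree `m`. -/
abbrev Fib (m : ℤ) := {x : ℤ × ι // x.1 + deg x.2 = m}

/-- The entries of total degree `m` of a double complex. -/
abbrev fam (K : CochainComplex (HomologicalComplex A c) ℤ) (m : ℤ) : Fib deg m → A :=
  fun x => (K.X x.1.1).X x.1.2

/-- A double complex with finitely many nonzero entries in each total degree. -/
def FiniteSupport (K : CochainComplex (HomologicalComplex A c) ℤ) : Prop :=
  ∀ m, {x : Fib deg m | ¬ IsZero (fam deg K m x)}.Finite

/-- The total complex of a double complex can be formed. -/
class HasTot (K : CochainComplex (HomologicalComplex A c) ℤ) : Prop where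
  hasBiproduct (m : ℤ) : HasBiproduct (fam deg K m)

attribute [instance] HasTot.hasBiproduct

lemma FiniteSupport.hasTot [HasFiniteBiproducts A]
    {K : CochainComplex (HomologicalComplex A c) ℤ} (h : FiniteSupport deg K) : HasTot deg K :=
  ⟨fun m => hasBiproduct_of_finite _ (h m).toFinset (fun j hj => by simpa using hj)⟩

variable (K : CochainComplex (HomologicalComplex A c) ℤ) [HasTot deg K]

/-- The projection to an entry of the double complex, zero if the degrees do not match. -/
def π (m p : ℤ) (n : ι) : (⨁ fam deg K m) ⟶ (K.X p).X n :=
  if h : p + deg n = m then biproduct.π (fam deg K m) ⟨(p, n), h⟩ else 0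

/-- The inclusion of an entry of the double complex. -/
def incl (m p : ℤ) (n : ι) (h : p + deg n = m) : (K.X p).X n ⟶ (⨁ fam deg K m) :=
  biproduct.ι (fam deg K m) ⟨(p, n), h⟩

variable {deg K}

lemma π_eq_zero {m p : ℤ} {n : ι} (h : p + deg n ≠ m) : π deg K m p n = 0 := dif_neg h

lemma hom_ext {m : ℤ} {Z : A} {f g : Z ⟶ ⨁ fam deg K m}
    (h : ∀ p n, p + deg n = m → f ≫ π deg K m p n = g ≫ π deg K m p n) : f = g := by
  refine biproduct.hom_ext _ _ fun ⟨⟨p, n⟩, hx⟩ => ?_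
  have := h p n hx
  rwa [π, dif_pos hx] at this

lemma lift_π {m p : ℤ} {n : ι} (h : p + deg n = m) {Z : A}
    (f : ∀ x, Z ⟶ fam deg K m x) : biproduct.lift f ≫ π deg K m p n = f ⟨(p, n), h⟩ := by
  rw [π, dif_pos h, biproduct.lift_π]

lemma incl_π_self {m p : ℤ} {n : ι} (h : p + deg n = m) :
    incl deg K m p n h ≫ π deg K m p n = 𝟙 _ := by
  rw [π, dif_pos h]
  exact biproduct.ι_π_self _ _

lemma incl_π_ne {m p p' : ℤ} {n n' : ι} (h : p + deg n = m) (hne : (p, n) ≠ (p', n')) :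
    incl deg K m p n h ≫ π deg K m p' n' = 0 := by
  rw [π]
  split_ifs with h'
  · exact biproduct.ι_π_ne _ (fun e => hne (congrArg Subtype.val e))
  · exact comp_zero

variable (deg K) in
/-- The differential of the total complex. -/
def d (m m' : ℤ) : (⨁ fam deg K m) ⟶ (⨁ fam deg K m') :=
  if m + 1 = m' then biproduct.lift fun x =>
    π deg K m (x.1.1 - 1) x.1.2 ≫ (K.d (x.1.1 - 1) x.1.1).f x.1.2 +
      x.1.1.negOnePow • π deg K m x.1.1 (c.prev x.1.2) ≫ (K.X x.1.1).d (c.prev x.1.2) x.1.2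
  else 0

/-- The degree function is compatible with the shape of the rows. -/
class DegCompat (c : ComplexShape ι) (deg : ι → ℤ) : Prop where
  deg_eq {n n' : ι} : c.Rel n n' → deg n' = deg n + 1

variable [DegCompat c deg]

/-- No hypothesis relates `(p', n)` to the total degree `m'`: if the degrees do not match, both
projections vanish or the row differential is zero by shape. Later computations are thereby free of
degree bookkeeping. -/
lemma d_π {m m' p p' : ℤ} {n : ι} (hm : m + 1 = m') (hp : p + 1 = p') :
    d deg K m m' ≫ π deg K m' p' n = π deg K m p n ≫ (K.d p p').f n +
      p'.negOnePow • π deg K m p' (c.prev n) ≫ (K.X p').d (c.prev n) n := by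
  obtain rfl : p = p' - 1 := by lia
  rw [d, if_pos hm]
  by_cases h : p' + deg n = m'
  · exact lift_π h _
  · rw [π_eq_zero h, comp_zero, π_eq_zero (by lia), zero_comp, zero_add]
    by_cases hc : c.Rel (c.prev n) n
    · have := DegCompat.deg_eq (deg := deg) hc
      rw [π_eq_zero (by lia), zero_comp, smul_zero]
    · rw [(K.X p').shape _ _ hc, comp_zero, smul_zero]

lemma d_π_assoc {m m' p p' : ℤ} {n : ι} (hm : m + 1 = m') (hp : p + 1 = p') {Z : A}
    (h : (K.X p').X n ⟶ Z) :
    d deg K m m' ≫ π deg K m' p' n ≫ h = (π deg K m p n ≫ (K.d p p').f n +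
      p'.negOnePow • π deg K m p' (c.prev n) ≫ (K.X p').d (c.prev n) n) ≫ h := by
  rw [← Category.assoc, d_π hm hp]

variable (deg K) in
/-- The total complex of a double complex. -/
@[simps]
def tot : CochainComplex A ℤ where
  X m := ⨁ fam deg K m
  d m m' := d deg K m m'
  shape m m' h := if_neg h
  d_comp_d' := by
    rintro i j l rfl rfl
    refine hom_ext fun p n _ => ?_
    have h1 : p - 1 - 1 + 1 = p - 1 := by lia
    have h2 : p - 1 + 1 = p := by lia
    -- The sign of the row differential alternates with `p`; this cancels the two mixed terms of the
    -- squared differential.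
    have h3 : p.negOnePow = -(p - 1).negOnePow := by
      rw [← Int.negOnePow_succ, h2]
    have e1 : (K.d (p - 1 - 1) (p - 1)).f n ≫ (K.d (p - 1) p).f n = 0 := by
      rw [← HomologicalComplex.comp_f, K.d_comp_d, HomologicalComplex.zero_f]
    rw [Category.assoc, d_π rfl h2, Preadditive.comp_add, d_π_assoc rfl h1,
      Linear.comp_units_smul, d_π_assoc rfl h2, h3]
    simp only [Preadditive.add_comp, Preadditive.neg_comp, Category.assoc, Linear.units_smul_comp, e1,
      HomologicalComplex.d_comp_d, comp_zero, zero_comp, smul_zero, zero_add, add_zero,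
      HomologicalComplex.Hom.comm, neg_zero, Units.neg_smul, add_neg_cancel]

end Tot

/-! ### Functoriality of the total complex. -/

namespace Tot

variable {A : Type*} [Category* A] [Preadditive A] {ι : Type} {c : ComplexShape ι} {deg : ι → ℤ}

section Functoriality

variable {K L N : CochainComplex (HomologicalComplex A c) ℤ} [HasTot deg K] [HasTot deg L]
  [HasTot deg N]

variable (deg) in
/-- The map on total complexes induced by a map of double complexes. -/
def mapX (f : K ⟶ L) (m : ℤ) : (⨁ fam deg K m) ⟶ (⨁ fam deg L m) :=
  biproduct.lift fun x => π deg K m x.1.1 x.1.2 ≫ (f.f x.1.1).f x.1.2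

lemma mapX_π (f : K ⟶ L) (m p : ℤ) (n : ι) :
    mapX deg f m ≫ π deg L m p n = π deg K m p n ≫ (f.f p).f n := by
  by_cases h : p + deg n = m
  · exact lift_π h _
  · rw [π_eq_zero h, π_eq_zero h, comp_zero, zero_comp]

lemma mapX_π_assoc (f : K ⟶ L) (m p : ℤ) (n : ι) {Z : A} (h : (L.X p).X n ⟶ Z) :
    mapX deg f m ≫ π deg L m p n ≫ h = π deg K m p n ≫ (f.f p).f n ≫ h := by
  rw [← Category.assoc, mapX_π, Category.assoc]

variable [DegCompat c deg]

variable (deg) in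
/-- The chain map on total complexes induced by a map of double complexes. -/
@[simps]
def map (f : K ⟶ L) : tot deg K ⟶ tot deg L where
  f m := mapX deg f m
  comm' := by
    rintro m _ rfl
    change mapX deg f m ≫ d deg L m (m + 1) = d deg K m (m + 1) ≫ mapX deg f (m + 1)
    refine hom_ext fun p n _ => ?_
    have hp : p - 1 + 1 = p := by lia
    have e : (f.f (p - 1)).f n ≫ (L.d (p - 1) p).f n = (K.d (p - 1) p).f n ≫ (f.f p).f n := by
      rw [← HomologicalComplex.comp_f, ← HomologicalComplex.comp_f, f.comm]
    simp only [Category.assoc, d_π rfl hp, mapX_π, Preadditive.comp_add,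
      Linear.comp_units_smul, mapX_π_assoc, d_π_assoc rfl hp, Preadditive.add_comp,
      Linear.units_smul_comp, e, HomologicalComplex.Hom.comm]

lemma map_id : map deg (𝟙 K) = 𝟙 (tot deg K) := by
  ext m
  change mapX deg (𝟙 K) m = 𝟙 (⨁ fam deg K m)
  refine hom_ext fun p n _ => ?_
  rw [mapX_π, HomologicalComplex.id_f, HomologicalComplex.id_f, Category.comp_id,
    Category.id_comp]

lemma map_comp (f : K ⟶ L) (g : L ⟶ N) : map deg (f ≫ g) = map deg f ≫ map deg g := by
  ext m
  change mapX deg (f ≫ g) m = mapX deg f m ≫ mapX deg g m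
  refine hom_ext fun p n _ => ?_
  simp only [mapX_π, HomologicalComplex.comp_f, Category.assoc, mapX_π_assoc]

end Functoriality

end Tot

/-! ### Complexes of Banach spaces with components -/

/-- A complex of Banach spaces whose elements are families of components in a double complex. -/
structure Decomp {ι : Type} (c : ComplexShape ι) (deg : ι → ℤ) (Z : Ban.Cpx.{u} k) where
  X : ℤ → ι → Ban.{u} k
  dv (p p' : ℤ) (n : ι) : X p n →L[k] X p' n
  dh (p : ℤ) (n n' : ι) : X p n →L[k] X p n'
  dh_shape (p : ℤ) (n n' : ι) (x : X p n) : ¬ c.Rel n n' → dh p n n' x = 0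
  comp (m p : ℤ) (n : ι) : Z.X m →L[k] X p n
  elem (m p : ℤ) (n : ι) (h : p + deg n = m) : X p n →L[k] Z.X m
  comp_eq_zero {m p : ℤ} {n : ι} (h : p + deg n ≠ m) (x : Z.X m) : comp m p n x = 0
  comp_elem_self {m p : ℤ} {n : ι} (h : p + deg n = m) (x : X p n) :
    comp m p n (elem m p n h x) = x
  comp_elem_ne {m p p' : ℤ} {n n' : ι} (h : p + deg n = m) (hne : p = p' → n = n' → False)
    (x : X p n) : comp m p' n' (elem m p n h x) = 0
  comp_d {m m' p p' : ℤ} {n : ι} (hm : m + 1 = m') (hp : p + 1 = p') (x : Z.X m) :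
    comp m' p' n ((Z.d m m').clm x) =
      dv p p' n (comp m p n x) + (p'.negOnePow : ℤ) • dh p' (c.prev n) n (comp m p' (c.prev n) x)
  bounds (m : ℤ) : ∃ a b : ℤ, ∀ p n, p + deg n = m → (deg n < a ∨ b ≤ deg n) → ∀ x : X p n, x = 0
  ext {m : ℤ} (x : Z.X m) (h : ∀ p n, p + deg n = m → comp m p n x = 0) : x = 0

namespace Decomp

variable {ι : Type} {c : ComplexShape ι} {deg : ι → ℤ} {Z W : Ban.Cpx.{u} k}

/-- The row differential into `n` starts at `c.prev n`. Either this is a true predecessor, of degree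
one less, or the differential is zero by shape. -/
lemma dh_prev_eq_zero [Tot.DegCompat c deg] (D : Decomp c deg Z) (m p : ℤ) (n : ι) (x : Z.X m)
    (h : ∀ n', deg n = deg n' + 1 → D.comp m p n' x = 0) :
    D.dh p (c.prev n) n (D.comp m p (c.prev n) x) = 0 := by
  by_cases hc : c.Rel (c.prev n) n
  · rw [h _ (Tot.DegCompat.deg_eq hc), map_zero]
  · exact D.dh_shape _ _ _ _ hc

lemma comp_eq_zero_of_isZero (D : Decomp c deg Z) (m p : ℤ) (n : ι) (x : Z.X m)
    (h : p + deg n = m → ∀ x : D.X p n, x = 0) : D.comp m p n x = 0 := by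
  by_cases hp : p + deg n = m
  · exact h hp _
  · exact D.comp_eq_zero hp x

/-- A chain map that is a quasi-isomorphism on columns is a quasi-isomorphism. -/
lemma qi_of_columns [Tot.DegCompat c deg] (hdeg : Function.Injective deg) (D : Decomp c deg Z)
    (E : Decomp c deg W) (f : Z ⟶ W) (φ : ∀ p n, D.X p n →L[k] E.X p n)
    (hφ : ∀ m p n x, E.comp m p n ((f.f m).clm x) = φ p n (D.comp m p n x))
    (H : ∀ n p q r s, p + 1 = q → q + 1 = r → r + 1 = s → ∀ (x : D.X r n) (y : E.X q n),
      D.dv r s n x = 0 → φ r n x = E.dv q r n y →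
      ∃ (x' : D.X q n) (y' : E.X p n), x = D.dv q r n x' ∧ y = φ q n x' + E.dv p q n y') :
    Ban.QI f := by
  refine Ban.QI.of_coneExact fun i j l hij hjl => ?_
  obtain ⟨a₁, b₁, h₁⟩ := D.bounds l
  obtain ⟨a₂, b₂, h₂⟩ := E.bounds j
  -- Filter by the degree of the columns. The row differential raises `deg n`, so on the lowest
  -- nonzero column the total differential is the vertical one. The bounds of `D` in degree `l` and
  -- of `E` in degree `j` make the filtration finite.
  refine Ban.coneExact_of_filtration f i j l
    (fun a x y => ∀ p n, deg n < a → D.comp l p n x = 0 ∧ E.comp j p n y = 0)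
    (min a₁ a₂) (max b₁ b₂) ?_ ?_ ?_
  · intro x y _ _
    refine ⟨0, 0, fun p n hn => ?_⟩
    simp only [map_zero, add_zero, sub_zero]
    exact ⟨D.comp_eq_zero_of_isZero _ _ _ _ fun h => h₁ p n h (Or.inl (by lia)),
      E.comp_eq_zero_of_isZero _ _ _ _ fun h => h₂ p n h (Or.inl (by lia))⟩
  · intro a x y hP hx hxy
    -- Integers that are not the degree of a column require no correction.
    by_cases hn : ∃ n, deg n = a
    swap
    · refine ⟨0, 0, fun p n hn' => ?_⟩
      simp only [map_zero, add_zero, sub_zero]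
      exact hP p n (lt_of_le_of_ne (by lia) (fun e => hn ⟨n, e⟩))
    obtain ⟨n, rfl⟩ := hn
    obtain ⟨p, hp⟩ : ∃ p, p + deg n = i := ⟨i - deg n, by lia⟩
    -- Row terms entering column `n` come from columns of smaller degree, which already vanish. So
    -- the components of `x` and `y` in column `n` form a cycle of the cone of that column, and `H`
    -- bounds it.
    have e₁ := congrArg (D.comp (l + 1) (p + 1 + 1 + 1) n) hx
    rw [D.comp_d rfl rfl, D.dh_prev_eq_zero _ _ _ _ (fun n' h => (hP _ n' (by lia)).1),
      smul_zero, add_zero, map_zero] at e₁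
    have e₂ := congrArg (E.comp l (p + 1 + 1) n) hxy
    rw [E.comp_d hjl rfl, E.dh_prev_eq_zero _ _ _ _ (fun n' h => (hP _ n' (by lia)).2),
      smul_zero, add_zero, hφ] at e₂
    obtain ⟨x', y', hx', hy'⟩ := H n p _ _ _ rfl rfl rfl _ _ e₁ e₂
    -- The correction is supported in column `n`. Its boundary meets other columns only through the
    -- row differential, hence only in larger degree, so the columns cleared before stay clear.
    refine ⟨D.elem j (p + 1) n (by lia) x', E.elem i p n hp y', fun q n' hn' => ?_⟩
    obtain ⟨q, rfl⟩ : ∃ q', q = q' + 1 := ⟨q - 1, by lia⟩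
    rw [map_sub, map_sub, map_add, hφ, D.comp_d hjl rfl, E.comp_d hij rfl,
      D.dh_prev_eq_zero, E.dh_prev_eq_zero, smul_zero, smul_zero, add_zero, add_zero]
    rotate_left
    · intro n'' h
      exact E.comp_elem_ne _ (fun _ e => by subst e; lia) _
    · intro n'' h
      exact D.comp_elem_ne _ (fun _ e => by subst e; lia) _
    by_cases hnn : n' = n
    · subst hnn
      constructor
      · by_cases hq : q = p + 1
        · subst hq
          rw [D.comp_elem_self, hx', sub_self]
        · rw [D.comp_eq_zero (by lia), D.comp_eq_zero (by lia), map_zero, sub_zero]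
      · by_cases hq : q = p
        · subst hq
          rw [D.comp_elem_self, E.comp_elem_self, hy', sub_self]
        · rw [E.comp_eq_zero (by lia), D.comp_eq_zero (by lia), E.comp_eq_zero (by lia), map_zero,
            map_zero, add_zero, sub_zero]
    · have := hP (q + 1) n' (lt_of_le_of_ne (by lia) (fun e => hnn (hdeg e)))
      rw [this.1, this.2, D.comp_elem_ne _ (fun _ e => hnn e.symm),
        D.comp_elem_ne _ (fun _ e => hnn e.symm), E.comp_elem_ne _ (fun _ e => hnn e.symm)]
      simp
  · intro a x y ha hP _ _
    constructor
    · refine D.ext x fun p n h => ?_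
      by_cases hb : deg n < a
      · exact (hP p n hb).1
      · exact h₁ p n h (Or.inr (by lia)) _
    · refine E.ext y fun p n h => ?_
      by_cases hb : deg n < a
      · exact (hP p n hb).2
      · exact h₂ p n h (Or.inr (by lia)) _

end Decomp

/-! ### Total complexes after an additive functor to Banach spaces. -/

namespace Tot

variable {A : Type*} [Category* A] [Preadditive A] {ι : Type} {c : ComplexShape ι} {deg : ι → ℤ}

variable (Φ : A ⥤ Ban.{u} k) [Φ.Additive]

lemma eq_zero_of_isZero {X : A} (h : IsZero X) (x : Φ.obj X) : x = 0 := by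
  have := congrArg (fun f => (Φ.map f).clm x) (h.eq_of_src (𝟙 X) 0)
  simpa using this

lemma FiniteSupport.bounds {K : CochainComplex (HomologicalComplex A c) ℤ}
    (hK : FiniteSupport deg K) (m : ℤ) :
    ∃ a b : ℤ, ∀ p n, p + deg n = m → ¬ IsZero ((K.X p).X n) → a ≤ deg n ∧ deg n < b := by
  obtain ⟨a, ha⟩ := ((hK m).image fun x => deg x.1.2).bddBelow
  obtain ⟨b, hb⟩ := ((hK m).image fun x => deg x.1.2).bddAbove
  refine ⟨a, b + 1, fun p n h hz => ⟨ha ⟨⟨(p, n), h⟩, hz, rfl⟩, ?_⟩⟩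
  exact Int.lt_add_one_of_le (hb ⟨⟨(p, n), h⟩, hz, rfl⟩)

variable [DegCompat c deg] {K L : CochainComplex (HomologicalComplex A c) ℤ}
  [HasTot deg K] [HasTot deg L]

variable (deg K) in
/-- The total complex, after application of an additive functor to Banach spaces. -/
abbrev totΦ : Ban.Cpx.{u} k := (Φ.mapHomologicalComplex _).obj (tot deg K)

variable (deg) in
/-- The map on total complexes, after application of an additive functor to Banach spaces. -/
abbrev mapΦ (f : K ⟶ L) : totΦ deg Φ K ⟶ totΦ deg Φ L :=
  (Φ.mapHomologicalComplex _).map (map deg f)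

/-- The components of elements of a total complex. -/
def decomp (hK : FiniteSupport deg K) : Decomp c deg (totΦ deg Φ K) where
  X p n := Φ.obj ((K.X p).X n)
  dv p p' n := (Φ.map ((K.d p p').f n)).clm
  dh p n n' := (Φ.map ((K.X p).d n n')).clm
  dh_shape p n n' x h := by rw [(K.X p).shape _ _ h, Φ.map_zero, Ban.zero_apply]
  comp m p n := (Φ.map (π deg K m p n)).clm
  elem m p n h := (Φ.map (incl deg K m p n h)).clm
  comp_eq_zero {m p n} h x := by
    have : Φ.map (π deg K m p n) = 0 := by rw [π_eq_zero h, Φ.map_zero]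
    exact congrArg (fun f => Ban.Hom.clm f x) this
  comp_elem_self {m p n} h x := by
    have : Φ.map (incl deg K m p n h) ≫ Φ.map (π deg K m p n) = 𝟙 _ := by
      rw [← Φ.map_comp, incl_π_self, Φ.map_id]
    exact congrArg (fun f => Ban.Hom.clm f x) this
  comp_elem_ne {m p p' n n'} h hne x := by
    have : Φ.map (incl deg K m p n h) ≫ Φ.map (π deg K m p' n') = 0 := by
      rw [← Φ.map_comp, incl_π_ne h (fun e => hne (congrArg Prod.fst e) (congrArg Prod.snd e)),
        Φ.map_zero]
    exact congrArg (fun f => Ban.Hom.clm f x) this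
  comp_d {m m' p p' n} hm hp x := by
    have : Φ.map (d deg K m m') ≫ Φ.map (π deg K m' p' n) =
        Φ.map (π deg K m p n) ≫ Φ.map ((K.d p p').f n) +
        (p'.negOnePow : ℤ) • (Φ.map (π deg K m p' (c.prev n)) ≫
          Φ.map ((K.X p').d (c.prev n) n)) := by
      rw [← Φ.map_comp, d_π hm hp, Φ.map_add, Φ.map_comp, Units.smul_def, Φ.map_zsmul,
        Φ.map_comp]
    exact congrArg (fun f => Ban.Hom.clm f x) this
  bounds m := by
    obtain ⟨a, b, h⟩ := hK.bounds m
    refine ⟨a, b, fun p n hp hn x => eq_zero_of_isZero Φ ?_ x⟩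
    by_contra hz
    have := h p n hp hz
    lia
  ext {m} x h := by
    refine eq_zero_of_map_biproduct_π Φ (fam deg K m) (hK m) x ?_
    rintro ⟨⟨p, n⟩, hx⟩
    have := h p n hx
    rwa [π, dif_pos hx] at this

/-- A map of double complexes that is a quasi-isomorphism on columns is a quasi-isomorphism on
total complexes. -/
lemma qi_map_of_columns (hdeg : Function.Injective deg) (hK : FiniteSupport deg K)
    (hL : FiniteSupport deg L) (f : K ⟶ L)
    (hf : ∀ n, Ban.QI ((Φ.mapHomologicalComplex _).map
      (((HomologicalComplex.eval A c n).mapHomologicalComplex _).map f))) :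
    Ban.QI (mapΦ deg Φ f) := by
  refine Decomp.qi_of_columns hdeg (decomp Φ hK) (decomp Φ hL) _
    (fun p n => (Φ.map ((f.f p).f n)).clm) ?_ ?_
  · intro m p n x
    have : Φ.map (mapX deg f m) ≫ Φ.map (π deg L m p n) =
        Φ.map (π deg K m p n) ≫ Φ.map ((f.f p).f n) := by
      rw [← Φ.map_comp, mapX_π, Φ.map_comp]
    exact congrArg (fun f => Ban.Hom.clm f x) this
  · rintro n p q r _ hpq hqr rfl
    exact (hf n).coneExact p q r hpq hqr

end Tot

/-! ### Quasi-isomorphisms by exactness of rows -/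

/-- The cohomological degree of the terms of a chain complex. -/
def degL (n : ℕ) : ℤ := -n

/-- The cohomological degree of the terms of a cochain complex. -/
def degR (n : ℕ) : ℤ := n

lemma degL_injective : Function.Injective degL := fun a b h => by
  simp only [degL] at h; lia

lemma degR_injective : Function.Injective degR := fun a b h => by
  simp only [degR] at h; lia

instance : Tot.DegCompat (ComplexShape.down ℕ) degL where
  deg_eq {n n'} h := by
    have : n' + 1 = n := h
    simp only [degL]; lia

instance : Tot.DegCompat (ComplexShape.up ℕ) degR where
  deg_eq {n n'} h := by
    have : n + 1 = n' := h
    simp only [degR]; lia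

namespace Decomp

variable {Z : Ban.Cpx.{u} k}

/-- Rows are exact resolutions of the terms of `M`, so a cycle is cleared row by row in order of
increasing `p`. In degree `l` the components sit at `(l + n, n)`, so the process starts at row `l`;
it stops at `l - a + 1`, since rows from there on have `deg n < a`. -/
lemma qi_of_rows_left (D : Decomp (ComplexShape.down ℕ) degL Z) {M : Ban.Cpx.{u} k} (f : Z ⟶ M)
    (aug : ∀ p, D.X p 0 →L[k] M.X p) (hf : ∀ m x, (f.f m).clm x = aug m (D.comp m m 0 x))
    (H₀ : ∀ p y, ∃ z, aug p z = y) (H₁ : ∀ p x, aug p x = 0 → ∃ z, D.dh p 1 0 z = x)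
    (H₂ : ∀ p n x, D.dh p (n + 1) n x = 0 → ∃ z, D.dh p (n + 2) (n + 1) z = x) :
    Ban.QI f := by
  refine Ban.QI.of_coneExact fun i j l hij hjl => ?_
  obtain ⟨a, b, hab⟩ := D.bounds l
  refine Ban.coneExact_of_filtration f i j l
    (fun c x y => y = 0 ∧ ∀ p n, p < c → D.comp l p n x = 0) l (l - a + 1) ?_ ?_ ?_
  · intro x y _ _
    -- Since the augmentation is onto, an element of bidegree `(j, 0)` clears `y`. The later
    -- corrections have no component there, so `y` stays zero.
    obtain ⟨z, rfl⟩ := H₀ j y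
    refine ⟨D.elem j j 0 (by simp [degL]) z, 0, ?_, fun p n hp => ?_⟩
    · rw [hf, D.comp_elem_self, map_zero, add_zero, sub_self]
    · exact D.comp_eq_zero (by simp only [degL]; lia) _
  · rintro c x y ⟨rfl, hP⟩ hx hfx
    rw [map_zero] at hfx
    by_cases hc : c < l
    · refine ⟨0, 0, by simp, fun p n hp => ?_⟩
      exact D.comp_eq_zero (by simp only [degL]; lia) _
    obtain ⟨n, rfl⟩ : ∃ n : ℕ, c = l + n := ⟨(c - l).toNat, by lia⟩
    -- All lower rows being clear, no vertical term interferes: the cycle condition says that this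
    -- component is killed by the row differential, or by the augmentation when `n = 0`.
    obtain ⟨z, hz⟩ : ∃ z, D.dh (l + n) (n + 1) n z = D.comp l (l + n) n x := by
      rcases n with _ | n
      · rw [hf] at hfx
        have e : l + ((0 : ℕ) : ℤ) = l := by simp
        rw [e]
        exact H₁ l _ hfx
      · refine H₂ _ n _ ?_
        have e := congrArg (D.comp (l + 1) (l + (n + 1 : ℕ)) n) hx
        rw [D.comp_d rfl (p := l + n) (by push_cast; ring), hP _ _ (by lia), map_zero, zero_add,
          map_zero, ← Units.smul_def, smul_eq_zero_iff_eq, ChainComplex.prev] at e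
        exact e
    -- In the total differential the row part carries the sign of its row; the same sign here
    -- cancels it.
    refine ⟨((l + n : ℤ).negOnePow : ℤ) •
      D.elem j (l + n) (n + 1) (by simp only [degL]; push_cast; lia) z, 0, ?_, fun p m hp => ?_⟩
    · rw [hf, map_zsmul, D.comp_elem_ne _ (fun _ h => by lia), smul_zero, map_zero, map_zero,
        add_zero, sub_zero]
    · rw [map_sub, map_zsmul, map_zsmul, D.comp_d hjl (p := p - 1) (by lia),
        D.comp_elem_ne _ (fun h _ => by lia), map_zero, zero_add, ChainComplex.prev]
      by_cases hm : p = l + n ∧ m = n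
      · obtain ⟨rfl, rfl⟩ := hm
        rw [D.comp_elem_self, hz, ← Units.smul_def, ← Units.smul_def, smul_smul,
          Int.units_mul_self, one_smul, sub_self]
      · rw [D.comp_elem_ne _ (fun h h' => hm ⟨h.symm, by lia⟩), map_zero, smul_zero, smul_zero,
          sub_zero]
        by_cases hp' : p < l + n
        · exact hP _ _ hp'
        · exact D.comp_eq_zero (fun h => hm ⟨by lia, by simp only [degL] at h; lia⟩) _
  · rintro c x y hc ⟨rfl, hP⟩ _ _
    refine ⟨D.ext x fun p n h => ?_, rfl⟩
    by_cases hp : p < c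
    · exact hP _ _ hp
    · exact hab p n h (Or.inl (by lia)) _

/-- Dual clearing process: `y` is cleared from the smallest `p`, that is, from the far end of the
rows, towards `(j, 0)`. Rows below `j - b + 1` have `b ≤ deg n`, and beyond row `j` there are no
components. Once `y = 0`, injectivity of the coaugmentation forces `x = 0`. -/
lemma qi_of_rows_right (D : Decomp (ComplexShape.up ℕ) degR Z) {M : Ban.Cpx.{u} k} (f : M ⟶ Z)
    (aug : ∀ p, M.X p →L[k] D.X p 0) (hf : ∀ m x, D.comp m m 0 ((f.f m).clm x) = aug m x)
    (hf' : ∀ m p n x, D.comp m p (n + 1) ((f.f m).clm x) = 0)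
    (H₀ : ∀ p x, aug p x = 0 → x = 0) (H₁ : ∀ p x, D.dh p 0 1 x = 0 → ∃ z, aug p z = x)
    (H₂ : ∀ p n x, D.dh p (n + 1) (n + 2) x = 0 → ∃ z, D.dh p n (n + 1) z = x) :
    Ban.QI f := by
  refine Ban.QI.of_coneExact fun i j l hij hjl => ?_
  obtain ⟨a, b, hab⟩ := D.bounds j
  refine Ban.coneExact_of_filtration f i j l
    (fun c x y => ∀ p n, p < c → D.comp j p n y = 0) (j - b + 1) (j + 1) ?_ ?_ ?_
  · intro x y _ _
    refine ⟨0, 0, fun p n hp => ?_⟩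
    simp only [map_zero, add_zero, sub_zero]
    exact D.comp_eq_zero_of_isZero _ _ _ _ fun h => hab p n h (Or.inr (by lia))
  · rintro c x y hP hx hfx
    by_cases hc : j < c
    · refine ⟨0, 0, fun p n hp => ?_⟩
      simp only [map_zero, add_zero, sub_zero]
      by_cases hp' : p < c
      · exact hP _ _ hp'
      · exact D.comp_eq_zero (by simp only [degR]; lia) _
    obtain ⟨n, hn⟩ : ∃ n : ℕ, c + n = j := ⟨(j - c).toNat, by lia⟩
    -- The image of `f` has no component at index `n + 1`, and row `c - 1` is already clear.
    have key : D.dh c n (n + 1) (D.comp j c n y) = 0 := by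
      have e := congrArg (D.comp l c (n + 1)) hfx
      rw [hf', D.comp_d hjl (p := c - 1) (by lia), hP _ _ (by lia), map_zero, zero_add,
        eq_comm, ← Units.smul_def, smul_eq_zero_iff_eq, CochainComplex.prev_nat_succ] at e
      exact e
    -- At the start of a row the preimage lies in `M` and is the correction `x'`; elsewhere it lies
    -- in the row and corrects through the total differential.
    rcases n with _ | n
    · obtain rfl : c = j := by simpa using hn
      obtain ⟨z, hz⟩ := H₁ _ _ key
      refine ⟨z, 0, fun p m hp => ?_⟩
      rw [map_zero, add_zero, map_sub]
      rcases m with _ | m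
      · by_cases hp' : p = c
        · subst hp'
          rw [hf, hz, sub_self]
        · rw [D.comp_eq_zero (by simpa [degR] using hp'),
            D.comp_eq_zero (by simpa [degR] using hp'), sub_self]
      · rw [hf', sub_zero]
        by_cases hp' : p < c
        · exact hP _ _ hp'
        · exact D.comp_eq_zero (by simp only [degR]; lia) _
    · obtain ⟨z, hz⟩ := H₂ _ _ _ key
      refine ⟨0, (c.negOnePow : ℤ) • D.elem i c n (by simp only [degR]; lia) z, fun p m hp => ?_⟩
      rw [map_zero, zero_add, map_sub, map_zsmul, map_zsmul, D.comp_d hij (p := p - 1) (by lia),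
        D.comp_elem_ne _ (fun h _ => by lia), map_zero, zero_add]
      by_cases hm : p = c ∧ m = n + 1
      · obtain ⟨rfl, rfl⟩ := hm
        rw [CochainComplex.prev_nat_succ, D.comp_elem_self, hz, ← Units.smul_def,
          ← Units.smul_def, smul_smul, Int.units_mul_self, one_smul, sub_self]
      · have h0 : D.dh p ((ComplexShape.up ℕ).prev m) m
            (D.comp i p ((ComplexShape.up ℕ).prev m) (D.elem i c n
              (by simp only [degR]; lia) z)) = 0 := by
          refine D.dh_prev_eq_zero _ _ _ _ fun n' h => D.comp_elem_ne _ (fun e e' => hm ⟨e.symm, ?_⟩) _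
          simp only [degR] at h
          lia
        rw [h0, smul_zero, smul_zero, sub_zero]
        by_cases hp' : p < c
        · exact hP _ _ hp'
        · exact D.comp_eq_zero (fun h => hm ⟨by lia, by simp only [degR] at h; lia⟩) _
  · rintro c x y hc hP _ hfx
    have hy : y = 0 := by
      refine D.ext y fun p n h => hP _ _ ?_
      simp only [degR] at h
      lia
    subst hy
    refine ⟨H₀ l x ?_, rfl⟩
    rw [← hf, hfx, map_zero, map_zero]

end Decomp

/-! ### Bar and cobar complexes of an augmented or coaugmented endofunctor -/

section Iterates

variable {A : Type*} [Category* A] (T : A ⥤ A)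

/-- The iterates of an endofunctor on objects. -/
def powObj : ℕ → A → A
  | 0, M => M
  | n + 1, M => T.obj (powObj n M)

/-- The iterates of an endofunctor on morphisms. -/
def powMap {M N : A} (f : M ⟶ N) : ∀ n, powObj T n M ⟶ powObj T n N
  | 0 => f
  | n + 1 => T.map (powMap f n)

lemma powMap_id (M : A) : ∀ n, powMap T (𝟙 M) n = 𝟙 (powObj T n M)
  | 0 => rfl
  | n + 1 => (congrArg T.map (powMap_id M n)).trans (T.map_id _)

lemma powMap_comp {M N P : A} (f : M ⟶ N) (g : N ⟶ P) :
    ∀ n, powMap T (f ≫ g) n = powMap T f n ≫ powMap T g n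
  | 0 => rfl
  | n + 1 => (congrArg T.map (powMap_comp f g n)).trans (T.map_comp _ _)

variable [Preadditive A] [T.Additive]

lemma powMap_add {M N : A} (f g : M ⟶ N) :
    ∀ n, powMap T (f + g) n = powMap T f n + powMap T g n
  | 0 => rfl
  | n + 1 => (congrArg T.map (powMap_add f g n)).trans T.map_add

/-- The iterates of an endofunctor. -/
@[simps]
def powFunctor (n : ℕ) : A ⥤ A where
  obj := powObj T n
  map f := powMap T f n
  map_id M := powMap_id T M n
  map_comp f g := powMap_comp T f g n

instance (n : ℕ) : (powFunctor T n).Additive where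
  map_add := powMap_add T _ _ n

end Iterates

/-- An augmentation of an endofunctor. -/
structure Augmentation {A : Type*} [Category* A] (T : A ⥤ A) where
  app (M : A) : T.obj M ⟶ M
  naturality {M N : A} (f : M ⟶ N) : T.map f ≫ app N = app M ≫ f

/-! ### Bar complexes of an augmented endofunctor. -/

namespace Bar

variable {A : Type*} [Category* A] [Preadditive A] {T : A ⥤ A} [T.Additive] (ε : Augmentation T)

/-- The recursion step for the differentials of the augmented bar complex. -/
def next {X : A} (d : T.obj X ⟶ X) : T.obj (T.obj X) ⟶ T.obj X := ε.app (T.obj X) - T.map d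

lemma next_app (M : A) : next ε (ε.app M) ≫ ε.app M = 0 := by
  rw [next, Preadditive.sub_comp, ε.naturality, sub_self]

/-- Unrolled, the recursion is the usual alternating sum of faces. Naturality of `ε` is all that is
needed: after applying `T`, the hypothesis removes one term, and the other two agree by naturality.
No comultiplication enters. -/
lemma next_next {X : A} {d : T.obj X ⟶ X} (h : next ε d ≫ d = 0) :
    next ε (next ε d) ≫ next ε d = 0 := by
  have h' : T.map (next ε d) ≫ next ε d = T.map (next ε d) ≫ ε.app (T.obj X) := by
    rw [show next ε d = ε.app (T.obj X) - T.map d from rfl, Preadditive.comp_sub, ← T.map_comp]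
    rw [← show next ε d = ε.app (T.obj X) - T.map d from rfl, h, T.map_zero, sub_zero]
  rw [show next ε (next ε d) = ε.app (T.obj (T.obj X)) - T.map (next ε d) from rfl,
    Preadditive.sub_comp, h', ε.naturality, sub_self]

lemma next_naturality {X Y : A} {d : T.obj X ⟶ X} {d' : T.obj Y ⟶ Y} (f : X ⟶ Y)
    (h : T.map f ≫ d' = d ≫ f) : T.map (T.map f) ≫ next ε d' = next ε d ≫ T.map f := by
  rw [next, next, Preadditive.comp_sub, Preadditive.sub_comp, ε.naturality, ← T.map_comp, h,
    T.map_comp]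

lemma contraction_app {M : A} (σ : M ⟶ T.obj M) (hσ : σ ≫ ε.app M = 𝟙 M) :
    ε.app M ≫ σ + (-T.map σ) ≫ next ε (ε.app M) = 𝟙 (T.obj M) := by
  rw [next, Preadditive.neg_comp, Preadditive.comp_sub, ε.naturality, ← T.map_comp, hσ, T.map_id]
  abel

/-- Apply `T` to the homotopy identity; the cross terms cancel by naturality of `ε`, at the price of
replacing `s` by `-T.map s`. -/
lemma contraction_next {X : A} {d : T.obj X ⟶ X} {s : X ⟶ T.obj X}
    (h : d ≫ s + (-T.map s) ≫ next ε d = 𝟙 (T.obj X)) :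
    next ε d ≫ (-T.map s) + (-T.map (-T.map s)) ≫ next ε (next ε d) = 𝟙 (T.obj (T.obj X)) := by
  have h' : T.map d ≫ T.map s + T.map (-T.map s) ≫ T.map (next ε d) = 𝟙 _ := by
    rw [← T.map_comp, ← T.map_comp, ← T.map_add, h, T.map_id]
  rw [show next ε (next ε d) = ε.app (T.obj (T.obj X)) - T.map (next ε d) from rfl,
    Preadditive.neg_comp (T.map _), Preadditive.comp_sub, ε.naturality, ← h']
  rw [show next ε d ≫ (-T.map s) = ε.app (T.obj X) ≫ (-T.map s) + T.map d ≫ T.map s by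
    rw [next, Preadditive.sub_comp, Preadditive.comp_neg (T.map d), sub_neg_eq_add]]
  abel

/-- The differential of the augmented bar complex. -/
def δ (M : A) : ∀ n, T.obj (powObj T n M) ⟶ powObj T n M
  | 0 => ε.app M
  | n + 1 => next ε (δ M n)

lemma δ_δ (M : A) : ∀ n, next ε (δ ε M n) ≫ δ ε M n = 0
  | 0 => next_app ε M
  | n + 1 => next_next ε (δ_δ M n)

lemma δ_naturality {M N : A} (f : M ⟶ N) :
    ∀ n, T.map (powMap T f n) ≫ δ ε N n = δ ε M n ≫ powMap T f n
  | 0 => ε.naturality f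
  | n + 1 => next_naturality ε (powMap T f n) (δ_naturality f n)

/-- The differential of the bar complex. -/
def barD (M : A) (n : ℕ) : T.obj (powObj T (n + 1) M) ⟶ T.obj (powObj T n M) := next ε (δ ε M n)

lemma barD_barD (M : A) (n : ℕ) : barD ε M (n + 1) ≫ barD ε M n = 0 := δ_δ ε M (n + 1)

lemma barD_naturality {M N : A} (f : M ⟶ N) (n : ℕ) :
    T.map (powMap T f (n + 1)) ≫ barD ε N n = barD ε M n ≫ T.map (powMap T f n) :=
  δ_naturality ε f (n + 1)

/-- The bar complex. -/
def bar : A ⥤ ChainComplex A ℕ where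
  obj M := ChainComplex.of (fun n => T.obj (powObj T n M)) (barD ε M)
    (barD_barD ε M)
  map f := ChainComplex.ofHom (fun n => T.map (powMap T f n)) (fun n => by
    dsimp only
    rw [ChainComplex.of_d, ChainComplex.of_d]
    exact barD_naturality ε f n)
  map_id M := by
    ext n
    exact (congrArg T.map (powMap_id T M n)).trans (T.map_id _)
  map_comp f g := by
    ext n
    exact (congrArg T.map (powMap_comp T f g n)).trans (T.map_comp _ _)

instance : (bar ε).Additive where
  map_add {M N f g} := by
    ext n
    exact (congrArg T.map (powMap_add T f g n)).trans T.map_add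

lemma bar_d (M : A) (n : ℕ) : ((bar ε).obj M).d (n + 1) n = barD ε M n :=
  ChainComplex.of_d (fun n => T.obj (powObj T n M)) (barD ε M) n

/-- Exactness of the augmented bar complex after application of a functor to Banach spaces. -/
def Exact (Φ : A ⥤ Ban.{u} k) (M : A) : Prop :=
  (∀ y : Φ.obj M, ∃ z : Φ.obj (T.obj M), (Φ.map (ε.app M)).clm z = y) ∧
    ∀ (n : ℕ) (x : Φ.obj (T.obj (powObj T n M))), (Φ.map (δ ε M n)).clm x = 0 →
      ∃ z, (Φ.map (next ε (δ ε M n))).clm z = x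

/-- The contracting homotopy of the augmented bar complex induced by a section of the
augmentation. -/
def s {M : A} (σ : M ⟶ T.obj M) : ∀ n, powObj T n M ⟶ T.obj (powObj T n M)
  | 0 => σ
  | n + 1 => -T.map (s σ n)

lemma s_δ {M : A} (σ : M ⟶ T.obj M) (hσ : σ ≫ ε.app M = 𝟙 M) :
    ∀ n, δ ε M n ≫ s σ n + (-T.map (s σ n)) ≫ next ε (δ ε M n) = 𝟙 _
  | 0 => contraction_app ε σ hσ
  | n + 1 => contraction_next ε (s_δ σ hσ n)

variable {ε}

/-- A section inside `A` yields a contracting homotopy inside `A`, which every additive functor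
preserves. Used for coinvariants of representations that are already resolved. -/
lemma Exact.of_section (Φ : A ⥤ Ban.{u} k) [Φ.Additive] {M : A} (σ : M ⟶ T.obj M)
    (hσ : σ ≫ ε.app M = 𝟙 M) : Exact ε Φ M := by
  constructor
  · intro y
    refine ⟨(Φ.map σ).clm y, ?_⟩
    rw [← Ban.comp_apply, ← Φ.map_comp, hσ, Φ.map_id, Ban.id_apply]
  · intro n x hx
    refine ⟨(Φ.map (-T.map (s σ n))).clm x, ?_⟩
    have h := congrArg (fun f => (Φ.map f).clm x) (s_δ ε σ hσ n)
    simp only [Φ.map_add, Φ.map_comp, Φ.map_id, Ban.id_apply, Ban.add_apply] at h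
    rw [Ban.comp_apply, hx, map_zero, zero_add] at h
    exact h

/-- If the section exists only after applying `Φ` but is natural, then it sends a cycle `x` to a
preimage: `next` of `σ x` is `x` minus `σ` applied to the differential of `x`. Used for the
forgetful functor, on arbitrary representations. -/
lemma Exact.of_natural_section (Φ : A ⥤ Ban.{u} k) [Φ.Additive]
    (σ : ∀ M, Φ.obj M ⟶ Φ.obj (T.obj M)) (hσ : ∀ M x, (Φ.map (ε.app M)).clm ((σ M).clm x) = x)
    (hσ' : ∀ {M N : A} (f : M ⟶ N) (x : Φ.obj M),
      (Φ.map (T.map f)).clm ((σ M).clm x) = (σ N).clm ((Φ.map f).clm x)) (M : A) :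
    Exact ε Φ M := by
  refine ⟨fun y => ⟨_, hσ M y⟩, fun n x hx => ⟨(σ _).clm x, ?_⟩⟩
  rw [next, Φ.map_sub, Ban.sub_apply, hσ, hσ', hx, map_zero, sub_zero]

variable (ε)

/-! The total bar complex -/

/-- The bar double complex of a complex. -/
abbrev double (K : CochainComplex A ℤ) : CochainComplex (ChainComplex A ℕ) ℤ :=
  ((bar ε).mapHomologicalComplex _).obj K

lemma isZero_double (K : CochainComplex A ℤ) (p : ℤ) (n : ℕ) (h : IsZero (K.X p)) :
    IsZero (((double ε K).X p).X n) :=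
  (powFunctor T (n + 1)).map_isZero h

/-- Boundedness above enters here: if `p ≤ N` and `p - n = m`, then `n ≤ N - m`, and `n` determines
`p`. -/
lemma finiteSupport (K : CMinus A) : Tot.FiniteSupport degL (double ε K.obj) := by
  obtain ⟨N, hN⟩ := K.property
  intro m
  refine Set.Finite.of_injOn (f := fun x => x.1.2) (t := Set.Iic (N - m).toNat) ?_ ?_
    (Set.finite_Iic _)
  · rintro ⟨⟨p, n⟩, hx⟩ hz
    by_contra hn
    refine hz (isZero_double ε _ p n (K.obj.isZero_of_isStrictlyLE N p ?_))
    simp only [Set.mem_Iic, degL] at hn hx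
    lia
  · rintro ⟨⟨p, n⟩, hx⟩ _ ⟨⟨p', n'⟩, hx'⟩ _ h
    obtain rfl : n = n' := h
    have : p = p' := by simp only at hx hx'; lia
    subst this
    rfl

variable [HasFiniteBiproducts A]

instance (K : CMinus A) : Tot.HasTot degL (double ε K.obj) := (finiteSupport ε K).hasTot

/-- The total bar complex. -/
def totBar : CMinus A ⥤ CMinus A :=
  (bddAbove A).lift
    { obj := fun K => Tot.tot degL (double ε K.obj)
      map := fun f => Tot.map degL (((bar ε).mapHomologicalComplex _).map f.hom)
      map_id := fun K => (congrArg (Tot.map degL)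
        (((bar ε).mapHomologicalComplex _).map_id K.obj)).trans Tot.map_id
      map_comp := fun f g => (congrArg (Tot.map degL)
        (((bar ε).mapHomologicalComplex _).map_comp f.hom g.hom)).trans (Tot.map_comp _ _) }
    (fun K => by
      obtain ⟨N, hN⟩ := K.property
      refine ⟨N, (CochainComplex.isStrictlyLE_iff _ _).2 fun m hm => ?_⟩
      refine (IsZero.iff_id_eq_zero _).2 ?_
      change 𝟙 (⨁ Tot.fam degL (double ε K.obj) m) = 0
      refine Tot.hom_ext fun p n h => IsZero.eq_of_tgt (isZero_double ε _ p n ?_) _ _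
      refine K.obj.isZero_of_isStrictlyLE N p ?_
      simp only [degL] at h
      lia)

/-- The augmentation of the columns of the bar double complex. -/
def augCol (K : CMinus A) (m : ℤ) : ((double ε K.obj).X m).X 0 ⟶ K.obj.X m := ε.app (K.obj.X m)

lemma d_augCol (K : CMinus A) (m : ℤ) :
    ((double ε K.obj).X m).d (0 + 1) 0 ≫ augCol ε K m = 0 := by
  rw [augCol]
  exact (congrArg (· ≫ ε.app (K.obj.X m)) (bar_d ε (K.obj.X m) 0)).trans (next_app ε _)

lemma f_augCol (K : CMinus A) (m : ℤ) :
    ((double ε K.obj).d m (m + 1)).f 0 ≫ augCol ε K (m + 1) =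
      augCol ε K m ≫ K.obj.d m (m + 1) :=
  ε.naturality (K.obj.d m (m + 1))

/-- The augmentation of the total bar complex. -/
def aug (K : CMinus A) : ((totBar ε).obj K).obj ⟶ K.obj where
  f m := Tot.π degL (double ε K.obj) m m 0 ≫ augCol ε K m
  comm' := by
    rintro m _ rfl
    change (Tot.π degL (double ε K.obj) m m 0 ≫ augCol ε K m) ≫ K.obj.d m (m + 1) =
      Tot.d degL (double ε K.obj) m (m + 1) ≫ Tot.π degL (double ε K.obj) (m + 1) (m + 1) 0 ≫
        augCol ε K (m + 1)
    rw [Tot.d_π_assoc rfl rfl, ChainComplex.prev, Preadditive.add_comp, Linear.units_smul_comp,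
      Category.assoc, Category.assoc, Category.assoc, d_augCol, f_augCol, comp_zero, smul_zero,
      add_zero]

/-- The augmentation of the total bar complex, as a natural transformation. -/
def augTrans : totBar ε ⟶ 𝟭 (CMinus A) where
  app K := ⟨aug ε K⟩
  naturality K L f := by
    refine ObjectProperty.hom_ext _ ?_
    ext m
    change Tot.mapX degL (((bar ε).mapHomologicalComplex _).map f.hom) m ≫
      Tot.π degL (double ε L.obj) m m 0 ≫ augCol ε L m =
      (Tot.π degL (double ε K.obj) m m 0 ≫ augCol ε K m) ≫ f.hom.f m
    rw [Tot.mapX_π_assoc, Category.assoc]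
    exact congrArg (Tot.π degL (double ε K.obj) m m 0 ≫ ·) (ε.naturality (f.hom.f m))

variable {ε}

/-- The augmentation of the total bar complex is a quasi-isomorphism if the augmented bar
complexes of the entries are exact. -/
lemma qi_aug (Φ : A ⥤ Ban.{u} k) [Φ.Additive] (K : CMinus A)
    (h : ∀ p, Exact ε Φ (K.obj.X p)) : Ban.QI ((Φ.mapHomologicalComplex _).map (aug ε K)) := by
  refine (Tot.decomp Φ (finiteSupport ε K)).qi_of_rows_left _
    (fun p => (Φ.map (ε.app (K.obj.X p))).clm) ?_ (fun p => (h p).1) ?_ ?_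
  · intro m x
    exact congrArg (fun f => Ban.Hom.clm f x) (Φ.map_comp
      (Tot.π degL (double ε K.obj) m m 0) (ε.app (K.obj.X m)))
  · intro p x hx
    obtain ⟨z, hz⟩ := (h p).2 0 x hx
    exact ⟨z, (congrArg (fun f => (Φ.map f).clm z) (bar_d ε (K.obj.X p) 0)).trans hz⟩
  · intro p n x hx
    obtain ⟨z, hz⟩ := (h p).2 (n + 1) x
      ((congrArg (fun f => (Φ.map f).clm x) (bar_d ε (K.obj.X p) n)).symm.trans hx)
    exact ⟨z, (congrArg (fun f => (Φ.map f).clm z) (bar_d ε (K.obj.X p) (n + 1))).trans hz⟩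

/-- Column `n` of the bar double complex is the iterate `powFunctor T (n + 1)` applied to the
complex, so the comparison by columns applies. -/
lemma qi_totBar_map (Φ : A ⥤ Ban.{u} k) [Φ.Additive] {K L : CMinus A} (f : K ⟶ L)
    (h : ∀ n, Ban.QI ((Φ.mapHomologicalComplex _).map
      (((powFunctor T (n + 1)).mapHomologicalComplex _).map f.hom))) :
    Ban.QI ((Φ.mapHomologicalComplex _).map ((totBar ε).map f).hom) :=
  Tot.qi_map_of_columns Φ degL_injective (finiteSupport ε K) (finiteSupport ε L) _ h

/-- A finite biproduct of objects in the image of `T` has a section of the augmentation as soon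
as its summands do. -/
lemma exists_section_biproduct {J : Type} (X : J → A) [HasBiproduct X]
    (h : ∀ j, ∃ σ : X j ⟶ T.obj (X j), σ ≫ ε.app (X j) = 𝟙 _) :
    ∃ σ : (⨁ X) ⟶ T.obj (⨁ X), σ ≫ ε.app (⨁ X) = 𝟙 _ := by
  choose σ hσ using h
  refine ⟨biproduct.desc fun j => σ j ≫ T.map (biproduct.ι X j), ?_⟩
  refine biproduct.hom_ext' _ _ fun j => ?_
  rw [biproduct.ι_desc_assoc, Category.assoc, ε.naturality, ← Category.assoc, hσ,
    Category.id_comp, Category.comp_id]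

/-- Each entry is a biproduct of values of `T`, so sections are assembled summand by summand. -/
lemma exists_section_totBar (K : CMinus A)
    (h : ∀ N : A, ∃ σ : T.obj N ⟶ T.obj (T.obj N), σ ≫ ε.app (T.obj N) = 𝟙 _) (m : ℤ) :
    ∃ σ : ((totBar ε).obj K).obj.X m ⟶ T.obj (((totBar ε).obj K).obj.X m),
      σ ≫ ε.app (((totBar ε).obj K).obj.X m) = 𝟙 _ :=
  exists_section_biproduct (Tot.fam degL (double ε K.obj) m) fun j => h (powObj T j.1.2 _)

end Bar

/-- A coaugmentation of an endofunctor. -/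
structure Coaugmentation {A : Type*} [Category* A] (T : A ⥤ A) where
  app (M : A) : M ⟶ T.obj M
  naturality {M N : A} (f : M ⟶ N) : f ≫ app N = app M ≫ T.map f

/-! ### Cobar complexes of a coaugmented endofunctor. -/

namespace Cobar

variable {A : Type*} [Category* A] [Preadditive A] {T : A ⥤ A} [T.Additive] (η : Coaugmentation T)

/-- The recursion step for the differentials of the coaugmented cobar complex. -/
def next {X : A} (d : X ⟶ T.obj X) : T.obj X ⟶ T.obj (T.obj X) := η.app (T.obj X) - T.map d

lemma app_next (M : A) : η.app M ≫ next η (η.app M) = 0 := by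
  rw [next, Preadditive.comp_sub, η.naturality, sub_self]

lemma next_next {X : A} {d : X ⟶ T.obj X} (h : d ≫ next η d = 0) :
    next η d ≫ next η (next η d) = 0 := by
  have h' : next η d ≫ T.map (next η d) = η.app (T.obj X) ≫ T.map (next η d) := by
    rw [show next η d = η.app (T.obj X) - T.map d from rfl, Preadditive.sub_comp, ← T.map_comp]
    rw [← show next η d = η.app (T.obj X) - T.map d from rfl, h, T.map_zero, sub_zero]
  rw [show next η (next η d) = η.app (T.obj (T.obj X)) - T.map (next η d) from rfl,
    Preadditive.comp_sub, h', η.naturality, sub_self]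

lemma next_naturality {X Y : A} {d : X ⟶ T.obj X} {d' : Y ⟶ T.obj Y} (f : X ⟶ Y)
    (h : f ≫ d' = d ≫ T.map f) : T.map f ≫ next η d' = next η d ≫ T.map (T.map f) := by
  rw [next, next, Preadditive.comp_sub, Preadditive.sub_comp, η.naturality, ← T.map_comp, h,
    T.map_comp]

lemma contraction_app {M : A} (r : T.obj M ⟶ M) (hr : η.app M ≫ r = 𝟙 M) :
    r ≫ η.app M + next η (η.app M) ≫ (-T.map r) = 𝟙 (T.obj M) := by
  rw [next, Preadditive.comp_neg, Preadditive.sub_comp, η.naturality, ← T.map_comp, hr, T.map_id]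
  abel

lemma contraction_next {X : A} {d : X ⟶ T.obj X} {s : T.obj X ⟶ X}
    (h : s ≫ d + next η d ≫ (-T.map s) = 𝟙 (T.obj X)) :
    (-T.map s) ≫ next η d + next η (next η d) ≫ (-T.map (-T.map s)) = 𝟙 (T.obj (T.obj X)) := by
  have h' : T.map s ≫ T.map d + T.map (next η d) ≫ T.map (-T.map s) = 𝟙 _ := by
    rw [← T.map_comp, ← T.map_comp, ← T.map_add, h, T.map_id]
  rw [show next η (next η d) = η.app (T.obj (T.obj X)) - T.map (next η d) from rfl,
    Preadditive.comp_neg _ (T.map _), Preadditive.sub_comp, ← η.naturality, ← h']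
  rw [show (-T.map s) ≫ next η d = (-T.map s) ≫ η.app (T.obj X) + T.map s ≫ T.map d by
    rw [next, Preadditive.comp_sub, Preadditive.neg_comp _ (T.map d), sub_neg_eq_add]]
  abel

/-- The differential of the coaugmented cobar complex. -/
def δ (M : A) : ∀ n, powObj T n M ⟶ T.obj (powObj T n M)
  | 0 => η.app M
  | n + 1 => next η (δ M n)

lemma δ_δ (M : A) : ∀ n, δ η M n ≫ next η (δ η M n) = 0
  | 0 => app_next η M
  | n + 1 => next_next η (δ_δ M n)

lemma δ_naturality {M N : A} (f : M ⟶ N) :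
    ∀ n, powMap T f n ≫ δ η N n = δ η M n ≫ T.map (powMap T f n)
  | 0 => η.naturality f
  | n + 1 => next_naturality η (powMap T f n) (δ_naturality f n)

/-- The differential of the cobar complex. -/
def cobarD (M : A) (n : ℕ) : T.obj (powObj T n M) ⟶ T.obj (powObj T (n + 1) M) :=
  next η (δ η M n)

lemma cobarD_cobarD (M : A) (n : ℕ) : cobarD η M n ≫ cobarD η M (n + 1) = 0 := δ_δ η M (n + 1)

lemma cobarD_naturality {M N : A} (f : M ⟶ N) (n : ℕ) :
    T.map (powMap T f n) ≫ cobarD η N n = cobarD η M n ≫ T.map (powMap T f (n + 1)) :=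
  δ_naturality η f (n + 1)

/-- The cobar complex. -/
def cobar : A ⥤ CochainComplex A ℕ where
  obj M := CochainComplex.of (fun n => T.obj (powObj T n M)) (cobarD η M) (cobarD_cobarD η M)
  map f := CochainComplex.ofHom (fun n => T.map (powMap T f n)) (fun n => by
    dsimp only
    rw [CochainComplex.of_d, CochainComplex.of_d]
    exact cobarD_naturality η f n)
  map_id M := by
    ext n
    exact (congrArg T.map (powMap_id T M n)).trans (T.map_id _)
  map_comp f g := by
    ext n
    exact (congrArg T.map (powMap_comp T f g n)).trans (T.map_comp _ _)

instance : (cobar η).Additive where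
  map_add {M N f g} := by
    ext n
    exact (congrArg T.map (powMap_add T f g n)).trans T.map_add

lemma cobar_d (M : A) (n : ℕ) : ((cobar η).obj M).d n (n + 1) = cobarD η M n :=
  CochainComplex.of_d (fun n => T.obj (powObj T n M)) (cobarD η M) n

/-- Exactness of the coaugmented cobar complex after application of a functor to Banach
spaces. -/
def Exact (Φ : A ⥤ Ban.{u} k) (M : A) : Prop :=
  (∀ x : Φ.obj M, (Φ.map (η.app M)).clm x = 0 → x = 0) ∧
    ∀ (n : ℕ) (x : Φ.obj (T.obj (powObj T n M))), (Φ.map (next η (δ η M n))).clm x = 0 →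
      ∃ z, (Φ.map (δ η M n)).clm z = x

/-- The contracting homotopy of the coaugmented cobar complex induced by a retraction of the
coaugmentation. -/
def s {M : A} (r : T.obj M ⟶ M) : ∀ n, T.obj (powObj T n M) ⟶ powObj T n M
  | 0 => r
  | n + 1 => -T.map (s r n)

lemma s_δ {M : A} (r : T.obj M ⟶ M) (hr : η.app M ≫ r = 𝟙 M) :
    ∀ n, s r n ≫ δ η M n + next η (δ η M n) ≫ (-T.map (s r n)) = 𝟙 _
  | 0 => contraction_app η r hr
  | n + 1 => contraction_next η (s_δ r hr n)

variable {η}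

lemma Exact.of_retraction (Φ : A ⥤ Ban.{u} k) [Φ.Additive] {M : A} (r : T.obj M ⟶ M)
    (hr : η.app M ≫ r = 𝟙 M) : Exact η Φ M := by
  constructor
  · intro x hx
    rw [← Ban.id_apply (Φ.obj M) x, ← Φ.map_id, ← hr, Φ.map_comp, Ban.comp_apply, hx, map_zero]
  · intro n x hx
    refine ⟨(Φ.map (s r n)).clm x, ?_⟩
    have h := congrArg (fun f => (Φ.map f).clm x) (s_δ η r hr n)
    simp only [Φ.map_add, Φ.map_comp, Φ.map_id, Ban.id_apply, Ban.add_apply] at h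
    rw [Ban.comp_apply, Ban.comp_apply, hx, map_zero, add_zero] at h
    exact h

/-- For a cocycle `x`, the coaugmentation of `x` equals the image of `x` under `T` of the previous
differential. Applying `r` to both sides exhibits `x` as the differential of `r x`. -/
lemma Exact.of_natural_retraction (Φ : A ⥤ Ban.{u} k) [Φ.Additive]
    (r : ∀ M, Φ.obj (T.obj M) ⟶ Φ.obj M) (hr : ∀ M x, (r M).clm ((Φ.map (η.app M)).clm x) = x)
    (hr' : ∀ {M N : A} (f : M ⟶ N) (x : Φ.obj (T.obj M)),
      (r N).clm ((Φ.map (T.map f)).clm x) = (Φ.map f).clm ((r M).clm x)) (M : A) :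
    Exact η Φ M := by
  refine ⟨fun x hx => by rw [← hr M x, hx, map_zero], fun n x hx => ⟨(r _).clm x, ?_⟩⟩
  rw [next, Φ.map_sub, Ban.sub_apply, sub_eq_zero] at hx
  rw [← hr', ← hx, hr]

variable (η)

/-! The total cobar complex -/

/-- The cobar double complex of a complex. -/
abbrev double (K : CochainComplex A ℤ) : CochainComplex (CochainComplex A ℕ) ℤ :=
  ((cobar η).mapHomologicalComplex _).obj K

lemma isZero_double (K : CochainComplex A ℤ) (p : ℤ) (n : ℕ) (h : IsZero (K.X p)) :
    IsZero (((double η K).X p).X n) :=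
  (powFunctor T (n + 1)).map_isZero h

/-- Boundedness below enters here: `p + n = m` with `N ≤ p` leaves only `n ≤ m - N`. -/
lemma finiteSupport (K : CPlus A) : Tot.FiniteSupport degR (double η K.obj) := by
  obtain ⟨N, hN⟩ := K.property
  intro m
  refine Set.Finite.of_injOn (f := fun x => x.1.2) (t := Set.Iic (m - N).toNat) ?_ ?_
    (Set.finite_Iic _)
  · rintro ⟨⟨p, n⟩, hx⟩ hz
    by_contra hn
    refine hz (isZero_double η _ p n (K.obj.isZero_of_isStrictlyGE N p ?_))
    simp only [Set.mem_Iic, degR] at hn hx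
    lia
  · rintro ⟨⟨p, n⟩, hx⟩ _ ⟨⟨p', n'⟩, hx'⟩ _ h
    obtain rfl : n = n' := h
    have : p = p' := by simp only at hx hx'; lia
    subst this
    rfl

variable [HasFiniteBiproducts A]

instance (K : CPlus A) : Tot.HasTot degR (double η K.obj) := (finiteSupport η K).hasTot

/-- The total cobar complex. -/
def totCobar : CPlus A ⥤ CPlus A :=
  (bddBelow A).lift
    { obj := fun K => Tot.tot degR (double η K.obj)
      map := fun f => Tot.map degR (((cobar η).mapHomologicalComplex _).map f.hom)
      map_id := fun K => (congrArg (Tot.map degR)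
        (((cobar η).mapHomologicalComplex _).map_id K.obj)).trans Tot.map_id
      map_comp := fun f g => (congrArg (Tot.map degR)
        (((cobar η).mapHomologicalComplex _).map_comp f.hom g.hom)).trans (Tot.map_comp _ _) }
    (fun K => by
      obtain ⟨N, hN⟩ := K.property
      refine ⟨N, (CochainComplex.isStrictlyGE_iff _ _).2 fun m hm => ?_⟩
      refine (IsZero.iff_id_eq_zero _).2 ?_
      change 𝟙 (⨁ Tot.fam degR (double η K.obj) m) = 0
      refine Tot.hom_ext fun p n h => IsZero.eq_of_tgt (isZero_double η _ p n ?_) _ _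
      refine K.obj.isZero_of_isStrictlyGE N p ?_
      simp only [degR] at h
      lia)

/-- The coaugmentation of the columns of the cobar double complex. -/
def coaugCol (K : CPlus A) (m : ℤ) : K.obj.X m ⟶ ((double η K.obj).X m).X 0 := η.app (K.obj.X m)

lemma coaugCol_d (K : CPlus A) (m : ℤ) :
    coaugCol η K m ≫ ((double η K.obj).X m).d 0 (0 + 1) = 0 := by
  rw [coaugCol]
  exact (congrArg (η.app (K.obj.X m) ≫ ·) (cobar_d η (K.obj.X m) 0)).trans (app_next η _)

lemma coaugCol_f (K : CPlus A) (m : ℤ) :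
    coaugCol η K m ≫ ((double η K.obj).d m (m + 1)).f 0 =
      K.obj.d m (m + 1) ≫ coaugCol η K (m + 1) :=
  (η.naturality (K.obj.d m (m + 1))).symm

lemma add_degR_zero (m : ℤ) : m + degR 0 = m := by simp [degR]

/-- The coaugmentation of the total cobar complex in a given degree. -/
def coaugX (K : CPlus A) (m : ℤ) : K.obj.X m ⟶ ⨁ Tot.fam degR (double η K.obj) m :=
  coaugCol η K m ≫ Tot.incl degR (double η K.obj) m m 0 (add_degR_zero m)

lemma coaugX_π_self (K : CPlus A) (m : ℤ) :
    coaugX η K m ≫ Tot.π degR (double η K.obj) m m 0 = coaugCol η K m := by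
  rw [coaugX, Category.assoc, Tot.incl_π_self, Category.comp_id]

lemma coaugX_π_ne (K : CPlus A) (m p : ℤ) (n : ℕ) (h : (m, 0) ≠ (p, n)) :
    coaugX η K m ≫ Tot.π degR (double η K.obj) m p n = 0 := by
  rw [coaugX, Category.assoc, Tot.incl_π_ne _ h, comp_zero]

lemma coaugX_d (K : CPlus A) (m : ℤ) :
    coaugX η K m ≫ Tot.d degR (double η K.obj) m (m + 1) =
      K.obj.d m (m + 1) ≫ coaugX η K (m + 1) := by
  refine Tot.hom_ext fun p n h => ?_
  obtain ⟨p, rfl⟩ : ∃ q, p = q + 1 := ⟨p - 1, by lia⟩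
  rw [Category.assoc, Category.assoc, Tot.d_π rfl rfl, Preadditive.comp_add,
    Linear.comp_units_smul, ← Category.assoc, ← Category.assoc]
  -- The case `n = 0` is naturality of `η`; the case `n = 1` is that `η` followed by the first
  -- differential vanishes; for larger `n` every term is zero.
  rcases n with _ | _ | n
  · obtain rfl : p = m := by simp only [degR] at h; lia
    rw [coaugX_π_self η K (p + 1), coaugX_π_self η K p, coaugCol_f,
      ((double η K.obj).X (p + 1)).shape ((ComplexShape.up ℕ).prev 0) 0 (by simp), comp_zero,
      smul_zero, add_zero]
  · obtain rfl : m = p + 1 := by simp only [degR] at h; lia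
    rw [coaugX_π_ne η K (p + 1) p _ (by simp), coaugX_π_ne η K (p + 1 + 1) _ _ (by simp),
      zero_comp, CochainComplex.prev_nat_succ, coaugX_π_self, coaugCol_d, smul_zero, add_zero,
      comp_zero]
  · rw [coaugX_π_ne η K m p _ (by simp), coaugX_π_ne η K (m + 1) _ _ (by simp),
      CochainComplex.prev_nat_succ, coaugX_π_ne η K m (p + 1) _ (by simp), zero_comp, zero_comp,
      comp_zero, smul_zero, add_zero]

/-- The coaugmentation of the total cobar complex. -/
def coaug (K : CPlus A) : K.obj ⟶ ((totCobar η).obj K).obj where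
  f m := coaugX η K m
  comm' := by
    rintro m _ rfl
    exact coaugX_d η K m

/-- The coaugmentation of the total cobar complex, as a natural transformation. -/
def coaugTrans : 𝟭 (CPlus A) ⟶ totCobar η where
  app K := ⟨coaug η K⟩
  naturality K L f := by
    refine ObjectProperty.hom_ext _ ?_
    ext m
    change f.hom.f m ≫ coaugX η L m =
      coaugX η K m ≫ Tot.mapX degR (((cobar η).mapHomologicalComplex _).map f.hom) m
    refine Tot.hom_ext fun p n h => ?_
    rw [Category.assoc, Category.assoc, Tot.mapX_π, ← Category.assoc (coaugX η K m)]
    by_cases hn : (m, 0) = (p, n)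
    · obtain ⟨rfl, rfl⟩ := Prod.mk.inj hn
      rw [coaugX_π_self, coaugX_π_self]
      exact η.naturality (f.hom.f m)
    · rw [coaugX_π_ne _ _ _ _ _ hn, coaugX_π_ne _ _ _ _ _ hn, comp_zero, zero_comp]

variable {η}

/-- The coaugmentation of the total cobar complex is a quasi-isomorphism if the coaugmented cobar
complexes of the entries are exact. -/
lemma qi_coaug (Φ : A ⥤ Ban.{u} k) [Φ.Additive] (K : CPlus A)
    (h : ∀ p, Exact η Φ (K.obj.X p)) :
    Ban.QI ((Φ.mapHomologicalComplex _).map (coaug η K)) := by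
  refine (Tot.decomp Φ (finiteSupport η K)).qi_of_rows_right _
    (fun p => (Φ.map (η.app (K.obj.X p))).clm) ?_ ?_ (fun p => (h p).1) ?_ ?_
  · intro m x
    refine congrArg (fun f => Ban.Hom.clm f x) ((Φ.map_comp
      (coaugX η K m) (Tot.π degR (double η K.obj) m m 0)).symm.trans ?_)
    exact congrArg Φ.map (coaugX_π_self η K m)
  · intro m p n x
    have e : Φ.map (coaugX η K m) ≫ Φ.map (Tot.π degR (double η K.obj) m p (n + 1)) = 0 := by
      rw [← Φ.map_comp, coaugX_π_ne η K m p _ (by simp), Φ.map_zero]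
    exact congrArg (fun f => Ban.Hom.clm f x) e
  · intro p x hx
    exact (h p).2 0 x ((congrArg (fun f => (Φ.map f).clm x) (cobar_d η (K.obj.X p) 0)).symm.trans hx)
  · intro p n x hx
    obtain ⟨z, hz⟩ := (h p).2 (n + 1) x
      ((congrArg (fun f => (Φ.map f).clm x) (cobar_d η (K.obj.X p) (n + 1))).symm.trans hx)
    exact ⟨z, (congrArg (fun f => (Φ.map f).clm z) (cobar_d η (K.obj.X p) n)).trans hz⟩

lemma qi_totCobar_map (Φ : A ⥤ Ban.{u} k) [Φ.Additive] {K L : CPlus A} (f : K ⟶ L)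
    (h : ∀ n, Ban.QI ((Φ.mapHomologicalComplex _).map
      (((powFunctor T (n + 1)).mapHomologicalComplex _).map f.hom))) :
    Ban.QI ((Φ.mapHomologicalComplex _).map ((totCobar η).map f).hom) :=
  Tot.qi_map_of_columns Φ degR_injective (finiteSupport η K) (finiteSupport η L) _ h

/-- A biproduct has a retraction of the coaugmentation as soon as its summands do. -/
lemma exists_retraction_biproduct {J : Type} (X : J → A) [HasBiproduct X]
    (h : ∀ j, ∃ r : T.obj (X j) ⟶ X j, η.app (X j) ≫ r = 𝟙 _) :
    ∃ r : T.obj (⨁ X) ⟶ ⨁ X, η.app (⨁ X) ≫ r = 𝟙 _ := by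
  choose r hr using h
  refine ⟨biproduct.lift fun j => T.map (biproduct.π X j) ≫ r j, ?_⟩
  refine biproduct.hom_ext _ _ fun j => ?_
  rw [Category.assoc, biproduct.lift_π, ← Category.assoc, ← η.naturality, Category.assoc, hr,
    Category.id_comp, Category.comp_id]

lemma exists_retraction_totCobar (K : CPlus A)
    (h : ∀ N : A, ∃ r : T.obj (T.obj N) ⟶ T.obj N, η.app (T.obj N) ≫ r = 𝟙 _) (m : ℤ) :
    ∃ r : T.obj (((totCobar η).obj K).obj.X m) ⟶ ((totCobar η).obj K).obj.X m,
      η.app (((totCobar η).obj K).obj.X m) ≫ r = 𝟙 _ :=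
  exists_retraction_biproduct (Tot.fam degR (double η K.obj) m) fun j => h (powObj T j.1.2 _)

end Cobar

instance : HasFiniteBiproducts (GBan k G) :=
  haveI : HasFiniteProducts (GBan k G) := hasFiniteProducts_of_has_binary_and_terminal
  HasFiniteBiproducts.of_hasFiniteProducts

/-! ### Summable families and bounded families -/

section Families

variable {E : Type u} {F : Type*} [NormedAddCommGroup E] [NormedSpace k E]
  [NormedAddCommGroup F] [NormedSpace k F]

variable (G E) in
/-- The space of absolutely summable families. -/
abbrev L1 := lp (fun _ : G => E) 1

variable (G E) in
/-- The space of bounded families. -/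
abbrev Linf := lp (fun _ : G => E) ⊤

namespace L1

lemma hasSum_norm (x : L1 G E) : HasSum (fun a => ‖x a‖) ‖x‖ := by
  simpa using lp.hasSum_norm (by simp) x

lemma mem {x : G → E} (h : Summable fun a => ‖x a‖) : Memℓp x 1 :=
  memℓp_gen (by simpa using h)

/-- The family concentrated at one element. -/
def single (a : G) : E →L[k] L1 G E := by
  classical exact lp.singleContinuousLinearMap k (fun _ : G => E) 1 a

lemma norm_single (a : G) (x : E) : ‖(single a : E →L[k] L1 G E) x‖ = ‖x‖ := by
  classical exact lp.norm_single (E := fun _ : G => E) one_pos a x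

lemma single_apply_self (a : G) (x : E) : ((single a : E →L[k] L1 G E) x) a = x := by
  classical exact lp.single_apply_self (E := fun _ : G => E) 1 a x

lemma single_apply_ne {a b : G} (h : b ≠ a) (x : E) :
    ((single a : E →L[k] L1 G E) x) b = 0 := by
  classical exact lp.single_apply_ne (E := fun _ : G => E) 1 a x h

/-- Families concentrated at one element span a dense subspace of ℓ¹, so identities between
continuous linear maps on ℓ¹ are checked on them. -/
lemma ext_single {f g : L1 G E →L[k] F}
    (h : ∀ a x, f ((single a : E →L[k] _) x) = g ((single a : E →L[k] _) x)) : f = g := by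
  classical
  exact lp.ext_continuousLinearMap (by simp) fun a => ContinuousLinearMap.ext fun x => h a x

variable [CompleteSpace F]

lemma summable_desc (u : G → E →L[k] F) {C : ℝ} (hu : ∀ a x, ‖u a x‖ ≤ C * ‖x‖) (x : L1 G E) :
    Summable fun a => u a (x a) :=
  Summable.of_norm_bounded ((hasSum_norm x).summable.mul_left C) fun a => hu a (x a)

/-- The map out of a space of summable families induced by a uniformly bounded family of maps. -/
def desc (u : G → E →L[k] F) (C : ℝ) (hu : ∀ a x, ‖u a x‖ ≤ C * ‖x‖) : L1 G E →L[k] F :=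
  LinearMap.mkContinuous
    { toFun := fun x => ∑' a, u a (x a)
      map_add' := fun x y => by
        rw [← (summable_desc u hu x).tsum_add (summable_desc u hu y)]
        exact tsum_congr fun a => map_add (u a) (x a) (y a)
      map_smul' := fun c x => by
        rw [RingHom.id_apply, ← (summable_desc u hu x).tsum_const_smul c]
        exact tsum_congr fun a => map_smul (u a) c (x a) }
    C fun x => tsum_of_norm_bounded ((hasSum_norm x).mul_left C) fun a => hu a (x a)

lemma desc_apply (u : G → E →L[k] F) (C : ℝ) (hu) (x : L1 G E) :
    desc u C hu x = ∑' a, u a (x a) := rfl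

lemma norm_desc_le (u : G → E →L[k] F) (C : ℝ) (hu) (x : L1 G E) :
    ‖desc u C hu x‖ ≤ C * ‖x‖ :=
  tsum_of_norm_bounded ((hasSum_norm x).mul_left C) fun a => hu a (x a)

@[simp]
lemma desc_single (u : G → E →L[k] F) (C : ℝ) (hu) (a : G) (x : E) :
    desc u C hu ((single a : E →L[k] _) x) = u a x := by
  rw [desc_apply, tsum_eq_single a fun b hb => by rw [single_apply_ne hb, map_zero],
    single_apply_self]

end L1

namespace Linf

lemma norm_apply_le (x : Linf G E) (a : G) : ‖x a‖ ≤ ‖x‖ := lp.norm_apply_le_norm (by simp) x a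

lemma mem {x : G → E} (C : ℝ) (h : ∀ a, ‖x a‖ ≤ C) : Memℓp x ⊤ :=
  memℓp_infty ⟨C, by rintro _ ⟨a, rfl⟩; exact h a⟩

/-- The evaluation of a bounded family. -/
def eval (a : G) : Linf G E →L[k] E :=
  LinearMap.mkContinuous
    { toFun := fun x => x a
      map_add' := fun _ _ => rfl
      map_smul' := fun _ _ => rfl } 1 fun x => (norm_apply_le x a).trans (one_mul _).ge

@[simp] lemma eval_apply (a : G) (x : Linf G E) : (eval a : Linf G E →L[k] E) x = x a := rfl

lemma nonneg_of_bound (u : G → F →L[k] E) {C : ℝ} (hu : ∀ a x, ‖u a x‖ ≤ C * ‖x‖) (x : F) :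
    0 ≤ C * ‖x‖ := (norm_nonneg _).trans (hu 1 x)

/-- The map into a space of bounded families induced by a uniformly bounded family of maps. -/
def lift (u : G → F →L[k] E) (C : ℝ) (hu : ∀ a x, ‖u a x‖ ≤ C * ‖x‖) : F →L[k] Linf G E :=
  LinearMap.mkContinuous
    { toFun := fun x => ⟨fun a => u a x, mem (C * ‖x‖) fun a => hu a x⟩
      map_add' := fun x y => lp.ext (funext fun a => map_add (u a) x y)
      map_smul' := fun c x => lp.ext (funext fun a => map_smul (u a) c x) }
    C fun x => lp.norm_le_of_forall_le (nonneg_of_bound u hu x) fun a => hu a x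

@[simp] lemma lift_apply (u : G → F →L[k] E) (C : ℝ) (hu) (x : F) (a : G) :
    lift u C hu x a = u a x := rfl

lemma norm_lift_le (u : G → F →L[k] E) (C : ℝ) (hu) (x : F) : ‖lift u C hu x‖ ≤ C * ‖x‖ :=
  lp.norm_le_of_forall_le (nonneg_of_bound u hu x) fun a => hu a x

lemma ext {x y : Linf G E} (h : ∀ a, x a = y a) : x = y := lp.ext (funext h)

end Linf

end Families

/-- An isometric action from a family of contractions. -/
def isometricAction {E : Type u} [NormedAddCommGroup E] [NormedSpace k E] (f : G → E →L[k] E)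
    (h₁ : ∀ x, f 1 x = x) (h : ∀ g g' x, f (g * g') x = f g (f g' x))
    (hf : ∀ g x, ‖f g x‖ ≤ ‖x‖) : G →* (E ≃ₗᵢ[k] E) :=
  have h' : ∀ g x, f g⁻¹ (f g x) = x := fun g x => by rw [← h, inv_mul_cancel, h₁]
  { toFun := fun g =>
      { toFun := f g
        invFun := f g⁻¹
        map_add' := map_add _
        map_smul' := map_smul _
        left_inv := h' g
        right_inv := fun x => by rw [← h, mul_inv_cancel, h₁]
        norm_map' := fun x => le_antisymm (hf g x) (by
          have := hf g⁻¹ (f g x)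
          rwa [h'] at this) }
    map_one' := LinearIsometryEquiv.ext h₁
    map_mul' := fun g g' => LinearIsometryEquiv.ext (h g g') }

/-! ### The representation of absolutely summable families -/

namespace GBan

lemma norm_single_le {E : Type u} [NormedAddCommGroup E] [NormedSpace k E] (a : G) (x : E) :
    ‖(L1.single a : E →L[k] L1 G E) x‖ ≤ 1 * ‖x‖ := by rw [L1.norm_single, one_mul]

/-- The translation of absolutely summable families. -/
def translate {E : Type u} [NormedAddCommGroup E] [NormedSpace k E] [CompleteSpace E] (g : G) :
    L1 G E →L[k] L1 G E :=
  L1.desc (fun a => L1.single (g * a)) 1 fun a x => norm_single_le (g * a) x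

lemma norm_translate_le {E : Type u} [NormedAddCommGroup E] [NormedSpace k E] [CompleteSpace E]
    (g : G) (x : L1 G E) : ‖(translate g : L1 G E →L[k] L1 G E) x‖ ≤ ‖x‖ :=
  (L1.norm_desc_le _ _ _ x).trans (one_mul _).le

/-- The representation of absolutely summable families in a representation. -/
def ell1Obj (M : GBan k G) : GBan k G where
  carrier := L1 G M
  ρ := isometricAction translate
    (fun x => by
      refine DFunLike.congr_fun (?_ : translate 1 = ContinuousLinearMap.id k (L1 G M)) x
      refine L1.ext_single fun a m => ?_
      simp [translate])
    (fun g g' x => by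
      refine DFunLike.congr_fun
        (?_ : translate (g * g') = (translate g).comp (translate g' : L1 G M →L[k] _)) x
      refine L1.ext_single fun a m => ?_
      simp [translate, mul_assoc])
    norm_translate_le

/-- The family concentrated at one element. -/
abbrev single (M : GBan k G) (a : G) : M →L[k] ell1Obj M := (L1.single a : M →L[k] L1 G M)

@[simp] lemma ell1Obj_ρ_single (M : GBan k G) (g a : G) (m : M) :
    (ell1Obj M).ρ g (single M a m) = single M (g * a) m :=
  L1.desc_single (fun a => (L1.single (g * a) : M →L[k] L1 G M)) 1
    (fun a x => norm_single_le (g * a) x) a m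

lemma norm_single (M : GBan k G) (a : G) (m : M) : ‖single M a m‖ = ‖m‖ := L1.norm_single a m

lemma ell1_clm_ext {M : GBan k G} {F : Type*} [NormedAddCommGroup F] [NormedSpace k F]
    {f g : ell1Obj M →L[k] F} (h : ∀ a m, f (single M a m) = g (single M a m)) : f = g :=
  L1.ext_single h

lemma ell1_hom_ext {M N : GBan k G} {f g : ell1Obj M ⟶ N}
    (h : ∀ a m, f.clm (single M a m) = g.clm (single M a m)) : f = g :=
  GBan.Hom.ext (L1.ext_single h)

/-- The equivariant map out of the representation of summable families induced by a uniformly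
bounded equivariant family of maps. -/
def descHom {M N : GBan k G} (u : G → M →L[k] N) (C : ℝ) (hu : ∀ a x, ‖u a x‖ ≤ C * ‖x‖)
    (h : ∀ g a m, u (g * a) m = N.ρ g (u a m)) : ell1Obj M ⟶ N where
  clm := L1.desc u C hu
  equivariant g x := by
    refine DFunLike.congr_fun (?_ : (L1.desc u C hu).comp
      ((ell1Obj M).ρ g).toContinuousLinearEquiv.toContinuousLinearMap =
      (N.ρ g).toContinuousLinearEquiv.toContinuousLinearMap.comp (L1.desc u C hu)) x
    refine ell1_clm_ext fun a m => ?_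
    change L1.desc u C hu ((ell1Obj M).ρ g (single M a m)) = N.ρ g (L1.desc u C hu (single M a m))
    rw [ell1Obj_ρ_single]
    exact (L1.desc_single _ _ _ _ _).trans ((h g a m).trans
      (congrArg (N.ρ g) (L1.desc_single _ _ _ _ _).symm))

@[simp] lemma descHom_single {M N : GBan k G} (u : G → M →L[k] N) (C : ℝ) (hu) (h) (a : G)
    (m : M) : (descHom u C hu h).clm (single M a m) = u a m :=
  L1.desc_single u C hu a m

lemma norm_single_comp_le {M N : GBan k G} (f : M →L[k] N) (a : G) (m : M) :
    ‖(single N a).comp f m‖ ≤ ‖f‖ * ‖m‖ :=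
  (norm_single N a (f m)).le.trans (f.le_opNorm m)

/-- The map on summable families induced by a morphism. -/
def ell1Map {M N : GBan k G} (f : M ⟶ N) : ell1Obj M ⟶ ell1Obj N :=
  descHom (fun a => (single N a).comp f.clm) ‖f.clm‖ (norm_single_comp_le f.clm)
    (fun g a m => (ell1Obj_ρ_single N g a (f.clm m)).symm)

@[simp] lemma ell1Map_single {M N : GBan k G} (f : M ⟶ N) (a : G) (m : M) :
    (ell1Map f).clm (single M a m) = single N a (f.clm m) :=
  descHom_single _ _ (norm_single_comp_le f.clm) _ a m

variable (k G) in
/-- The functor of absolutely summable families. -/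
@[simps]
def ell1 : GBan k G ⥤ GBan k G where
  obj := ell1Obj
  map := ell1Map
  map_id M := ell1_hom_ext fun a m => ell1Map_single _ a m
  map_comp f g := ell1_hom_ext fun a m => by simp

instance : (ell1 k G).Additive where
  map_add {M N f g} := ell1_hom_ext fun a m => by
    change (ell1Map (f + g)).clm (single M a m) =
      (ell1Map f).clm (single M a m) + (ell1Map g).clm (single M a m)
    simp

/-- The action of a group element. -/
def act (M : GBan k G) (g : G) : M →L[k] M := (M.ρ g).toContinuousLinearEquiv

@[simp] lemma act_apply (M : GBan k G) (g : G) (m : M) : M.act g m = M.ρ g m := rfl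

lemma norm_act_le (M : GBan k G) (g : G) (m : M) : ‖M.act g m‖ ≤ 1 * ‖m‖ := by
  rw [one_mul]; exact ((M.ρ g).norm_map m).le

lemma ρ_mul_apply (M : GBan k G) (g g' : G) (m : M) : M.ρ (g * g') m = M.ρ g (M.ρ g' m) := by
  rw [map_mul]; rfl

lemma ρ_one_apply (M : GBan k G) (m : M) : M.ρ 1 m = m := by
  rw [map_one]; rfl

/-- The summation map of the representation of summable families. -/
def ell1Sum (M : GBan k G) : ell1Obj M ⟶ M := descHom M.act 1 M.norm_act_le M.ρ_mul_apply

@[simp] lemma ell1Sum_single (M : GBan k G) (a : G) (m : M) :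
    (ell1Sum M).clm (single M a m) = M.ρ a m := descHom_single _ _ M.norm_act_le _ a m

variable (k G) in
/-- The summation map, an augmentation of the functor of absolutely summable families. -/
@[simps]
def ell1ε : Augmentation (ell1 k G) where
  app := ell1Sum
  naturality {M N} f := ell1_hom_ext fun a m => by
    change (ell1Sum N).clm ((ell1Map f).clm (single M a m)) =
      f.clm ((ell1Sum M).clm (single M a m))
    simp [f.equivariant]

lemma norm_single_single_le (M : GBan k G) (a : G) (m : M) :
    ‖(single (ell1Obj M) a).comp (single M 1) m‖ ≤ 1 * ‖m‖ := by
  rw [one_mul]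
  exact ((norm_single (ell1Obj M) a _).trans (norm_single M 1 m)).le

/-- The section of the augmentation for a representation of summable families. -/
def ell1Section (M : GBan k G) : ell1Obj M ⟶ ell1Obj (ell1Obj M) :=
  descHom (fun a => (single (ell1Obj M) a).comp (single M 1)) 1 M.norm_single_single_le
    (fun g a _ => (ell1Obj_ρ_single (ell1Obj M) g a _).symm)

@[simp] lemma ell1Section_single (M : GBan k G) (a : G) (m : M) :
    (ell1Section M).clm (single M a m) = single (ell1Obj M) a (single M 1 m) :=
  descHom_single _ _ M.norm_single_single_le _ a m

/-- The section `δ_a m ↦ δ_a (δ_1 m)` is equivariant because translation only moves the outer index,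
and the augmentation returns the translate of `δ_1 m` by `a`, which is `δ_a m`. -/
lemma ell1Section_ε (M : GBan k G) : ell1Section M ≫ ell1Sum (ell1Obj M) = 𝟙 (ell1Obj M) :=
  ell1_hom_ext fun a m => by simp

/-! Coordinates and exactness -/

/-- The coordinates of a summable family. -/
def coord (M : GBan k G) (a : G) : ell1Obj M →L[k] M := lp.evalCLM k (fun _ : G => M) 1 a

lemma coord_single_self (M : GBan k G) (a : G) (m : M) : coord M a (single M a m) = m :=
  L1.single_apply_self (k := k) a m

lemma coord_single_ne (M : GBan k G) {a b : G} (h : b ≠ a) (m : M) :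
    coord M b (single M a m) = 0 :=
  L1.single_apply_ne (k := k) h m

lemma coord_map {M N : GBan k G} (f : M ⟶ N) (x : ell1Obj M) (a : G) :
    coord N a ((ell1Map f).clm x) = f.clm (coord M a x) := by
  have : (coord N a).comp (ell1Map f).clm = f.clm.comp (coord M a) := by
    refine ell1_clm_ext fun b m => ?_
    change coord N a ((ell1Map f).clm (single M b m)) = f.clm (coord M a (single M b m))
    rw [ell1Map_single]
    by_cases h : a = b
    · subst h
      rw [coord_single_self, coord_single_self]
    · rw [coord_single_ne N h, coord_single_ne M h, map_zero]
  exact DFunLike.congr_fun this x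

/-- Open mapping theorem for `f` onto the closed kernel of `g`. A constant independent of `y` is
what keeps families of preimages summable or bounded. -/
lemma exists_bounded_preimage {E F H : Ban.{u} k} (f : E ⟶ F) (g : F ⟶ H) (w : f ≫ g = 0)
    (h : ∀ y, g.clm y = 0 → ∃ x, f.clm x = y) :
    ∃ C : ℝ, ∀ y, g.clm y = 0 → ∃ x, f.clm x = y ∧ ‖x‖ ≤ C * ‖y‖ := by
  let K : Submodule k F := Ban.ker g
  have : CompleteSpace K := (Ban.isClosed_ker g).completeSpace_coe
  obtain ⟨C, -, hC⟩ := (f.clm.codRestrict K (Ban.comp_eq_zero w)).exists_preimage_norm_le (by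
    rintro ⟨y, hy⟩
    obtain ⟨x, rfl⟩ := h y hy
    exact ⟨x, rfl⟩)
  refine ⟨C, fun y hy => ?_⟩
  obtain ⟨x, hx, hx'⟩ := hC ⟨y, hy⟩
  exact ⟨x, congrArg Subtype.val hx, hx'⟩

lemma acyclic_iff_elements (K : Cpx k G) : acyclic (GBan k G) K ↔
    ∀ i j l : ℤ, i + 1 = j → j + 1 = l → ∀ x : K.X j, (K.d j l).clm x = 0 →
      ∃ y : K.X i, (K.d i j).clm y = x :=
  (acyclic_iff K).trans (Ban.acyclic_iff _)

lemma acyclic.exists_bounded {K : Cpx k G} (h : acyclic (GBan k G) K) (i j l : ℤ)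
    (hij : i + 1 = j) (hjl : j + 1 = l) :
    ∃ C : ℝ, ∀ x : K.X j, (K.d j l).clm x = 0 →
      ∃ y : K.X i, (K.d i j).clm y = x ∧ ‖y‖ ≤ C * ‖x‖ :=
  exists_bounded_preimage (((forgetCpx k G).obj K).d i j) (((forgetCpx k G).obj K).d j l)
    (((forgetCpx k G).obj K).d_comp_d i j l) ((acyclic_iff_elements K).1 h i j l hij hjl)

/-- Preimages are chosen coordinate by coordinate; with one constant `C` for all coordinates, their
norms are dominated by a summable family. -/
lemma acyclic_ell1 (K : Cpx k G) (h : acyclic (GBan k G) K) :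
    acyclic (GBan k G) (((ell1 k G).mapHomologicalComplex _).obj K) := by
  rw [acyclic_iff_elements]
  intro i j l hij hjl (x : L1 G (K.X j)) hx
  obtain ⟨C, hC⟩ := acyclic.exists_bounded h i j l hij hjl
  have hx' : ∀ a, (K.d j l).clm (x a) = 0 := fun a =>
    (coord_map (K.d j l) x a).symm.trans ((congrArg (coord (K.X l) a) hx).trans (map_zero _))
  choose y hy hy' using fun a => hC (x a) (hx' a)
  let y' : ell1Obj (K.X i) := ⟨y, L1.mem (Summable.of_nonneg_of_le (fun _ => norm_nonneg _) hy'
    ((L1.hasSum_norm x).summable.mul_left C))⟩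
  exact ⟨y', lp.ext (funext fun a => (coord_map (K.d i j) y' a).trans (hy a))⟩

/-! Coinvariants -/

/-- The sum of the coordinates of a summable family. -/
def total (M : GBan k G) : ell1Obj M →L[k] M :=
  L1.desc (fun _ => ContinuousLinearMap.id k M) 1 (fun _ m => (one_mul ‖m‖).ge)

@[simp] lemma total_single (M : GBan k G) (a : G) (m : M) : total M (single M a m) = m :=
  L1.desc_single (fun _ => ContinuousLinearMap.id k M) 1 _ a m

lemma total_map {M N : GBan k G} (f : M ⟶ N) (x : ell1Obj M) :
    total N ((ell1Map f).clm x) = f.clm (total M x) := by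
  have : (total N).comp (ell1Map f).clm = f.clm.comp (total M) :=
    ell1_clm_ext fun a m => by simp
  exact DFunLike.congr_fun this x

lemma total_ρ (M : GBan k G) (g : G) (x : ell1Obj M) : total M ((ell1Obj M).ρ g x) = total M x := by
  have : (total M).comp ((ell1Obj M).act g) = total M := ell1_clm_ext fun a m => by simp
  exact DFunLike.congr_fun this x

/-- Translating `δ_1 m` by `a` gives `δ_a m`, so modulo coinvariants all mass may be moved to the
neutral element, where only the sum of the coordinates remains. -/
lemma mk_single (M : GBan k G) (x : ell1Obj M) :
    (Submodule.Quotient.mk (single M 1 (total M x)) : ell1Obj M ⧸ (ell1Obj M).coinvariantsKer) =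
      Submodule.Quotient.mk x := by
  have : ((ell1Obj M).coinvariantsKer.mkQL.comp (single M 1)).comp (total M) =
      (ell1Obj M).coinvariantsKer.mkQL := by
    refine ell1_clm_ext fun a m => ?_
    change (Submodule.Quotient.mk (single M 1 (total M (single M a m))) :
      ell1Obj M ⧸ (ell1Obj M).coinvariantsKer) = Submodule.Quotient.mk (single M a m)
    rw [total_single, Submodule.Quotient.eq]
    refine Submodule.le_topologicalClosure _ (Submodule.subset_span ⟨single M 1 m, a, ?_⟩)
    rw [ell1Obj_ρ_single, mul_one]
  exact DFunLike.congr_fun this x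

lemma coinvariantsKer_le_ker_total (M : GBan k G) :
    (ell1Obj M).coinvariantsKer ≤ LinearMap.ker (total M : ell1Obj M →ₗ[k] M) := by
  refine Submodule.topologicalClosure_minimal _ ?_ (ContinuousLinearMap.isClosed_ker (total M))
  rw [Submodule.span_le]
  rintro _ ⟨m, g, rfl⟩
  change total M (m - _) = 0
  rw [map_sub, total_ρ, sub_self]

variable (k G) in
/-- The coinvariants of the representation of summable families. -/
def ell1Coinvariants : ell1 k G ⋙ coinvariants k G ≅ forget k G :=
  NatIso.ofComponents (fun M =>
    { hom := ⟨⟨Submodule.liftQ _ (total M : ell1Obj M →ₗ[k] M) (coinvariantsKer_le_ker_total M), by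
        refine (Submodule.isOpenQuotientMap_mkQ _).isQuotientMap.continuous_iff.2 ?_
        exact (total M).continuous⟩⟩
      inv := ⟨(ell1Obj M).coinvariantsKer.mkQL.comp (single M 1)⟩
      hom_inv_id := by
        ext x
        obtain ⟨x, rfl⟩ := Submodule.Quotient.mk_surjective _ x
        exact mk_single M x
      inv_hom_id := by
        ext x
        exact total_single M 1 x })
    (fun f => by
      ext x
      obtain ⟨x, rfl⟩ := Submodule.Quotient.mk_surjective _ x
      exact total_map f x)

end GBan

/-! ### The representation of bounded families -/

namespace GBan

lemma norm_eval_le {E : Type u} [NormedAddCommGroup E] [NormedSpace k E] (a : G) (x : Linf G E) :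
    ‖(Linf.eval a : Linf G E →L[k] E) x‖ ≤ 1 * ‖x‖ :=
  (Linf.norm_apply_le x a).trans (one_mul _).ge

/-- The translation of bounded families. -/
def translateInf {E : Type u} [NormedAddCommGroup E] [NormedSpace k E] (g : G) :
    Linf G E →L[k] Linf G E :=
  Linf.lift (fun a => Linf.eval (g⁻¹ * a)) 1 fun a x => norm_eval_le (g⁻¹ * a) x

lemma norm_translateInf_le {E : Type u} [NormedAddCommGroup E] [NormedSpace k E]
    (g : G) (x : Linf G E) : ‖(translateInf g : Linf G E →L[k] Linf G E) x‖ ≤ ‖x‖ :=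
  (Linf.norm_lift_le _ _ _ x).trans (one_mul _).le

/-- The representation of bounded families in a representation. -/
def linfObj (M : GBan k G) : GBan k G where
  carrier := Linf G M
  ρ := isometricAction translateInf
    (fun x => Linf.ext fun a => by simp [translateInf])
    (fun g g' x => Linf.ext fun a => by simp [translateInf, mul_assoc])
    norm_translateInf_le

/-- The values of a bounded family. -/
def val (M : GBan k G) (a : G) : linfObj M →L[k] M := (Linf.eval a : Linf G M →L[k] M)

lemma norm_val_le (M : GBan k G) (a : G) (x : linfObj M) : ‖val M a x‖ ≤ ‖x‖ :=
  Linf.norm_apply_le (E := M) x a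

lemma linf_ext {M : GBan k G} {x y : linfObj M} (h : ∀ a, val M a x = val M a y) : x = y :=
  Linf.ext (E := M) h

@[simp] lemma val_ρ (M : GBan k G) (g a : G) (x : linfObj M) :
    val M a ((linfObj M).ρ g x) = val M (g⁻¹ * a) x := rfl

lemma linf_hom_ext {M N : GBan k G} {f g : N ⟶ linfObj M}
    (h : ∀ x a, val M a (f.clm x) = val M a (g.clm x)) : f = g :=
  GBan.hom_ext fun x => linf_ext (h x)

/-- The equivariant map into the representation of bounded families induced by a uniformly
bounded equivariant family of maps. -/
def liftHom {M N : GBan k G} (u : G → N →L[k] M) (C : ℝ) (hu : ∀ a x, ‖u a x‖ ≤ C * ‖x‖)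
    (h : ∀ g a x, u a (N.ρ g x) = u (g⁻¹ * a) x) : N ⟶ linfObj M where
  clm := Linf.lift u C hu
  equivariant g x := linf_ext fun a => h g a x

lemma norm_comp_val_le {M N : GBan k G} (f : M →L[k] N) (a : G) (x : linfObj M) :
    ‖f.comp (val M a) x‖ ≤ ‖f‖ * ‖x‖ :=
  (f.le_opNorm _).trans (mul_le_mul_of_nonneg_left (norm_val_le M a x) (norm_nonneg f))

/-- The map on bounded families induced by a morphism. -/
def linfMap {M N : GBan k G} (f : M ⟶ N) : linfObj M ⟶ linfObj N :=
  liftHom (fun a => f.clm.comp (val M a)) ‖f.clm‖ (norm_comp_val_le f.clm) (fun _ _ _ => rfl)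

variable (k G) in
/-- The functor of bounded families. -/
@[simps]
def linf : GBan k G ⥤ GBan k G where
  obj := linfObj
  map := linfMap
  map_id _ := rfl
  map_comp _ _ := rfl

instance : (linf k G).Additive where
  map_add := rfl

/-- The orbit map into the representation of bounded families. -/
def linfOrbit (M : GBan k G) : M ⟶ linfObj M :=
  liftHom (fun a => M.act a⁻¹) 1 (fun a => M.norm_act_le a⁻¹) (fun g a x => by
    simp only [act_apply, mul_inv_rev, inv_inv, ρ_mul_apply])

@[simp] lemma val_linfOrbit (M : GBan k G) (a : G) (x : M) :
    val M a ((linfOrbit M).clm x) = M.ρ a⁻¹ x := rfl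

variable (k G) in
/-- The orbit map, a coaugmentation of the functor of bounded families. -/
@[simps]
def linfη : Coaugmentation (linf k G) where
  app := linfOrbit
  naturality f := linf_hom_ext fun x a => (f.equivariant a⁻¹ x).symm

lemma norm_val_val_le (M : GBan k G) (a : G) (x : linfObj (linfObj M)) :
    ‖(val M 1).comp (val (linfObj M) a) x‖ ≤ 1 * ‖x‖ := by
  rw [one_mul]
  exact (norm_val_le M 1 _).trans (norm_val_le (linfObj M) a x)

/-- The retraction of the coaugmentation for a representation of bounded families. -/
def linfRetraction (M : GBan k G) : linfObj (linfObj M) ⟶ linfObj M :=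
  liftHom (fun a => (val M 1).comp (val (linfObj M) a)) 1 M.norm_val_val_le (fun _ _ _ => rfl)

/-- The retraction reads off `x a 1`. On an orbit this is the value at `1` of the translate of `x`
by `a⁻¹`, which is `x a`. -/
lemma linfη_retraction (M : GBan k G) :
    linfOrbit (linfObj M) ≫ linfRetraction M = 𝟙 (linfObj M) := by
  refine linf_hom_ext fun x a => ?_
  change val M 1 (val (linfObj M) a ((linfOrbit (linfObj M)).clm x)) = val M a x
  rw [val_linfOrbit, val_ρ, inv_inv, mul_one]

/-- As for summable families: preimages of the values, taken with a uniform constant, again form a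
bounded family. -/
lemma acyclic_linf (K : Cpx k G) (h : acyclic (GBan k G) K) :
    acyclic (GBan k G) (((linf k G).mapHomologicalComplex _).obj K) := by
  rw [acyclic_iff_elements]
  intro i j l hij hjl x hx
  obtain ⟨C, hC⟩ := acyclic.exists_bounded h i j l hij hjl
  have hx' : ∀ a, (K.d j l).clm (val (K.X j) a x) = 0 := fun a =>
    (congrArg (val (K.X l) a) hx).trans (map_zero _)
  choose y hy hy' using fun a => hC (val (K.X j) a x) (hx' a)
  -- The constant `C` is not known to be nonnegative, and the bound must be monotone in the norm of
  -- the value.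
  let y' : linfObj (K.X i) := ⟨y, Linf.mem (max C 0 * ‖x‖) fun a => (hy' a).trans
    (mul_le_mul (le_max_left _ _) (norm_val_le _ a x) (norm_nonneg _) (le_max_right _ _))⟩
  exact ⟨y', linf_ext fun a => hy a⟩

/-- The constant families. -/
def const (M : GBan k G) : M →L[k] linfObj M :=
  Linf.lift (fun _ => ContinuousLinearMap.id k M) 1 (fun _ m => (one_mul ‖m‖).ge)

lemma const_val (M : GBan k G) (x : linfObj M) (hx : ∀ g, (linfObj M).ρ g x = x) :
    const M (val M 1 x) = x :=
  linf_ext fun a => by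
    -- Invariance under `a`, evaluated at `a` itself, compares the value at `a` with the value at
    -- `1`.
    have := congrArg (val M a) (hx a)
    rw [val_ρ, inv_mul_cancel] at this
    exact this

variable (k G) in
/-- The invariants of the representation of bounded families. -/
def linfInvariants : linf k G ⋙ invariants k G ≅ forget k G :=
  NatIso.ofComponents (fun M =>
    { hom := ⟨(val M 1).comp (linfObj M).invariantsSubmodule.subtypeL⟩
      inv := ⟨(const M).codRestrict _ (fun _ _ => rfl)⟩
      hom_inv_id := by
        ext x
        exact Subtype.ext (const_val M x.1 x.2)
      inv_hom_id := rfl })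
    (fun f => rfl)

/-! Duals -/

/-- The dual representation. -/
abbrev dualObj (M : GBan k G) : GBan k G := (dualGBan k G).obj (.op M)

/-- The members of a bounded family of functionals. -/
def functional (M : GBan k G) (a : G) : linfObj (dualObj M) →L[k] (M →L[k] k) := val (dualObj M) a

lemma norm_functional_apply_le (M : GBan k G) (f : linfObj (dualObj M)) (a : G) (m : M) :
    ‖functional M a f m‖ ≤ ‖f‖ * ‖m‖ :=
  (ContinuousLinearMap.le_opNorm _ m).trans
    (mul_le_mul_of_nonneg_right (norm_val_le (dualObj M) a f) (norm_nonneg m))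

/-- A bounded family of functionals, as a functional on summable families. -/
def pair (M : GBan k G) (f : linfObj (dualObj M)) : ell1Obj M →L[k] k :=
  L1.desc (fun a => functional M a f) ‖f‖ (norm_functional_apply_le M f)

@[simp] lemma pair_single (M : GBan k G) (f : linfObj (dualObj M)) (a : G) (m : M) :
    pair M f (single M a m) = functional M a f m :=
  L1.desc_single _ _ (norm_functional_apply_le M f) a m

/-- The pairing of bounded families of functionals with summable families, linearly. -/
def pairL (M : GBan k G) : linfObj (dualObj M) →L[k] (ell1Obj M →L[k] k) :=
  LinearMap.mkContinuous
    { toFun := pair M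
      map_add' := fun f g => ell1_clm_ext (f := pair M (f + g)) (g := pair M f + pair M g) fun a m => by
        rw [pair_single, map_add, _root_.add_apply, _root_.add_apply,
          pair_single, pair_single]
      map_smul' := fun c f => ell1_clm_ext (f := pair M (c • f)) (g := c • pair M f) fun a m => by
        rw [pair_single, map_smul]
        exact congrArg (c • ·) (pair_single M f a m).symm }
    1 fun f => (ContinuousLinearMap.opNorm_le_bound (pair M f) (norm_nonneg f)
      (L1.norm_desc_le _ _ (norm_functional_apply_le M f))).trans (one_mul _).ge

/-- The pairing of bounded families of functionals with summable families. -/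
def pairing (M : GBan k G) : linfObj (dualObj M) ⟶ dualObj (ell1Obj M) where
  clm := pairL M
  equivariant g f := by
    refine ell1_clm_ext (f := pair M ((linfObj (dualObj M)).ρ g f))
      (g := (pair M f).comp ((ell1Obj M).act g⁻¹)) fun a m => ?_
    rw [ContinuousLinearMap.comp_apply, act_apply, ell1Obj_ρ_single, pair_single, pair_single]
    rfl

/-- On `δ_a m` both sides give `φ (a m)`, the inverse in the orbit map cancelling that of the
contragredient action. So the coaugmentation of a dual, followed by the pairing, is the dual of the
augmentation; whether the pairing is an isomorphism is immaterial. -/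
lemma orbit_pairing (M : GBan k G) :
    linfOrbit (dualObj M) ≫ pairing M = (dualGBan k G).map (ell1Sum M).op := by
  refine GBan.hom_ext fun (φ : M →L[k] k) => ?_
  refine ell1_clm_ext (f := pair M ((linfOrbit (dualObj M)).clm φ))
    (g := φ.comp (ell1Sum M).clm) fun a m => ?_
  rw [pair_single, ContinuousLinearMap.comp_apply, ell1Sum_single]
  change φ (M.ρ a⁻¹⁻¹ m) = φ (M.ρ a m)
  rw [inv_inv]

/-- The dual of a representation with a section of the augmentation has a retraction of the
coaugmentation. -/
lemma exists_retraction_dual (M : GBan k G)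
    (h : ∃ σ : M ⟶ ell1Obj M, σ ≫ ell1Sum M = 𝟙 M) :
    ∃ r : linfObj (dualObj M) ⟶ dualObj M, linfOrbit (dualObj M) ≫ r = 𝟙 _ := by
  obtain ⟨σ, hσ⟩ := h
  refine ⟨pairing M ≫ (dualGBan k G).map σ.op, ?_⟩
  rw [← Category.assoc, orbit_pairing, ← Functor.map_comp, ← op_comp, hσ, op_id,
    CategoryTheory.Functor.map_id]

end GBan

/-! ### Derived functors from functorial resolutions -/

section Resolutions

variable {C D H : Type*} [Category* C] [Category* D] [Category* H] (L : C ⥤ D)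
  (W : MorphismProperty C) [L.IsLocalization W] (F : C ⥤ H) (R : C ⥤ C)

/-! ### Left derived functors from functorial left resolutions. -/

namespace LeftResolution

variable (ε : R ⟶ 𝟭 C) (hF : W.IsInvertedBy (R ⋙ F))

/-- The left derived functor obtained from a functorial resolution. -/
def functor : D ⥤ H := Localization.lift (R ⋙ F) hF L

/-- The left derived functor is computed by the resolution. -/
def iso : L ⋙ functor L W F R hF ≅ R ⋙ F := Localization.fac (R ⋙ F) hF L

/-- The counit of the left derived functor. -/
def counit : L ⋙ functor L W F R hF ⟶ F := (iso L W F R hF).hom ≫ Functor.whiskerRight ε F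

variable {ε}

/-- The universal property of the left derived functor, before localization. -/
def liftApp (hε : ∀ X, W (ε.app X)) {G : D ⥤ H} (β : L ⋙ G ⟶ F) :
    L ⋙ G ⟶ L ⋙ functor L W F R hF where
  app X :=
    haveI := Localization.inverts L W _ (hε X)
    -- Go back along the resolution, which `L` inverts, apply `β` at the resolved object, and
    -- identify the result with the value of the derived functor.
    inv (G.map (L.map (ε.app X))) ≫ β.app (R.obj X) ≫ (iso L W F R hF).inv.app X
  naturality X Y f := by
    have := Localization.inverts L W _ (hε X)
    have := Localization.inverts L W _ (hε Y)
    have h₁ : G.map (L.map (ε.app X)) ≫ G.map (L.map f) =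
        G.map (L.map (R.map f)) ≫ G.map (L.map (ε.app Y)) := by
      rw [← G.map_comp, ← G.map_comp, ← L.map_comp, ← L.map_comp]
      exact congrArg (fun g => G.map (L.map g)) (ε.naturality f).symm
    have h₂ := β.naturality (R.map f)
    have h₃ := (iso L W F R hF).inv.naturality f
    dsimp only [Functor.comp_obj, Functor.comp_map] at h₂ h₃ ⊢
    rw [← cancel_epi (G.map (L.map (ε.app X))), reassoc_of% h₁, IsIso.hom_inv_id_assoc,
      Category.assoc, Category.assoc, IsIso.hom_inv_id_assoc, ← h₃, reassoc_of% h₂]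

lemma liftApp_counit (hε : ∀ X, W (ε.app X)) {G : D ⥤ H} (β : L ⋙ G ⟶ F) :
    liftApp L W F R hF hε β ≫ counit L W F R ε hF = β := by
  ext X
  have := Localization.inverts L W _ (hε X)
  have h := β.naturality (ε.app X)
  dsimp [liftApp, counit] at h ⊢
  rw [Category.assoc, Category.assoc, Iso.inv_hom_id_app_assoc, IsIso.inv_comp_eq]
  exact h.symm

/-- The universal property of the left derived functor. -/
def liftHom (hε : ∀ X, W (ε.app X)) {G : D ⥤ H} (β : L ⋙ G ⟶ F) : G ⟶ functor L W F R hF :=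
  Localization.liftNatTrans L W (L ⋙ G) (L ⋙ functor L W F R hF) G (functor L W F R hF)
    (liftApp L W F R hF hε β)

lemma liftHom_counit (hε : ∀ X, W (ε.app X)) {G : D ⥤ H} (β : L ⋙ G ⟶ F) :
    Functor.whiskerLeft L (liftHom L W F R hF hε β) ≫ counit L W F R ε hF = β := by
  refine Eq.trans ?_ (liftApp_counit L W F R hF hε β)
  ext X
  simp [liftHom, Localization.liftNatTrans_app]

/-- Naturality along `ε.app X` reduces equality at `X` to equality at `R.obj X`. There the counit is
an isomorphism by `hR` and can be cancelled. -/
lemma hom_ext (hε : ∀ X, W (ε.app X)) (hR : ∀ X, IsIso (F.map (ε.app (R.obj X)))) {G : D ⥤ H}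
    (γ₁ γ₂ : G ⟶ functor L W F R hF)
    (h : Functor.whiskerLeft L γ₁ ≫ counit L W F R ε hF =
      Functor.whiskerLeft L γ₂ ≫ counit L W F R ε hF) : γ₁ = γ₂ := by
  refine Localization.natTrans_ext L W fun X => ?_
  have := Localization.inverts L W _ (hε X)
  have := hR X
  have e₁ : G.map (L.map (ε.app X)) ≫ γ₁.app (L.obj X) = _ := γ₁.naturality (L.map (ε.app X))
  have e₂ : G.map (L.map (ε.app X)) ≫ γ₂.app (L.obj X) = _ := γ₂.naturality (L.map (ε.app X))
  rw [← cancel_epi (G.map (L.map (ε.app X)))]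
  refine e₁.trans (Eq.trans ?_ e₂.symm)
  congr 1
  have hX := congrArg (fun τ => τ.app (R.obj X)) h
  dsimp [counit] at hX
  rwa [← Category.assoc, ← Category.assoc, cancel_mono, cancel_mono] at hX

/-- No triangulated structure is needed. A functorial resolution `R` derives `F` as soon as `R ⋙ F`
inverts `W` and `F` inverts the augmentation at resolved objects. -/
lemma isLeftDerivedFunctor (hε : ∀ X, W (ε.app X))
    (hR : ∀ X, IsIso (F.map (ε.app (R.obj X)))) :
    (functor L W F R hF).IsLeftDerivedFunctor (counit L W F R ε hF) W := by
  rw [Functor.isLeftDerivedFunctor_iff_isRightKanExtension]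
  exact ⟨⟨IsTerminal.ofUniqueHom (fun E => CostructuredArrow.homMk
    (liftHom L W F R hF hε E.hom) (liftHom_counit L W F R hF hε E.hom)) fun E m =>
      CostructuredArrow.hom_ext _ _ (hom_ext L W F R hF hε hR _ _
        ((CostructuredArrow.w m).trans (liftHom_counit L W F R hF hε E.hom).symm))⟩⟩

end LeftResolution

/-! ### Right derived functors from functorial right resolutions. -/

namespace RightResolution

variable (η : 𝟭 C ⟶ R) (hF : W.IsInvertedBy (R ⋙ F))

/-- The right derived functor obtained from a functorial resolution. -/
def functor : D ⥤ H := Localization.lift (R ⋙ F) hF L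

/-- The right derived functor is computed by the resolution. -/
def iso : L ⋙ functor L W F R hF ≅ R ⋙ F := Localization.fac (R ⋙ F) hF L

/-- The unit of the right derived functor. -/
def unit : F ⟶ L ⋙ functor L W F R hF := Functor.whiskerRight η F ≫ (iso L W F R hF).inv

variable {η}

/-- The universal property of the right derived functor, before localization. -/
def descApp (hη : ∀ X, W (η.app X)) {G : D ⥤ H} (β : F ⟶ L ⋙ G) :
    L ⋙ functor L W F R hF ⟶ L ⋙ G where
  app X :=
    haveI := Localization.inverts L W _ (hη X)
    (iso L W F R hF).hom.app X ≫ β.app (R.obj X) ≫ inv (G.map (L.map (η.app X)))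
  naturality X Y f := by
    have := Localization.inverts L W _ (hη X)
    have := Localization.inverts L W _ (hη Y)
    have h₁ : G.map (L.map f) ≫ G.map (L.map (η.app Y)) =
        G.map (L.map (η.app X)) ≫ G.map (L.map (R.map f)) := by
      rw [← G.map_comp, ← G.map_comp, ← L.map_comp, ← L.map_comp]
      exact congrArg (fun g => G.map (L.map g)) (η.naturality f)
    have h₂ := β.naturality (R.map f)
    have h₃ := (iso L W F R hF).hom.naturality f
    dsimp only [Functor.comp_obj, Functor.comp_map] at h₂ h₃ ⊢
    rw [← cancel_mono (G.map (L.map (η.app Y)))]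
    simp only [Category.assoc]
    rw [h₁, IsIso.inv_hom_id, Category.comp_id, IsIso.inv_hom_id_assoc, reassoc_of% h₃, h₂]

lemma unit_descApp (hη : ∀ X, W (η.app X)) {G : D ⥤ H} (β : F ⟶ L ⋙ G) :
    unit L W F R η hF ≫ descApp L W F R hF hη β = β := by
  ext X
  have := Localization.inverts L W _ (hη X)
  have h := β.naturality (η.app X)
  dsimp [descApp, unit] at h ⊢
  rw [Category.assoc, Iso.inv_hom_id_app_assoc, ← Category.assoc, IsIso.comp_inv_eq]
  exact h

/-- The universal property of the right derived functor. -/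
def descHom (hη : ∀ X, W (η.app X)) {G : D ⥤ H} (β : F ⟶ L ⋙ G) : functor L W F R hF ⟶ G :=
  Localization.liftNatTrans L W (L ⋙ functor L W F R hF) (L ⋙ G) (functor L W F R hF) G
    (descApp L W F R hF hη β)

lemma unit_descHom (hη : ∀ X, W (η.app X)) {G : D ⥤ H} (β : F ⟶ L ⋙ G) :
    unit L W F R η hF ≫ Functor.whiskerLeft L (descHom L W F R hF hη β) = β := by
  refine Eq.trans ?_ (unit_descApp L W F R hF hη β)
  ext X
  simp [descHom, Localization.liftNatTrans_app]

lemma hom_ext (hη : ∀ X, W (η.app X)) (hR : ∀ X, IsIso (F.map (η.app (R.obj X)))) {G : D ⥤ H}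
    (γ₁ γ₂ : functor L W F R hF ⟶ G)
    (h : unit L W F R η hF ≫ Functor.whiskerLeft L γ₁ =
      unit L W F R η hF ≫ Functor.whiskerLeft L γ₂) : γ₁ = γ₂ := by
  refine Localization.natTrans_ext L W fun X => ?_
  have := Localization.inverts L W _ (hη X)
  have := hR X
  have e₁ : _ = γ₁.app (L.obj X) ≫ G.map (L.map (η.app X)) := γ₁.naturality (L.map (η.app X))
  have e₂ : _ = γ₂.app (L.obj X) ≫ G.map (L.map (η.app X)) := γ₂.naturality (L.map (η.app X))
  rw [← cancel_mono (G.map (L.map (η.app X)))]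
  refine e₁.symm.trans (Eq.trans ?_ e₂)
  congr 1
  have hX := congrArg (fun τ => τ.app (R.obj X)) h
  dsimp [unit] at hX
  rwa [Category.assoc, Category.assoc, cancel_epi, cancel_epi] at hX

lemma isRightDerivedFunctor (hη : ∀ X, W (η.app X))
    (hR : ∀ X, IsIso (F.map (η.app (R.obj X)))) :
    (functor L W F R hF).IsRightDerivedFunctor (unit L W F R η hF) W := by
  rw [Functor.isRightDerivedFunctor_iff_isLeftKanExtension]
  exact ⟨⟨IsInitial.ofUniqueHom (fun E => StructuredArrow.homMk
    (descHom L W F R hF hη E.hom) (unit_descHom L W F R hF hη E.hom)) fun E m =>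
      StructuredArrow.hom_ext _ _ (hom_ext L W F R hF hη hR _ _
        ((StructuredArrow.w m).trans (unit_descHom L W F R hF hη E.hom).symm))⟩⟩

end RightResolution

end Resolutions

/-! ### The derived functors of coinvariants and invariants -/

namespace GBan

lemma acyclic_pow (T : GBan k G ⥤ GBan k G) [T.Additive]
    (hT : ∀ K, acyclic (GBan k G) K → acyclic (GBan k G) ((T.mapHomologicalComplex _).obj K))
    (K : Cpx k G) (h : acyclic (GBan k G) K) :
    ∀ n, acyclic (GBan k G) (((powFunctor T n).mapHomologicalComplex _).obj K)
  | 0 => (acyclic_iff_elements _).2 ((acyclic_iff_elements K).1 h)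
  | n + 1 => (acyclic_iff_elements _).2 ((acyclic_iff_elements _).1 (hT _ (acyclic_pow T hT K h n)))

/-- If `Φ ∘ T` is the forgetful functor, then `Φ ∘ T^(n+1)` preserves quasi-isomorphisms. -/
lemma qi_pow_succ (T : GBan k G ⥤ GBan k G) [T.Additive]
    (hT : ∀ K, acyclic (GBan k G) K → acyclic (GBan k G) ((T.mapHomologicalComplex _).obj K))
    (Φ : GBan k G ⥤ Ban.{u} k) [Φ.Additive] (e : T ⋙ Φ ≅ forget k G)
    {K L : Cpx k G} (f : K ⟶ L) (hf : qis (GBan k G) f) (n : ℕ) :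
    Ban.QI ((Φ.mapHomologicalComplex _).map
      (((powFunctor T (n + 1)).mapHomologicalComplex _).map f)) :=
  qis_map_Ban (powFunctor T (n + 1) ⋙ Φ) (fun K hK => Ban.acyclic_of_iso
    ((NatIso.mapHomologicalComplex (Functor.isoWhiskerLeft (powFunctor T n) e.symm)
      (ComplexShape.up ℤ)).app K) ((acyclic_iff _).1 (acyclic_pow T hT K hK n))) f hf

variable (k G) in
/-- The functorial resolution of bounded above complexes. -/
abbrev P : CMinus (GBan k G) ⥤ CMinus (GBan k G) := Bar.totBar (ell1ε k G)

variable (k G) in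
/-- The augmentation of the functorial resolution of bounded above complexes. -/
abbrev Pε : P k G ⟶ 𝟭 _ := Bar.augTrans (ell1ε k G)

variable (k G) in
/-- The functorial resolution of bounded below complexes. -/
abbrev I : CPlus (GBan k G) ⥤ CPlus (GBan k G) := Cobar.totCobar (linfη k G)

variable (k G) in
/-- The coaugmentation of the functorial resolution of bounded below complexes. -/
abbrev Iη : 𝟭 _ ⟶ I k G := Cobar.coaugTrans (linfη k G)

/-- The section `m ↦ δ_1 m` is not equivariant, but it is natural, and quasi-isomorphisms are tested
on underlying Banach spaces. -/
lemma qisMinus_Pε (K : CMinus (GBan k G)) : qisMinus (GBan k G) ((Pε k G).app K) := by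
  refine (qis_iff _).2 (Bar.qi_aug (forget k G) K fun p => ?_)
  refine Bar.Exact.of_natural_section (ε := ell1ε k G) (forget k G) (fun M => ⟨single M 1⟩) (fun M m => ?_)
    (fun f m => ell1Map_single f 1 m) (K.obj.X p)
  exact (ell1Sum_single M 1 m).trans (M.ρ_one_apply m)

/-- Evaluation at `1` is a natural, non-equivariant retraction of the orbit map. -/
lemma qisPlus_Iη (K : CPlus (GBan k G)) : qisPlus (GBan k G) ((Iη k G).app K) := by
  refine (qis_iff _).2 (Cobar.qi_coaug (forget k G) K fun p => ?_)
  refine Cobar.Exact.of_natural_retraction (η := linfη k G) (forget k G) (fun M => ⟨val M 1⟩) (fun M m => ?_)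
    (fun f m => rfl) (K.obj.X p)
  refine (val_linfOrbit M 1 m).trans ?_
  rw [inv_one]
  exact M.ρ_one_apply m

lemma qisMinus_of_qi {K L : CMinus (Ban.{u} k)} {f : K ⟶ L} (h : Ban.QI f.hom) :
    qisMinus (Ban.{u} k) f := (Ban.qis_iff _).2 h

lemma qisPlus_of_qi {K L : CPlus (Ban.{u} k)} {f : K ⟶ L} (h : Ban.QI f.hom) :
    qisPlus (Ban.{u} k) f := (Ban.qis_iff _).2 h

variable (k G) in
/-- Coinvariants of complexes, with values in the derived category. -/
abbrev coinvQ : CMinus (GBan k G) ⥤ DMinus (Ban.{u} k) :=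
  mapCMinus (coinvariants k G) ⋙ (qisMinus (Ban.{u} k)).Q

variable (k G) in
/-- Invariants of complexes, with values in the derived category. -/
abbrev invQ : CPlus (GBan k G) ⥤ DPlus (Ban.{u} k) :=
  mapCPlus (invariants k G) ⋙ (qisPlus (Ban.{u} k)).Q

/-- Coinvariants absorb one factor `ell1`, so column `n` becomes the underlying complex of the
`n`-th iterate of `ell1`, which preserves acyclicity. -/
lemma qi_coinvariants_P {K L : CMinus (GBan k G)} (f : K ⟶ L) (hf : qisMinus (GBan k G) f) :
    Ban.QI ((mapCMinus (coinvariants k G)).map ((P k G).map f)).hom :=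
  Bar.qi_totBar_map (coinvariants k G) f
    (qi_pow_succ (ell1 k G) acyclic_ell1 (coinvariants k G) (ell1Coinvariants k G) f.hom hf)

lemma qi_invariants_I {K L : CPlus (GBan k G)} (f : K ⟶ L) (hf : qisPlus (GBan k G) f) :
    Ban.QI ((mapCPlus (invariants k G)).map ((I k G).map f)).hom :=
  Cobar.qi_totCobar_map (invariants k G) f
    (qi_pow_succ (linf k G) acyclic_linf (invariants k G) (linfInvariants k G) f.hom hf)

/-- Complexes of this kind need not be resolved before taking coinvariants: equivariant sections
contract the augmented rows, and the contraction survives coinvariants. -/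
lemma qi_coinvariants_Pε (K : CMinus (GBan k G))
    (h : ∀ p, ∃ σ : K.obj.X p ⟶ ell1Obj (K.obj.X p), σ ≫ ell1Sum (K.obj.X p) = 𝟙 _) :
    Ban.QI ((mapCMinus (coinvariants k G)).map ((Pε k G).app K)).hom :=
  Bar.qi_aug (coinvariants k G) K fun p =>
    (h p).elim fun σ hσ => Bar.Exact.of_section (ε := ell1ε k G) _ σ hσ

lemma qi_invariants_Iη (K : CPlus (GBan k G))
    (h : ∀ p, ∃ r : linfObj (K.obj.X p) ⟶ K.obj.X p, linfOrbit (K.obj.X p) ≫ r = 𝟙 _) :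
    Ban.QI ((mapCPlus (invariants k G)).map ((Iη k G).app K)).hom :=
  Cobar.qi_coaug (invariants k G) K fun p =>
    (h p).elim fun r hr => Cobar.Exact.of_retraction (η := linfη k G) _ r hr

lemma isInvertedBy_P : (qisMinus (GBan k G)).IsInvertedBy (P k G ⋙ coinvQ k G) := fun _ _ f hf =>
  Localization.inverts (qisMinus (Ban.{u} k)).Q (qisMinus (Ban.{u} k)) _
    (qisMinus_of_qi (qi_coinvariants_P f hf))

lemma isInvertedBy_I : (qisPlus (GBan k G)).IsInvertedBy (I k G ⋙ invQ k G) := fun _ _ f hf =>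
  Localization.inverts (qisPlus (Ban.{u} k)).Q (qisPlus (Ban.{u} k)) _
    (qisPlus_of_qi (qi_invariants_I f hf))

lemma exists_section_P (K : CMinus (GBan k G)) (p : ℤ) :
    ∃ σ : ((P k G).obj K).obj.X p ⟶ ell1Obj (((P k G).obj K).obj.X p),
      σ ≫ ell1Sum (((P k G).obj K).obj.X p) = 𝟙 _ :=
  Bar.exists_section_totBar (ε := ell1ε k G) K (fun N => ⟨ell1Section N, ell1Section_ε N⟩) p

lemma exists_retraction_I (K : CPlus (GBan k G)) (p : ℤ) :
    ∃ r : linfObj (((I k G).obj K).obj.X p) ⟶ ((I k G).obj K).obj.X p,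
      linfOrbit (((I k G).obj K).obj.X p) ≫ r = 𝟙 _ :=
  Cobar.exists_retraction_totCobar (η := linfη k G) K
    (fun N => ⟨linfRetraction N, linfη_retraction N⟩) p

end GBan

open GBan

variable (k G) in
lemma isLeftDerivedFunctor_P :
    (LeftResolution.functor (qisMinus (GBan k G)).Q (qisMinus (GBan k G)) (coinvQ k G) (P k G)
      isInvertedBy_P).IsLeftDerivedFunctor
      (LeftResolution.counit (qisMinus (GBan k G)).Q (qisMinus (GBan k G)) (coinvQ k G) (P k G)
        (Pε k G) isInvertedBy_P) (qisMinus (GBan k G)) :=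
  LeftResolution.isLeftDerivedFunctor _ _ _ _ _ qisMinus_Pε
    fun K =>
    Localization.inverts (qisMinus (Ban.{u} k)).Q (qisMinus (Ban.{u} k)) _
      (qisMinus_of_qi (qi_coinvariants_Pε _ (exists_section_P K)))

variable (k G) in
lemma isRightDerivedFunctor_I :
    (RightResolution.functor (qisPlus (GBan k G)).Q (qisPlus (GBan k G)) (invQ k G) (I k G)
      isInvertedBy_I).IsRightDerivedFunctor
      (RightResolution.unit (qisPlus (GBan k G)).Q (qisPlus (GBan k G)) (invQ k G) (I k G)
        (Iη k G) isInvertedBy_I) (qisPlus (GBan k G)) :=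
  RightResolution.isRightDerivedFunctor _ _ _ _ _ qisPlus_Iη
    fun K =>
    Localization.inverts (qisPlus (Ban.{u} k)).Q (qisPlus (Ban.{u} k)) _
      (qisPlus_of_qi (qi_invariants_Iη _ (exists_retraction_I K)))

/-- The total left derived functor of coinvariants exists. -/
instance hasL_coinvariants : HasL (coinvariants k G) :=
  have := isLeftDerivedFunctor_P k G
  Functor.HasLeftDerivedFunctor.mk' _ (LeftResolution.counit (qisMinus (GBan k G)).Q
    (qisMinus (GBan k G)) (coinvQ k G) (P k G) (Pε k G) isInvertedBy_P)

/-- The total right derived functor of invariants exists. -/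
instance hasR_invariants : HasR (invariants k G) :=
  have := isRightDerivedFunctor_I k G
  Functor.HasRightDerivedFunctor.mk' _ (RightResolution.unit (qisPlus (GBan k G)).Q
    (qisPlus (GBan k G)) (invQ k G) (I k G) (Iη k G) isInvertedBy_I)

variable (k G) in
/-- The left derived functor of coinvariants is computed by the bar resolution. -/
def leftDerivedIso : (qisMinus (GBan k G)).Q ⋙ leftDerivedMinus (coinvariants k G) ≅
    P k G ⋙ coinvQ k G :=
  have := isLeftDerivedFunctor_P k G
  Functor.isoWhiskerLeft (qisMinus (GBan k G)).Q
    (Functor.leftDerivedUnique (LF := (coinvQ k G).totalLeftDerived (qisMinus (GBan k G)).Q _)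
      (α := (coinvQ k G).totalLeftDerivedCounit _ (qisMinus (GBan k G)))
      (α'₂ := LeftResolution.counit (qisMinus (GBan k G)).Q (qisMinus (GBan k G)) (coinvQ k G)
        (P k G) (Pε k G) isInvertedBy_P) (W := qisMinus (GBan k G))) ≪≫
    LeftResolution.iso _ _ _ _ _

variable (k G) in
/-- The right derived functor of invariants is computed by the cobar resolution. -/
def rightDerivedIso : (qisPlus (GBan k G)).Q ⋙ rightDerivedPlus (invariants k G) ≅
    I k G ⋙ invQ k G :=
  have := isRightDerivedFunctor_I k G
  Functor.isoWhiskerLeft (qisPlus (GBan k G)).Q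
    (Functor.rightDerivedUnique ((invQ k G).totalRightDerived (qisPlus (GBan k G)).Q _) _ ((invQ k G).totalRightDerivedUnit _ (qisPlus (GBan k G)))
      (RightResolution.unit (qisPlus (GBan k G)).Q (qisPlus (GBan k G)) (invQ k G) (I k G)
        (Iη k G) isInvertedBy_I) (qisPlus (GBan k G))) ≪≫
    RightResolution.iso _ _ _ _ _

/-! ### Duals of complexes of representations -/

lemma Ban.QI.comp {K L M : Ban.Cpx.{u} k} {f : K ⟶ L} {g : L ⟶ M} (hf : Ban.QI f)
    (hg : Ban.QI g) : Ban.QI (f ≫ g) := by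
  constructor
  · intro i j l hij hjl x hx y hy
    obtain ⟨y', hy'⟩ := hg.inj i j l hij hjl ((f.f j).clm x)
      (by rw [Ban.d_f_apply, hx, map_zero]) y hy
    exact hf.inj i j l hij hjl x hx y' hy'
  · intro i j l hij hjl y hy
    obtain ⟨z, hz, y', rfl⟩ := hg.surj i j l hij hjl y hy
    obtain ⟨x, hx, z', rfl⟩ := hf.surj i j l hij hjl z hz
    refine ⟨x, hx, (g.f i).clm z' + y', ?_⟩
    rw [map_add, map_add, Ban.d_f_apply, add_assoc]
    rfl

namespace GBan

lemma dualGBan_map_zero (M N : GBan k G) : (dualGBan k G).map (0 : M ⟶ N).op = 0 :=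
  GBan.hom_ext fun (φ : N →L[k] k) => ContinuousLinearMap.ext fun _ => map_zero φ

variable (k G) in
/-- The dual of a complex of representations. -/
def dualGCpx : (Cpx k G)ᵒᵖ ⥤ Cpx k G where
  obj K :=
    { X := fun n => dualObj (K.unop.X (-n))
      d := fun i j => (dualGBan k G).map (K.unop.d (-j) (-i)).op
      shape := fun i j h => by
        rw [K.unop.shape]
        · exact dualGBan_map_zero _ _
        · intro h'
          exact h (by change i + 1 = j; change -j + 1 = -i at h'; lia)
      d_comp_d' := fun i j l _ _ => by
        rw [← Functor.map_comp, ← op_comp, K.unop.d_comp_d]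
        exact dualGBan_map_zero _ _ }
  map {K L} f :=
    { f := fun n => (dualGBan k G).map (f.unop.f (-n)).op
      comm' := fun i j _ => by
        rw [← Functor.map_comp, ← Functor.map_comp, ← op_comp, ← op_comp, f.unop.comm] }
  map_id _ := rfl
  map_comp _ _ := rfl

/-- The complex underlying the dual is the dual of the underlying complex, so this is the
Hahn-Banach argument of `Ban.QI.dual`. -/
lemma qis_dual {K L : Cpx k G} (f : K ⟶ L) (hf : qis (GBan k G) f) :
    qis (GBan k G) ((dualGCpx k G).map f.op) :=
  (qis_iff _).2 ((qis_iff f).1 hf).dual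

lemma isZero_dual {M : GBan k G} (h : IsZero M) : IsZero (dualObj M) := by
  rw [IsZero.iff_id_eq_zero] at h ⊢
  refine Eq.trans ?_ (dualGBan_map_zero M M)
  rw [← h]
  rfl

variable (k G) in
/-- The dual of a bounded above complex of representations. -/
def dualMinus : (CMinus (GBan k G))ᵒᵖ ⥤ CPlus (GBan k G) :=
  (bddBelow _).lift ((bddAbove _).ι.op ⋙ dualGCpx k G) (fun K => by
    obtain ⟨N, hN⟩ := K.unop.property
    refine ⟨-N, (CochainComplex.isStrictlyGE_iff _ _).2 fun m hm => isZero_dual ?_⟩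
    exact K.unop.obj.isZero_of_isStrictlyLE N (-m) (by lia))

lemma qis_of_isIso {K L : Cpx k G} (f : K ⟶ L) (h : ∀ n, IsIso (f.f n)) :
    qis (GBan k G) f := by
  refine (qis_iff f).2 (Ban.QI.of_bijective _ fun n => ?_)
  have := h n
  refine Function.bijective_iff_has_inverse.2 ⟨(inv (f.f n)).clm, fun x => ?_, fun x => ?_⟩
  · exact congrArg (fun φ : _ ⟶ _ => GBan.Hom.clm φ x) (IsIso.hom_inv_id (f.f n))
  · exact congrArg (fun φ : _ ⟶ _ => GBan.Hom.clm φ x) (IsIso.inv_hom_id (f.f n))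

/-- The underlying complex of a representation placed in degree zero. -/
abbrev single₀ (M : GBan k G) : Cpx k G := (CochainComplex.singleFunctor (GBan k G) 0).obj M

/-- The dual of the isomorphism between a representation and the degree zero term of the
corresponding complex. -/
def dualSingleX (M : GBan k G) : dualObj M ≅ ((dualGCpx k G).obj (.op (single₀ M))).X 0 :=
  (dualGBan k G).mapIso (HomologicalComplex.singleObjXSelf (ComplexShape.up ℤ) 0 M).op

lemma isZero_single₀ (M : GBan k G) (n : ℤ) (h : n ≠ 0) : IsZero ((single₀ M).X n) :=
  HomologicalComplex.isZero_single_obj_X (ComplexShape.up ℤ) 0 M n h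

lemma dualSingleX_comp_d (M : GBan k G) (n : ℤ) (hn : (ComplexShape.up ℤ).Rel 0 n) :
    (dualSingleX M).hom ≫ ((dualGCpx k G).obj (.op (single₀ M))).d 0 n = 0 :=
  (isZero_dual (isZero_single₀ M (-n) (by
    change (0 : ℤ) + 1 = n at hn; lia))).eq_of_tgt _ _

/-- The comparison between duals of representations and duals of complexes. -/
def dualSingleHom (M : GBan k G) :
    single₀ (dualObj M) ⟶ (dualGCpx k G).obj (.op (single₀ M)) :=
  HomologicalComplex.mkHomFromSingle (dualSingleX M).hom (dualSingleX_comp_d M)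

lemma dualSingleHom_f (M : GBan k G) : (dualSingleHom M).f 0 =
    (HomologicalComplex.singleObjXSelf (ComplexShape.up ℤ) 0 (dualObj M)).hom ≫
      (dualSingleX M).hom :=
  HomologicalComplex.mkHomFromSingle_f (dualSingleX M).hom (dualSingleX_comp_d M)

lemma single_map_f_comp {M N : GBan k G} (f : M ⟶ N) :
    ((CochainComplex.singleFunctor (GBan k G) 0).map f).f 0 ≫
      (HomologicalComplex.singleObjXSelf (ComplexShape.up ℤ) 0 N).hom =
    (HomologicalComplex.singleObjXSelf (ComplexShape.up ℤ) 0 M).hom ≫ f := by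
  have := HomologicalComplex.single_map_f_self (ComplexShape.up ℤ) 0 f
  refine (congrArg (· ≫ (HomologicalComplex.singleObjXSelf (ComplexShape.up ℤ) 0 N).hom)
    this).trans ?_
  simp

/-- The term in degree zero of a single complex is only canonically isomorphic to the
representation, so the square needs proof. It is determined in degree zero, where it combines
naturality of that isomorphism for the dual of `f` with the dual of its naturality for `f`. -/
lemma dualSingleHom_naturality {M N : GBan k G} (f : M ⟶ N) :
    (CochainComplex.singleFunctor (GBan k G) 0).map ((dualGBan k G).map f.op) ≫
      dualSingleHom M = dualSingleHom N ≫
        (dualGCpx k G).map ((CochainComplex.singleFunctor (GBan k G) 0).map f).op := by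
  refine HomologicalComplex.from_single_hom_ext ?_
  have h₁ := congrArg (fun φ : _ ⟶ N => (dualGBan k G).map φ.op) (single_map_f_comp f)
  have h₂ := single_map_f_comp ((dualGBan k G).map f.op)
  change ((CochainComplex.singleFunctor (GBan k G) 0).map ((dualGBan k G).map f.op)).f 0 ≫
    (dualSingleHom M).f 0 = (dualSingleHom N).f 0 ≫ (dualGBan k G).map
      (((CochainComplex.singleFunctor (GBan k G) 0).map f).f 0).op
  rw [dualSingleHom_f, dualSingleHom_f]
  refine Eq.trans ?_ (Category.assoc _ _ _).symm
  refine (Category.assoc _ _ _).symm.trans ?_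
  refine (congrArg (· ≫ (dualSingleX M).hom) h₂).trans ?_
  refine (Category.assoc _ _ _).trans ?_
  exact congrArg ((HomologicalComplex.singleObjXSelf (ComplexShape.up ℤ) 0
    (dualObj N)).hom ≫ ·) h₁.symm

/-- An isomorphism in every degree: a composite of isomorphisms in degree zero, and a map between
zero objects elsewhere. -/
lemma qis_dualSingleHom (M : GBan k G) : qis (GBan k G) (dualSingleHom M) := by
  refine qis_of_isIso _ fun n => ?_
  by_cases h : n = 0
  · subst h
    rw [dualSingleHom_f]
    exact IsIso.comp_isIso' (Iso.isIso_hom _) (Iso.isIso_hom _)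
  · have h₁ := isZero_single₀ (dualObj M) n h
    have h₂ : IsZero (((dualGCpx k G).obj (.op (single₀ M))).X n) :=
      isZero_dual (isZero_single₀ M (-n) (by lia))
    exact ⟨0, h₁.eq_of_src _ _, h₂.eq_of_src _ _⟩

variable (k G) in
/-- The dual of the resolution of a representation. -/
abbrev dualRes : (GBan k G)ᵒᵖ ⥤ CPlus (GBan k G) :=
  (CMinus.single (GBan k G) ⋙ P k G).op ⋙ dualMinus k G

variable (k G) in
/-- The comparison between the dual of a representation and the dual of its resolution. -/
def toDualRes : dualGBan k G ⋙ CPlus.single (GBan k G) ⟶ dualRes k G where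
  app M := ⟨dualSingleHom M.unop ≫
    (dualGCpx k G).map ((Pε k G).app ((CMinus.single (GBan k G)).obj M.unop)).hom.op⟩
  naturality M N f := by
    refine ObjectProperty.hom_ext _ ?_
    have h₁ := dualSingleHom_naturality f.unop
    have h₂ : (dualGCpx k G).map ((CochainComplex.singleFunctor (GBan k G) 0).map f.unop).op ≫
        (dualGCpx k G).map ((Pε k G).app ((CMinus.single (GBan k G)).obj N.unop)).hom.op =
        (dualGCpx k G).map ((Pε k G).app ((CMinus.single (GBan k G)).obj M.unop)).hom.op ≫
          (dualGCpx k G).map ((P k G).map ((CMinus.single (GBan k G)).map f.unop)).hom.op :=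
      congrArg (fun g : (P k G).obj ((CMinus.single (GBan k G)).obj N.unop) ⟶
          (CMinus.single (GBan k G)).obj M.unop => (dualGCpx k G).map g.hom.op)
        ((Pε k G).naturality ((CMinus.single (GBan k G)).map f.unop)).symm
    change (CochainComplex.singleFunctor (GBan k G) 0).map ((dualGBan k G).map f) ≫
      dualSingleHom N.unop ≫
        (dualGCpx k G).map ((Pε k G).app ((CMinus.single (GBan k G)).obj N.unop)).hom.op =
      (dualSingleHom M.unop ≫
        (dualGCpx k G).map ((Pε k G).app ((CMinus.single (GBan k G)).obj M.unop)).hom.op) ≫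
        (dualGCpx k G).map ((P k G).map ((CMinus.single (GBan k G)).map f.unop)).hom.op
    refine (Category.assoc _ _ _).symm.trans ?_
    refine (congrArg (· ≫ (dualGCpx k G).map
      ((Pε k G).app ((CMinus.single (GBan k G)).obj N.unop)).hom.op) h₁).trans ?_
    refine (Category.assoc _ _ _).trans ?_
    refine (congrArg (dualSingleHom M.unop ≫ ·) h₂).trans ?_
    exact (Category.assoc _ _ _).symm

lemma qisPlus_toDualRes (M : (GBan k G)ᵒᵖ) : qisPlus (GBan k G) ((toDualRes k G).app M) :=
  (qis_iff _).2 (((qis_iff _).1 (qis_dualSingleHom M.unop)).comp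
    ((qis_iff _).1 (qis_dual _ (qisMinus_Pε ((CMinus.single (GBan k G)).obj M.unop)))))

/-- Degree `p` of the dual is the dual of degree `-p` of the resolution, where the augmentation has
an equivariant section. Hence invariants of the dual resolution need no further resolution. -/
lemma exists_retraction_dualRes (M : (GBan k G)ᵒᵖ) (p : ℤ) :
    ∃ r : linfObj (((dualRes k G).obj M).obj.X p) ⟶ ((dualRes k G).obj M).obj.X p,
      linfOrbit (((dualRes k G).obj M).obj.X p) ≫ r = 𝟙 _ :=
  exists_retraction_dual _ (exists_section_P _ (-p))

/-! Duals of coinvariants -/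

lemma apply_coinvariantsKer {M : GBan k G} (φ : M →L[k] k) (hφ : ∀ g m, φ (M.ρ g m) = φ m) :
    M.coinvariantsKer ≤ LinearMap.ker (φ : M →ₗ[k] k) := by
  refine Submodule.topologicalClosure_minimal _ ?_ (ContinuousLinearMap.isClosed_ker φ)
  rw [Submodule.span_le]
  rintro _ ⟨m, g, rfl⟩
  change φ (m - M.ρ g m) = 0
  rw [map_sub, hφ, sub_self]

lemma mk_ρ (M : GBan k G) (g : G) (m : M) :
    (Submodule.Quotient.mk (M.ρ g m) : M ⧸ M.coinvariantsKer) = Submodule.Quotient.mk m := by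
  refine ((Submodule.Quotient.eq _).2 ?_).symm
  exact Submodule.le_topologicalClosure _ (Submodule.subset_span ⟨m, g, rfl⟩)

variable (k G) in
/-- The comparison between functionals on coinvariants and invariant functionals. -/
def dualCoinvariants : (coinvariants k G).op ⋙ dualBan k ⟶ dualGBan k G ⋙ invariants k G where
  app M := ⟨((ContinuousLinearMap.compL k M.unop (M.unop ⧸ M.unop.coinvariantsKer) k).flip
      M.unop.coinvariantsKer.mkQL).codRestrict (dualObj M.unop).invariantsSubmodule
      fun φ g => ContinuousLinearMap.ext fun m => congrArg φ (mk_ρ M.unop g⁻¹ m)⟩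
  naturality _ _ _ := rfl

/-- A continuous functional is invariant exactly when it kills all `m - g m`, hence their closed
span. Bijectivity is all that is recorded, because it already makes a chain map a quasi-isomorphism.
-/
lemma bijective_dualCoinvariants (M : (GBan k G)ᵒᵖ) :
    Function.Bijective ((dualCoinvariants k G).app M).clm := by
  constructor
  · intro φ ψ h
    refine ContinuousLinearMap.ext fun x => ?_
    obtain ⟨m, rfl⟩ := Submodule.Quotient.mk_surjective _ x
    exact congrArg (fun θ : M.unop →L[k] k => θ m) (congrArg Subtype.val h)
  · rintro ⟨(φ : M.unop →L[k] k), hφ⟩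
    -- The contragredient action involves an inverse, so invariance is used at `g⁻¹`.
    have hφ' : ∀ g m, φ (M.unop.ρ g m) = φ m := fun g m => by
      have := congrArg (fun θ : M.unop →L[k] k => θ m) (hφ g⁻¹)
      refine Eq.trans ?_ this
      change _ = φ (M.unop.ρ g⁻¹⁻¹ m)
      rw [inv_inv]
    let ψ : (M.unop ⧸ M.unop.coinvariantsKer) →L[k] k :=
      ⟨Submodule.liftQ _ (φ : M.unop →ₗ[k] k) (apply_coinvariantsKer φ hφ'), by
        refine (Submodule.isOpenQuotientMap_mkQ _).isQuotientMap.continuous_iff.2 ?_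
        exact φ.continuous⟩
    exact ⟨ψ, Subtype.ext (ContinuousLinearMap.ext fun m => rfl)⟩

variable (k G) in
/-- The comparison between the dual of the coinvariants and the invariants of the dual of a
complex. -/
def dualCoinvariantsCpx : ((coinvariants k G).mapHomologicalComplex (ComplexShape.up ℤ)).op ⋙
    dualCpx k ⟶ dualGCpx k G ⋙ (invariants k G).mapHomologicalComplex (ComplexShape.up ℤ) where
  app K :=
    { f := fun n => (dualCoinvariants k G).app (.op (K.unop.X (-n)))
      comm' := fun i j _ => ((dualCoinvariants k G).naturality (K.unop.d (-j) (-i)).op).symm }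
  naturality _ _ _ := rfl

lemma qi_dualCoinvariantsCpx (K : (Cpx k G)ᵒᵖ) : Ban.QI ((dualCoinvariantsCpx k G).app K) :=
  Ban.QI.of_bijective _ fun n => bijective_dualCoinvariants (.op (K.unop.X (-n)))

end GBan

/-! ### Annihilators of closed subcomplexes -/

/-- Natural quasi-isomorphisms of complexes induce isomorphisms of functors to `D(Ban)`. -/
def isoOfQI {C : Type*} [Category* C] {F F' : C ⥤ Ban.Cpx.{u} k} (τ : F ⟶ F')
    (h : ∀ X, Ban.QI (τ.app X)) : F ⋙ (qis (Ban.{u} k)).Q ≅ F' ⋙ (qis (Ban.{u} k)).Q :=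
  haveI : ∀ X, IsIso ((Functor.whiskerRight τ (qis (Ban.{u} k)).Q).app X) := fun X =>
    Localization.inverts (qis (Ban.{u} k)).Q (qis (Ban.{u} k)) (τ.app X)
      ((Ban.qis_iff _).2 (h X))
  haveI := NatIso.isIso_of_isIso_app (Functor.whiskerRight τ (qis (Ban.{u} k)).Q)
  asIso (Functor.whiskerRight τ (qis (Ban.{u} k)).Q)

/-- The morphism from a quotient induced by a morphism that vanishes on the subspace. -/
def Ban.quotLift {E F : Ban.{u} k} (S : Submodule k E) (hS : IsClosed (S : Set E)) (f : E ⟶ F)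
    (h : ∀ x ∈ S, f.clm x = 0) : Ban.quot E S hS ⟶ F :=
  ⟨⟨Submodule.liftQ S (f.clm : E →ₗ[k] F) h, by
    refine (Submodule.isOpenQuotientMap_mkQ S).isQuotientMap.continuous_iff.2 ?_
    exact f.clm.continuous⟩⟩

namespace ClosedSubcomplex

variable {S T : ClosedSubcomplex.{u} k}

/-- `T` assigns to dual complexes the annihilator of `S`. -/
def Annihilates (T S : ClosedSubcomplex.{u} k) : Prop :=
  ∀ (K : (Ban.Cpx.{u} k)ᵒᵖ) (n : ℤ) (φ : K.unop.X (-n) →L[k] k),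
    φ ∈ T.S ((dualCpx k).obj K) n ↔ ∀ x ∈ S.S K.unop (-n), φ x = 0

/-- Restriction of functionals to a closed subcomplex. -/
def dualSub (h : Annihilates T S) : dualCpx k ⋙ T.quot ⟶ S.sub.op ⋙ dualCpx k where
  app K :=
    { f := fun n => Ban.quotLift _ (T.closed _ n)
        (Ban.dualMap (Ban.subι (K.unop.X (-n)) _ (S.closed K.unop (-n))))
        (fun φ hφ => ContinuousLinearMap.ext fun x => (h K n φ).1 hφ x.1 x.2)
      comm' := fun _ _ _ => Ban.quot_hom_ext rfl }
  naturality _ _ _ := HomologicalComplex.hom_ext _ _ fun _ => Ban.quot_hom_ext rfl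

/-- The dual of a subspace is the dual of the space modulo the annihilator; surjectivity is the
Hahn-Banach extension of functionals. -/
lemma bijective_dualSub (h : Annihilates T S) (K : (Ban.Cpx.{u} k)ᵒᵖ) (n : ℤ) :
    Function.Bijective (((dualSub h).app K).f n).clm := by
  constructor
  · refine (injective_iff_map_eq_zero _).2 fun φ hφ => ?_
    obtain ⟨φ, rfl⟩ := Submodule.Quotient.mk_surjective _ φ
    refine (Submodule.Quotient.mk_eq_zero _).2 ((h K n φ).2 fun x hx => ?_)
    exact congrArg (fun θ : S.S K.unop (-n) →L[k] k => θ ⟨x, hx⟩) hφ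
  · intro (ψ : S.S K.unop (-n) →L[k] k)
    obtain ⟨φ, hφ, -⟩ := exists_extension_norm_eq (S.S K.unop (-n)) ψ
    exact ⟨Submodule.Quotient.mk φ, ContinuousLinearMap.ext fun x => hφ x⟩

/-- Functionals on a quotient complex as functionals on the complex. -/
def dualQuot (h : Annihilates T S) : S.quot.op ⋙ dualCpx k ⟶ dualCpx k ⋙ T.sub where
  app K :=
    { f := fun n => ⟨((ContinuousLinearMap.compL k (K.unop.X (-n))
          (K.unop.X (-n) ⧸ S.S K.unop (-n)) k).flip (S.S K.unop (-n)).mkQL).codRestrict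
            (T.S ((dualCpx k).obj K) n) (fun φ => (h K n _).2 fun _ hx =>
              (congrArg φ ((Submodule.Quotient.mk_eq_zero _).2 hx)).trans (map_zero φ))⟩
      comm' := fun _ _ _ => rfl }
  naturality _ _ _ := rfl

/-- Functionals on a quotient are the functionals that vanish on the subspace; no extension is
needed. -/
lemma bijective_dualQuot (h : Annihilates T S) (K : (Ban.Cpx.{u} k)ᵒᵖ) (n : ℤ) :
    Function.Bijective (((dualQuot h).app K).f n).clm := by
  constructor
  · intro φ ψ hφψ
    refine ContinuousLinearMap.ext fun x => ?_
    obtain ⟨x, rfl⟩ := Submodule.Quotient.mk_surjective _ x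
    exact congrArg (fun θ : K.unop.X (-n) →L[k] k => θ x) (congrArg Subtype.val hφψ)
  · rintro ⟨(φ : K.unop.X (-n) →L[k] k), hφ⟩
    let ψ : (K.unop.X (-n) ⧸ S.S K.unop (-n)) →L[k] k :=
      ⟨Submodule.liftQ _ (φ : K.unop.X (-n) →ₗ[k] k) ((h K n φ).1 hφ), by
        refine (Submodule.isOpenQuotientMap_mkQ _).isQuotientMap.continuous_iff.2 ?_
        exact φ.continuous⟩
    exact ⟨ψ, Subtype.ext (ContinuousLinearMap.ext fun _ => rfl)⟩

end ClosedSubcomplex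

/-- In degree `n = -m`, a functional vanishes on the closure of a range exactly when it vanishes on
the range, that is, when the transposed differential kills it. In the other degrees one side is
everything and the other is zero. -/
lemma annihilates_cyclesSub (m : ℤ) :
    ClosedSubcomplex.Annihilates (cyclesSub.{u} k (-m)) (imageSub k m) := by
  intro K n φ
  refine (mem_cyclesSub (-m) ((dualCpx k).obj K) n φ).trans ?_
  constructor
  · rintro ⟨h₁, h₂⟩ x hx
    rw [mem_imageSub] at hx
    rcases lt_trichotomy n (-m) with hn | hn | hn
    · rw [hx.2 (by lia), map_zero]
    · refine Ban.im_le (K.unop.d (-n - 1) (-n)) (LinearMap.ker (φ : K.unop.X (-n) →ₗ[k] k))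
        (ContinuousLinearMap.isClosed_ker φ) (fun y => ?_) (hx.1 (by lia))
      have h := h₁ hn
      have e : -n - 1 = -(n + 1) := by lia
      -- The degrees `-n - 1` and `-(n + 1)` agree but are different expressions; generalizing to
      -- `p` allows substitution.
      have key : ∀ p (hp : p = -(n + 1)) (y : K.unop.X p),
          φ ((K.unop.d p (-n)).clm y) = 0 := by
        rintro p rfl y
        exact congrArg (fun θ : K.unop.X (-(n + 1)) →L[k] k => θ y) h
      exact key _ e y
    · exact congrArg (fun θ : K.unop.X (-n) →L[k] k => θ x) (h₂ hn)
  · intro h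
    constructor
    · intro hn
      refine ContinuousLinearMap.ext fun y => ?_
      refine h _ ((mem_imageSub m _ _ _).2 ⟨fun _ => ?_, by lia⟩)
      have key : ∀ p (hp : p = -(n + 1)), (K.unop.d (-(n + 1)) (-n)).clm y ∈
          Ban.im (K.unop.d p (-n)) := by
        rintro p rfl
        exact Ban.apply_mem_im _ _
      exact key _ (by lia)
    · intro hn
      exact ContinuousLinearMap.ext fun y =>
        h y ((mem_imageSub m _ _ _).2 ⟨by lia, by lia⟩)

/-! ### The two left truncations commute -/

lemma mk_mem_cyclesSub (C : Ban.Cpx.{u} k) (n : ℤ) (x : C.X n) (hx : x ∈ (cyclesSub k 0).S C n) :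
    ((cyclesSub k (-1)).S C n).mkQL x ∈ (cyclesSub k 0).S ((leftTruncGE k).obj C) n := by
  rw [mem_cyclesSub] at hx
  refine (mem_cyclesSub 0 ((leftTruncGE k).obj C) n _).2 ⟨fun hn => ?_, fun hn => ?_⟩
  · change ((cyclesSub k (-1)).S C (n + 1)).mkQL ((C.d n (n + 1)).clm x) = 0
    rw [hx.1 hn, map_zero]
  · exact (congrArg ((cyclesSub k (-1)).S C n).mkQL (hx.2 hn)).trans (map_zero _)

/-- The projection to the left truncation restricts to the left truncations. -/
def leftTruncCommAux (C : Ban.Cpx.{u} k) (n : ℤ) : ((leftTruncLE k).obj C).X n ⟶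
    ((leftTruncLE k).obj ((leftTruncGE k).obj C)).X n :=
  ⟨(((cyclesSub k (-1)).S C n).mkQL.comp ((cyclesSub k 0).S C n).subtypeL).codRestrict
    ((cyclesSub k 0).S ((leftTruncGE k).obj C) n) (fun x => mk_mem_cyclesSub C n x.1 x.2)⟩

variable (k) in
/-- The comparison between the two orders of left truncation. -/
def leftTruncComm : leftTruncLE.{u} k ⋙ leftTruncGE k ⟶ leftTruncGE k ⋙ leftTruncLE k where
  app C :=
    { f := fun n => Ban.quotLift _ ((cyclesSub k (-1)).closed _ n) (leftTruncCommAux C n)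
        (fun x hx => by
          rw [mem_cyclesSub] at hx
          refine Subtype.ext ((Submodule.Quotient.mk_eq_zero _).2
            ((mem_cyclesSub (-1) C n x.1).2 ⟨fun hn => ?_, fun hn => ?_⟩))
          · exact congrArg Subtype.val (hx.1 hn)
          · exact congrArg Subtype.val (hx.2 hn))
      comm' := fun _ _ _ => Ban.quot_hom_ext rfl }
  naturality _ _ _ := HomologicalComplex.hom_ext _ _ fun _ => Ban.quot_hom_ext rfl

/-- One truncation changes degree `-1` and removes what lies below, the other changes degree `0` and
removes what lies above, so they do not interfere. -/
lemma bijective_leftTruncComm (C : Ban.Cpx.{u} k) (n : ℤ) :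
    Function.Bijective (((leftTruncComm k).app C).f n).clm := by
  constructor
  · refine (injective_iff_map_eq_zero _).2 fun x hx => ?_
    obtain ⟨x, rfl⟩ := Submodule.Quotient.mk_surjective _ x
    have h : x.1 ∈ (cyclesSub k (-1)).S C n :=
      (Submodule.Quotient.mk_eq_zero _).1 (congrArg Subtype.val hx)
    rw [mem_cyclesSub] at h
    refine (Submodule.Quotient.mk_eq_zero _).2
      ((mem_cyclesSub (-1) ((leftTruncLE k).obj C) n x).2 ⟨fun hn => ?_, fun hn => ?_⟩)
    · exact Subtype.ext (h.1 hn)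
    · exact Subtype.ext (h.2 hn)
  · rintro ⟨x, hx⟩
    have hx' := (mem_cyclesSub 0 ((leftTruncGE k).obj C) n x).1 hx
    by_cases hn : 0 < n
    · refine ⟨0, (map_zero _).trans (Subtype.ext (hx'.2 hn).symm)⟩
    · obtain ⟨x, rfl⟩ := Submodule.Quotient.mk_surjective _ x
      refine ⟨Submodule.Quotient.mk (⟨x, (mem_cyclesSub 0 C n x).2 ⟨fun h => ?_, by lia⟩⟩ :
        (cyclesSub k 0).S C n), rfl⟩
      -- For `n = 0`, the differential of `x` is zero modulo a subcomplex concentrated in degrees at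
      -- most `-1`, hence is zero.
      have h' : (C.d n (n + 1)).clm x ∈ (cyclesSub k (-1)).S C (n + 1) :=
        (Submodule.Quotient.mk_eq_zero _).1 (hx'.1 h)
      exact ((mem_cyclesSub (-1) C (n + 1) _).1 h').2 (by lia)

/-! ### Duals of shifted complexes -/

/-- The degrees `-(i + n)` and `-i + -n` are only propositionally equal, so shifting and dualizing
agree only up to transport along this equality. -/
lemma XIsoOfEq_d_apply (K : Ban.Cpx.{u} k) {p p' q q' : ℤ} (hp : p = p') (hq : q = q')
    (x : K.X p) : (K.XIsoOfEq hq).hom.clm ((K.d p q).clm x) =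
      (K.d p' q').clm ((K.XIsoOfEq hp).hom.clm x) := by
  subst hp hq
  simp

lemma XIsoOfEq_f_apply {K L : Ban.Cpx.{u} k} (f : K ⟶ L) {p p' : ℤ} (hp : p = p')
    (x : K.X p) : (L.XIsoOfEq hp).hom.clm ((f.f p).clm x) =
      (f.f p').clm ((K.XIsoOfEq hp).hom.clm x) := by
  subst hp
  simp

lemma bijective_XIsoOfEq (K : Ban.Cpx.{u} k) {p p' : ℤ} (hp : p = p') :
    Function.Bijective (Ban.dualMap (K.XIsoOfEq hp).hom).clm := by
  subst hp
  rw [HomologicalComplex.XIsoOfEq_rfl]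
  exact Function.bijective_id

variable (k) in
/-- The comparison between duals of shifted complexes and shifted duals. -/
def dualShift (n : ℤ) : (shiftFunctor (Ban.Cpx.{u} k) (-n)).op ⋙ dualCpx k ⟶
    dualCpx k ⋙ shiftFunctor (Ban.Cpx.{u} k) n where
  app K :=
    { f := fun i => Ban.dualMap (K.unop.XIsoOfEq (show -(i + n) = -i + -n by lia)).hom
      comm' := fun i j _ => by
        refine Ban.hom_ext fun (φ : K.unop.X (-i + -n) →L[k] k) =>
          ContinuousLinearMap.ext fun (x : K.unop.X (-(j + n))) => ?_
        have h := XIsoOfEq_d_apply K.unop (show -(j + n) = -j + -n by lia)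
          (show -(i + n) = -i + -n by lia) x
        change n.negOnePow • φ ((K.unop.XIsoOfEq (show -(i + n) = -i + -n by lia)).hom.clm
            ((K.unop.d (-(j + n)) (-(i + n))).clm x)) =
          φ ((-n).negOnePow • (K.unop.d (-j + -n) (-i + -n)).clm
            ((K.unop.XIsoOfEq (show -(j + n) = -j + -n by lia)).hom.clm x))
        -- Shifts by `n` and by `-n` put the same sign on the differential, so the comparison map
        -- itself needs no sign.
        rw [h, Int.negOnePow_neg, Units.smul_def, Units.smul_def, map_zsmul] }
  naturality K L f := by
    refine HomologicalComplex.hom_ext _ _ fun i => ?_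
    refine Ban.hom_ext fun (φ : K.unop.X (-i + -n) →L[k] k) =>
      ContinuousLinearMap.ext fun (x : L.unop.X (-(i + n))) => ?_
    exact congrArg φ (XIsoOfEq_f_apply f.unop (show -(i + n) = -i + -n by lia) x).symm

lemma bijective_dualShift (n : ℤ) (K : (Ban.Cpx.{u} k)ᵒᵖ) (i : ℤ) :
    Function.Bijective (((dualShift k n).app K).f i).clm :=
  bijective_XIsoOfEq K.unop _

/-! ### Duality on the hearts -/

/-- `descend T` is computed by `T`, naturally. -/
def descendQ (T : Ban.Cpx.{u} k ⥤ Ban.Cpx.{u} k)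
    (hT : ∀ {K L : Ban.Cpx.{u} k} (f : K ⟶ L), Ban.QI f → Ban.QI (T.map f)) :
    (qis (Ban.{u} k)).Q ⋙ descend T hT ≅ T ⋙ (qis (Ban.{u} k)).Q :=
  Localization.fac (T ⋙ (qis (Ban.{u} k)).Q) _ (qis (Ban.{u} k)).Q

variable (k) in
/-- The duality functor on `D(Ban)` is computed by dual complexes, naturally. -/
def dualDQ : (qis (Ban.{u} k)).Q.op ⋙ dualD k ≅ dualCpx k ⋙ (qis (Ban.{u} k)).Q :=
  NatIso.ofComponents (fun K => dualDIso K.unop) (fun f =>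
    (congrArg Quiver.Hom.unop ((Localization.fac ((dualCpx k).rightOp ⋙ (qis (Ban.{u} k)).Q.op) _
      (qis (Ban.{u} k)).Q).inv.naturality f.unop)).symm)

/-- Three successive endofunctors of `D(Ban)` are computed by endofunctors of complexes. -/
def descendQ₃ (T₁ T₂ T₃ : Ban.Cpx.{u} k ⥤ Ban.Cpx.{u} k)
    (h₁ : ∀ {K L : Ban.Cpx.{u} k} (f : K ⟶ L), Ban.QI f → Ban.QI (T₁.map f))
    (h₂ : ∀ {K L : Ban.Cpx.{u} k} (f : K ⟶ L), Ban.QI f → Ban.QI (T₂.map f))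
    (h₃ : ∀ {K L : Ban.Cpx.{u} k} (f : K ⟶ L), Ban.QI f → Ban.QI (T₃.map f)) :
    (qis (Ban.{u} k)).Q ⋙ descend T₁ h₁ ⋙ descend T₂ h₂ ⋙ descend T₃ h₃ ≅
      (T₁ ⋙ T₂ ⋙ T₃) ⋙ (qis (Ban.{u} k)).Q :=
  Functor.isoWhiskerRight (descendQ T₁ h₁) (descend T₂ h₂ ⋙ descend T₃ h₃) ≪≫
    Functor.isoWhiskerLeft T₁ (Functor.isoWhiskerRight (descendQ T₂ h₂) (descend T₃ h₃)) ≪≫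
    Functor.isoWhiskerLeft (T₁ ⋙ T₂) (descendQ T₃ h₃)

variable (k) in
/-- Left cohomology in terms of complexes. -/
def HLeftQ (n : ℤ) : (qis (Ban.{u} k)).Q ⋙ HLeft k n ⋙ (isLeftHeart k).ι ≅
    (shiftFunctor (Ban.Cpx.{u} k) n ⋙ leftTruncGE k ⋙ leftTruncLE k) ⋙ (qis (Ban.{u} k)).Q :=
  descendQ₃ _ _ _ (fun _ h => h.shift n) (fun _ h => h.cyclesSub_quot (-1))
    (fun _ h => h.cyclesSub_sub 0)

variable (k) in
/-- Right cohomology in terms of complexes. -/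
def HRightQ (n : ℤ) : (qis (Ban.{u} k)).Q ⋙ HRight k n ⋙ (isRightHeart k).ι ≅
    (shiftFunctor (Ban.Cpx.{u} k) n ⋙ rightTruncGE k ⋙ rightTruncLE k) ⋙ (qis (Ban.{u} k)).Q :=
  descendQ₃ _ _ _ (fun _ h => h.shift n) (fun _ h => h.imageSub_quot 0)
    (fun _ h => h.imageSub_sub 1)

variable (k) in
/-- The dual of the right truncations is the left truncation of the dual. -/
def dualTrunc : (rightTruncGE.{u} k ⋙ rightTruncLE k).op ⋙ dualCpx k ⋙ (qis (Ban.{u} k)).Q ≅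
    (dualCpx k ⋙ leftTruncGE k ⋙ leftTruncLE k) ⋙ (qis (Ban.{u} k)).Q :=
  let hLE : ClosedSubcomplex.Annihilates (cyclesSub.{u} k (-1)) (imageSub k 1) :=
    annihilates_cyclesSub 1
  let hGE : ClosedSubcomplex.Annihilates (cyclesSub.{u} k 0) (imageSub k 0) :=
    annihilates_cyclesSub 0
  -- The dual of the subcomplex with the image in degree `1` is the quotient of the dual by the
  -- cycles in degree `-1`.
  let e₁ : (rightTruncGE.{u} k).op ⋙ (dualCpx k ⋙ leftTruncGE k) ⋙ (qis (Ban.{u} k)).Q ≅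
      (rightTruncGE.{u} k).op ⋙ ((rightTruncLE k).op ⋙ dualCpx k) ⋙ (qis (Ban.{u} k)).Q :=
    Functor.isoWhiskerLeft (rightTruncGE.{u} k).op (isoOfQI (ClosedSubcomplex.dualSub hLE)
      (fun K => Ban.QI.of_bijective _ (ClosedSubcomplex.bijective_dualSub hLE K)))
  -- The dual of the quotient by the image in degree `0` is the subcomplex of the dual with the
  -- cycles in degree `0`.
  let e₂ : ((rightTruncGE.{u} k).op ⋙ dualCpx k ⋙ leftTruncGE k) ⋙ (qis (Ban.{u} k)).Q ≅
      (dualCpx k ⋙ leftTruncLE k ⋙ leftTruncGE k) ⋙ (qis (Ban.{u} k)).Q :=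
    isoOfQI (Functor.whiskerRight (ClosedSubcomplex.dualQuot hGE) (leftTruncGE k)) (fun K =>
      (Ban.QI.of_bijective _ (ClosedSubcomplex.bijective_dualQuot hGE K)).cyclesSub_quot (-1))
  -- Duality, being contravariant, has produced the two left truncations in the opposite order.
  let e₃ : dualCpx k ⋙ (leftTruncLE.{u} k ⋙ leftTruncGE k) ⋙ (qis (Ban.{u} k)).Q ≅
      dualCpx k ⋙ (leftTruncGE.{u} k ⋙ leftTruncLE k) ⋙ (qis (Ban.{u} k)).Q :=
    Functor.isoWhiskerLeft (dualCpx k) (isoOfQI (leftTruncComm k)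
      (fun C => Ban.QI.of_bijective _ (bijective_leftTruncComm C)))
  e₁.symm ≪≫ e₂ ≪≫ e₃

variable (k) in
/-- The duality functor on the hearts takes right cohomology to left cohomology of the dual, on
underlying objects of the derived category. -/
def dualHRightQι (n : ℤ) :
    ((qis (Ban.{u} k)).Q.op ⋙ (HRight k (-n)).op ⋙ dualHeart k) ⋙ (isLeftHeart k).ι ≅
      (dualCpx k ⋙ (qis (Ban.{u} k)).Q ⋙ HLeft k n) ⋙ (isLeftHeart k).ι :=
  -- Passing to opposite functors reverses the isomorphism, whence the `symm`.
  let e₁ : ((qis (Ban.{u} k)).Q ⋙ HRight k (-n) ⋙ (isRightHeart k).ι).op ⋙ dualD k ≅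
      ((shiftFunctor (Ban.Cpx.{u} k) (-n) ⋙ rightTruncGE k ⋙ rightTruncLE k) ⋙
        (qis (Ban.{u} k)).Q).op ⋙ dualD k :=
    Functor.isoWhiskerRight (NatIso.op (HRightQ k (-n))).symm (dualD k)
  let e₂ : (shiftFunctor (Ban.Cpx.{u} k) (-n) ⋙ rightTruncGE k ⋙ rightTruncLE k).op ⋙
        (qis (Ban.{u} k)).Q.op ⋙ dualD k ≅
      (shiftFunctor (Ban.Cpx.{u} k) (-n) ⋙ rightTruncGE k ⋙ rightTruncLE k).op ⋙
        dualCpx k ⋙ (qis (Ban.{u} k)).Q :=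
    Functor.isoWhiskerLeft _ (dualDQ k)
  let e₃ : (shiftFunctor (Ban.Cpx.{u} k) (-n)).op ⋙ (rightTruncGE k ⋙ rightTruncLE k).op ⋙
        dualCpx k ⋙ (qis (Ban.{u} k)).Q ≅
      (shiftFunctor (Ban.Cpx.{u} k) (-n)).op ⋙
        (dualCpx k ⋙ leftTruncGE k ⋙ leftTruncLE k) ⋙ (qis (Ban.{u} k)).Q :=
    Functor.isoWhiskerLeft _ (dualTrunc k)
  let e₄ : (((shiftFunctor (Ban.Cpx.{u} k) (-n)).op ⋙ dualCpx k) ⋙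
        leftTruncGE k ⋙ leftTruncLE k) ⋙ (qis (Ban.{u} k)).Q ≅
      ((dualCpx k ⋙ shiftFunctor (Ban.Cpx.{u} k) n) ⋙
        leftTruncGE k ⋙ leftTruncLE k) ⋙ (qis (Ban.{u} k)).Q :=
    isoOfQI (Functor.whiskerRight (dualShift k n) (leftTruncGE k ⋙ leftTruncLE k)) (fun K =>
      ((Ban.QI.of_bijective _ (bijective_dualShift n K)).cyclesSub_quot (-1)).cyclesSub_sub 0)
  let e₅ : dualCpx k ⋙ (shiftFunctor (Ban.Cpx.{u} k) n ⋙ leftTruncGE k ⋙ leftTruncLE k) ⋙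
        (qis (Ban.{u} k)).Q ≅
      dualCpx k ⋙ (qis (Ban.{u} k)).Q ⋙ HLeft k n ⋙ (isLeftHeart k).ι :=
    Functor.isoWhiskerLeft (dualCpx k) (HLeftQ k n).symm
  e₁ ≪≫ e₂ ≪≫ e₃ ≪≫ e₄ ≪≫ e₅

variable (k) in
/-- The duality functor on the hearts takes right cohomology to left cohomology of the dual. -/
def dualHRightQ (n : ℤ) : (qis (Ban.{u} k)).Q.op ⋙ (HRight k (-n)).op ⋙ dualHeart k ≅
    dualCpx k ⋙ (qis (Ban.{u} k)).Q ⋙ HLeft k n :=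
  Functor.fullyFaithfulCancelRight (isLeftHeart k).ι (dualHRightQι k n)

open GBan

/-! ### Duality between `ℓ¹`-homology and bounded cohomology -/

variable (k G) in
/-- A functorial complex computing `ℓ¹`-homology. -/
abbrev l1Cpx : GBan k G ⥤ Ban.Cpx.{u} k :=
  CMinus.single (GBan k G) ⋙ P k G ⋙ mapCMinus (coinvariants k G) ⋙ (bddAbove (Ban.{u} k)).ι

variable (k G) in
/-- A functorial complex computing bounded cohomology. -/
abbrev bddCpx : GBan k G ⥤ Ban.Cpx.{u} k :=
  CPlus.single (GBan k G) ⋙ I k G ⋙ mapCPlus (invariants k G) ⋙ (bddBelow (Ban.{u} k)).ι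

variable (k G) in
/-- `ℓ¹`-homology is computed by `l1Cpx`. -/
def l1HomologyIso (n : ℤ) :
    l1Homology k G n ≅ l1Cpx k G ⋙ (qis (Ban.{u} k)).Q ⋙ HRight k (-n) :=
  let e₁ : CMinus.single (GBan k G) ⋙ ((qisMinus (GBan k G)).Q ⋙
        leftDerivedMinus (coinvariants k G)) ⋙ DMinus.toD (Ban.{u} k) ⋙ HRight k (-n) ≅
      CMinus.single (GBan k G) ⋙ (P k G ⋙ coinvQ k G) ⋙
        DMinus.toD (Ban.{u} k) ⋙ HRight k (-n) :=
    Functor.isoWhiskerLeft _ (Functor.isoWhiskerRight (leftDerivedIso k G) _)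
  let e₂ : (CMinus.single (GBan k G) ⋙ P k G ⋙ mapCMinus (coinvariants k G)) ⋙
        ((qisMinus (Ban.{u} k)).Q ⋙ DMinus.toD (Ban.{u} k)) ⋙ HRight k (-n) ≅
      (CMinus.single (GBan k G) ⋙ P k G ⋙ mapCMinus (coinvariants k G)) ⋙
        ((bddAbove (Ban.{u} k)).ι ⋙ (qis (Ban.{u} k)).Q) ⋙ HRight k (-n) :=
    Functor.isoWhiskerLeft _ (Functor.isoWhiskerRight
      (Localization.fac ((bddAbove (Ban.{u} k)).ι ⋙ (qis (Ban.{u} k)).Q) _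
        (qisMinus (Ban.{u} k)).Q) _)
  e₁ ≪≫ e₂

variable (k G) in
/-- Bounded cohomology is computed by `bddCpx`. -/
def boundedCohomologyIso (n : ℤ) :
    boundedCohomology k G n ≅ bddCpx k G ⋙ (qis (Ban.{u} k)).Q ⋙ HLeft k n :=
  let e₁ : CPlus.single (GBan k G) ⋙ ((qisPlus (GBan k G)).Q ⋙
        rightDerivedPlus (invariants k G)) ⋙ DPlus.toD (Ban.{u} k) ⋙ HLeft k n ≅
      CPlus.single (GBan k G) ⋙ (I k G ⋙ invQ k G) ⋙
        DPlus.toD (Ban.{u} k) ⋙ HLeft k n :=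
    Functor.isoWhiskerLeft _ (Functor.isoWhiskerRight (rightDerivedIso k G) _)
  let e₂ : (CPlus.single (GBan k G) ⋙ I k G ⋙ mapCPlus (invariants k G)) ⋙
        ((qisPlus (Ban.{u} k)).Q ⋙ DPlus.toD (Ban.{u} k)) ⋙ HLeft k n ≅
      (CPlus.single (GBan k G) ⋙ I k G ⋙ mapCPlus (invariants k G)) ⋙
        ((bddBelow (Ban.{u} k)).ι ⋙ (qis (Ban.{u} k)).Q) ⋙ HLeft k n :=
    Functor.isoWhiskerLeft _ (Functor.isoWhiskerRight
      (Localization.fac ((bddBelow (Ban.{u} k)).ι ⋙ (qis (Ban.{u} k)).Q) _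
        (qisPlus (Ban.{u} k)).Q) _)
  e₁ ≪≫ e₂

variable (k G) in
/-- The dual of the complex computing `ℓ¹`-homology computes the bounded cohomology of the dual. -/
def dualL1CpxIso : (l1Cpx k G).op ⋙ dualCpx k ⋙ (qis (Ban.{u} k)).Q ≅
    dualGBan k G ⋙ bddCpx k G ⋙ (qis (Ban.{u} k)).Q :=
  -- The dual of the coinvariants of the resolution is the complex of invariants of the dual
  -- resolution.
  let e₁ : ((CMinus.single (GBan k G) ⋙ P k G ⋙ (bddAbove (GBan k G)).ι).op ⋙
        (((coinvariants k G).mapHomologicalComplex (ComplexShape.up ℤ)).op ⋙ dualCpx k)) ⋙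
          (qis (Ban.{u} k)).Q ≅
      ((CMinus.single (GBan k G) ⋙ P k G ⋙ (bddAbove (GBan k G)).ι).op ⋙
        (dualGCpx k G ⋙ (invariants k G).mapHomologicalComplex (ComplexShape.up ℤ))) ⋙
          (qis (Ban.{u} k)).Q :=
    isoOfQI (Functor.whiskerLeft _ (dualCoinvariantsCpx k G)) (fun _ => qi_dualCoinvariantsCpx _)
  -- The terms of the dual resolution have retractions of the coaugmentation, so resolving once more
  -- by `I` does not change the invariants.
  let e₂ : (dualRes k G ⋙ mapCPlus (invariants k G) ⋙ (bddBelow (Ban.{u} k)).ι) ⋙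
        (qis (Ban.{u} k)).Q ≅
      (dualRes k G ⋙ I k G ⋙ mapCPlus (invariants k G) ⋙ (bddBelow (Ban.{u} k)).ι) ⋙
        (qis (Ban.{u} k)).Q :=
    isoOfQI (Functor.whiskerLeft (dualRes k G) (Functor.whiskerRight (Iη k G)
      (mapCPlus (invariants k G) ⋙ (bddBelow (Ban.{u} k)).ι)))
      (fun M => qi_invariants_Iη _ (exists_retraction_dualRes M))
  -- The map from the dual representation to the dual resolution is a quasi-isomorphism, and
  -- invariants of `I` preserve these. So the dual resolution may replace the dual representation.
  let e₃ : ((dualGBan k G ⋙ CPlus.single (GBan k G)) ⋙ I k G ⋙ mapCPlus (invariants k G) ⋙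
        (bddBelow (Ban.{u} k)).ι) ⋙ (qis (Ban.{u} k)).Q ≅
      (dualRes k G ⋙ I k G ⋙ mapCPlus (invariants k G) ⋙ (bddBelow (Ban.{u} k)).ι) ⋙
        (qis (Ban.{u} k)).Q :=
    isoOfQI (Functor.whiskerRight (toDualRes k G)
      (I k G ⋙ mapCPlus (invariants k G) ⋙ (bddBelow (Ban.{u} k)).ι))
      (fun M => qi_invariants_I _ (qisPlus_toDualRes M))
  e₁ ≪≫ e₂ ≪≫ e₃.symm

variable (k G) in
/-- The duality between `ℓ¹`-homology and bounded cohomology. -/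
def dualL1HomologyIso (n : ℤ) : (l1Homology k G n).op ⋙ dualHeart k ≅
    dualGBan k G ⋙ boundedCohomology k G n :=
  let e₁ : (l1Homology k G n).op ⋙ dualHeart k ≅
      (l1Cpx k G).op ⋙ (qis (Ban.{u} k)).Q.op ⋙ (HRight k (-n)).op ⋙ dualHeart k :=
    Functor.isoWhiskerRight (NatIso.op (l1HomologyIso k G n)).symm (dualHeart k)
  let e₂ : (l1Cpx k G).op ⋙ (qis (Ban.{u} k)).Q.op ⋙ (HRight k (-n)).op ⋙ dualHeart k ≅
      (l1Cpx k G).op ⋙ dualCpx k ⋙ (qis (Ban.{u} k)).Q ⋙ HLeft k n :=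
    Functor.isoWhiskerLeft _ (dualHRightQ k n)
  let e₃ : ((l1Cpx k G).op ⋙ dualCpx k ⋙ (qis (Ban.{u} k)).Q) ⋙ HLeft k n ≅
      (dualGBan k G ⋙ bddCpx k G ⋙ (qis (Ban.{u} k)).Q) ⋙ HLeft k n :=
    Functor.isoWhiskerRight (dualL1CpxIso k G) (HLeft k n)
  let e₄ : dualGBan k G ⋙ bddCpx k G ⋙ (qis (Ban.{u} k)).Q ⋙ HLeft k n ≅
      dualGBan k G ⋙ boundedCohomology k G n :=
    Functor.isoWhiskerLeft _ (boundedCohomologyIso k G n).symm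
  e₁ ≪≫ e₂ ≪≫ e₃ ≪≫ e₄

end

end BanachDuality

theorem mainTheorem1 (k : Type) [RCLike k] (G : Type u) [Group G] :
    ∃ (_ : BanachDuality.HasL (BanachDuality.coinvariants k G))
      (_ : BanachDuality.HasR (BanachDuality.invariants k G)),
      ∀ n : ℤ, Nonempty
        ((BanachDuality.l1Homology k G n).op ⋙ BanachDuality.dualHeart k ≅
          BanachDuality.dualGBan k G ⋙ BanachDuality.boundedCohomology k G n) :=
  ⟨BanachDuality.hasL_coinvariants, BanachDuality.hasR_invariants,
    fun n => ⟨BanachDuality.dualL1HomologyIso k G n⟩⟩
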